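/- For real $\lambda,\mu,\beta$ let $Z_{\lambda,\mu,\beta}=(X,Y)$ be the non-smooth vector field on $\mathbb R^2$ with discontinuity line $\Sigma=\{y=0\}$ given by $$X(x,y)=(1,\;x-\lambda)\ \ (y\ge 0),\qquad Y(x,y)=\Big(\tfrac{\mu}{2}x+\tfrac{\mu-2}{2}(y+\beta),\ \tfrac{\mu-2}{2}x+\tfrac{\mu}{2}(y+\beta)\Big)\ \ (y\le 0).$$ With $f(x,y)=y$, the sewing, escaping and sliding regions of $\Sigma$ are $\Sigma_1=\{(X.f)(Y.f)>0\}$, $\Sigma_2=\{X.f>0>Y.f\}$, $\Sigma_3=\{X.f<0<Y.f\}$. On $\Sigma_2\cup\Sigma_3$ the sliding vector field $Z^\Sigma$ (Filippov's convention) has horizontal component $H=(Y_2X_1-X_2Y_1)/(Y_2-X_2)$, and its zeros are the pseudo equilibria. A pseudo equilibrium is a $\Sigma$-saddle if it is an attractor of $Z^\Sigma$ in $\Sigma_2$ or a repeller in $\Sigma_3$; a $\Sigma$-repeller if it is a repeller in $\Sigma_2$; a $\Sigma$-attractor if it is an attractor in $\Sigma_3$. A tangential singularity is a point of $\Sigma$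 where $(X.f)(Y.f)=0$ and neither $X$ nor $Y$ vanishes. A point of $\Sigma$ with $X.f=0\ne X^2.f$ is a fold of $X$, visible if $X^2.f>0$; a point with $Y.f=0\neq Y^2.f$ is a fold of $Y$, visible if $Y^2.f<0$. Write $d=(\lambda,0)$, $c=\mu\beta/(2-\mu)$, $S=(0,-\beta)$, $h=(-\beta,0)$, $j=(\beta,0)$, and let $$R=\{(\lambda,\beta):\ |\lambda|<1,\ |\beta|<1,\ |\lambda|+\beta<1\}.$$ The *configuration* of $Z$ is the following data up to an increasing homeomorphism of $\Sigma$: the signs of $X.f$ and $Y.f$ along $\Sigma$, the visibility of the folds of $X$ and of $Y$, the zeros of $X$ and $Y$ on $\Sigma$, the sign of $H$ on $\Sigma_2\cup\Sigma_3$, and the points of $\Sigma$ first met by stable and unstable separatrices of saddles of $X$ in $y>0$ and of $Y$ in $y<0$; together with the numbers of these saddles. The *topological behaviour* of $Z$ is the number of its singular points of each type: saddle off $\Sigma$ (of $X$ in $y>0$ or of $Y$ in $y<0$); saddle of one field on $\Sigma$ where the other is transverse to $\Sigma$; saddle of one field on $\Sigma$ at a visible, or invisible, fold of the other; visible, or invisible,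 fold of one field where the other is transverse; common fold of both fields (visible–visible, visible–invisible, invisible–invisible); $\Sigma$-saddle; $\Sigma$-attractor; $\Sigma$-repeller. **Theorem.** Let $\mu<0$ (in particular, $-\varepsilon_0<\mu<0$ for any $\varepsilon_0>0$). The region $R$ is partitioned into the thirteen cases - $\beta<0$: (1) $\lambda<c$, (2) $\lambda=c$, (3) $\lambda>c$; - $\beta=0$: (4) $\lambda<0$, (5) $\lambda=0$, (6) $\lambda>0$; - $\beta>0$: (7) $\lambda<-\beta$, (8) $\lambda=-\beta$, (9) $-\beta<\lambda<c$, (10) $\lambda=c$, (11) $c<\lambda<\beta$, (12) $\lambda=\beta$, (13) $\lambda>\beta$, each of which occurs arbitrarily close to $(\lambda,\beta)=(0,0)$. For $(\lambda,\beta)\in R$ the systems $Z_{\lambda,\mu,\beta}$ have exactly $13$ distinct configurations, one for each case, and exactly $7$ distinct topological behaviours, represented by cases 1, 2, 4, 5, 7, 10, 11: cases 1, 3 share a behaviour, so do 4, 6, so do 7, 8, 9, and so do 11, 12, 13, and there are no other coincidences. Every singular point (a zero of $X$ in $y>0$, a zero of $Y$ in $y<0$, or a point of $\Sigma\setminus\Sigma_1$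 that does not lie in $\Sigma_2\cup\Sigma_3$ with $Z^\Sigma\neq 0$) has exactly one of the types. Moreover, for all $(\lambda,\beta)\in R$: - on $\Sigma$, the sliding region is $x<\min(\lambda,c)$, the escaping region is $x>\max(\lambda,c)$ and the sewing region is $\min(\lambda,c)<x<\max(\lambda,c)$; $d$ is the only fold of $X$ and is visible; $Y$ has the unique fold $(c,0)$ if $\beta\neq0$, visible for $\beta<0$ and invisible for $\beta>0$, and none if $\beta=0$; $S$ is the only zero of $Y$ and is a saddle; it lies in $y<0$ iff $\beta>0$, and then its unstable separatrix meets $\Sigma$ at $h$ and its stable separatrix at $j$, and these are the only such points; there is no equilibrium of $Y$ in $y<0$ if $\beta\le 0$, and none of $X$; - there is a $\Sigma$-saddle $Q=(q,0)$ in the escaping region, with $q=\dfrac{B-\sqrt{B^2+4\mu\beta(\mu+\lambda(\mu-2))}}{2\mu}$, $B=(\mu-2)(1-\beta)+\lambda\mu$, and $q>\max(\lambda,c,0,|\beta|)$, so $Q$ lies to the right of $d$, of $(c,0)$, of $S$, and of $h$ and $j$; - in cases 1–6 and 10, $Q$ is the only pseudo equilibrium, and on $\Sigma_2\cup\Sigma_3$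 one has $H>0$ iff $x<q$; - in cases 7–9 the pseudo equilibria are exactly $Q$ and a $\Sigma$-repeller $P=(p,0)$, $p=\dfrac{B+\sqrt{B^2+4\mu\beta(\mu+\lambda(\mu-2))}}{2\mu}$, with $c<p<\beta$; $H>0$ on $\Sigma_3$, and on $\Sigma_2$ one has $H>0$ iff $p<x<q$; - in cases 11–13 the pseudo equilibria are exactly $Q$ and a $\Sigma$-attractor $P=(p,0)$, $p$ as above, with $-\beta<p<c$; on $\Sigma_3$ one has $H>0$ iff $x<p$, and on $\Sigma_2$ iff $x<q$; - in case 10 the boundary of the triangle with vertices $h,j,S$ is a $\Sigma$-graph of kind III, and every point of the interior of the triangle lies on a $\Sigma$-graph of kind III through $d$. Here a $\Sigma$-graph is a simple closed path meeting $\Sigma$ that consists of equilibria, pseudo equilibria and tangential singularities joined cyclically by trajectory arcs of $Z$; it is of kind III if it is not contained in $\Sigma$, meets $\Sigma_2\cup\Sigma_3$, and meets $\Sigma$ only in $\Sigma_2\cup\Sigma_3$ and in tangential singularities. Finally, compare with $\mu=0$. If $(\lambda,\beta)\in R$ is in case $k$ for $\mu$, and $(\lambda',\beta')\in R$ is in case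 $k$ for $\mu=0$ (where $c=0$), then the data along $\Sigma$ of $Z_{\lambda',0,\beta'}$ are carried by an increasing homeomorphism from $\Sigma$ onto $\{x<q\}$ to those of $Z_{\lambda,\mu,\beta}$; $Z_{\lambda',0,\beta'}$ has no $\Sigma$-saddle; and the part $x>q$ of $\Sigma$ for $Z_{\lambda,\mu,\beta}$ is escaping with $H<0$. -/

import Mathlib

open Set Filter Topology

/- The switching line is `Σ = {y = 0}`, i.e. `f (x, y) = y`; `X` acts on `y ≥ 0`, `Y` on `y ≤ 0`. -/

namespace FoldSaddle

abbrev Plane : Type := ℝ × ℝ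

/-- A non-smooth vector field `Z = (X, Y)`: `X` for `y ≥ 0` and `Y` for `y ≤ 0`. -/
structure NSField where
  X : Plane → Plane
  Y : Plane → Plane

/-- The derivative `F.g = ⟨∇g, F⟩` of a function along a vector field. -/
noncomputable def lie (F : Plane → Plane) (g : Plane → ℝ) (p : Plane) : ℝ :=
  fderiv ℝ g p (F p)

/-- `F.f` for `f (x, y) = y`. -/
noncomputable def lie1 (F : Plane → Plane) : Plane → ℝ := lie F Prod.snd

/-- `F².f = F.(F.f)` for `f (x, y) = y`. -/
noncomputable def lie2 (F : Plane → Plane) : Plane → ℝ := lie F (lie F Prod.snd)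

/-- The discontinuity line. -/
def switching : Set Plane := {p | p.2 = 0}

/-! ### The three regions of the discontinuity line and the sliding vector field -/

def sewing (Z : NSField) : Set Plane :=
  {p | p ∈ switching ∧ 0 < lie1 Z.X p * lie1 Z.Y p}

def escaping (Z : NSField) : Set Plane :=
  {p | p ∈ switching ∧ 0 < lie1 Z.X p ∧ lie1 Z.Y p < 0}

def sliding (Z : NSField) : Set Plane :=
  {p | p ∈ switching ∧ lie1 Z.X p < 0 ∧ 0 < lie1 Z.Y p}

/-- The direction function: the horizontal component of the vector of the segment
`[X p, Y p]` that is tangent to the discontinuity line. -/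
noncomputable def direction (Z : NSField) (p : Plane) : ℝ :=
  ((Z.Y p).2 * (Z.X p).1 - (Z.X p).2 * (Z.Y p).1) / ((Z.Y p).2 - (Z.X p).2)

/-- The sliding (or escaping) vector field; used on `escaping Z ∪ sliding Z` only. -/
noncomputable def slidingField (Z : NSField) (p : Plane) : Plane := (direction Z p, 0)

theorem lie1_eq (F : Plane → Plane) (p : Plane) : lie1 F p = (F p).2 := by
  have h : fderiv ℝ (Prod.snd : ℝ × ℝ → ℝ) p = ContinuousLinearMap.snd ℝ ℝ ℝ :=
    (hasFDerivAt_snd).fderiv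
  simp [lie1, lie, h]

/-- Filippov's convention: the sliding vector field lies on the open segment from `X p` to `Y p`. -/
theorem slidingField_mem (Z : NSField) (p : Plane) (hp : p ∈ escaping Z ∪ sliding Z) :
    slidingField Z p ∈ openSegment ℝ (Z.X p) (Z.Y p) := by
  have hne : (Z.Y p).2 - (Z.X p).2 ≠ 0 := by
    rcases hp with ⟨_, h1, h2⟩ | ⟨_, h1, h2⟩ <;> rw [lie1_eq] at h1 h2
    · exact (by linarith : (Z.Y p).2 - (Z.X p).2 < 0).ne
    · exact (by linarith : 0 < (Z.Y p).2 - (Z.X p).2).ne'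
  refine ⟨(Z.Y p).2 / ((Z.Y p).2 - (Z.X p).2), -(Z.X p).2 / ((Z.Y p).2 - (Z.X p).2),
    ?_, ?_, ?_, ?_⟩
  · rcases hp with ⟨_, h1, h2⟩ | ⟨_, h1, h2⟩ <;> rw [lie1_eq] at h1 h2
    · exact div_pos_of_neg_of_neg h2 (by linarith)
    · exact div_pos h2 (by linarith)
  · rcases hp with ⟨_, h1, h2⟩ | ⟨_, h1, h2⟩ <;> rw [lie1_eq] at h1 h2
    · exact div_pos_of_neg_of_neg (by linarith) (by linarith)
    · exact div_pos (by linarith) (by linarith)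
  · field_simp
    ring
  · ext
    · simp only [slidingField, direction, Prod.fst_add, Prod.smul_fst, smul_eq_mul]
      field_simp
      ring
    · simp only [slidingField, Prod.snd_add, Prod.smul_snd, smul_eq_mul]
      field_simp
      ring

/-! ### Singular points -/

/-- A hyperbolic saddle of a planar vector field. -/
def IsSaddle (F : Plane → Plane) (p : Plane) : Prop :=
  DifferentiableAt ℝ F p ∧ F p = 0 ∧ ∃ a b : ℝ, a < 0 ∧ 0 < b ∧
    Module.End.HasEigenvalue (fderiv ℝ F p : Plane →ₗ[ℝ] Plane) a ∧
    Module.End.HasEigenvalue (fderiv ℝ F p : Plane →ₗ[ℝ] Plane) b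

/-- An equilibrium of `X` in `y > 0` or of `Y` in `y < 0`. -/
def IsRealEquilibrium (Z : NSField) (p : Plane) : Prop :=
  (0 < p.2 ∧ Z.X p = 0) ∨ (p.2 < 0 ∧ Z.Y p = 0)

def IsPseudoEquilibrium (Z : NSField) (p : Plane) : Prop :=
  p ∈ escaping Z ∪ sliding Z ∧ slidingField Z p = 0

/-- A tangential singularity: a contact of `X` or `Y` with the line that is not an equilibrium. -/
def IsTangential (Z : NSField) (p : Plane) : Prop :=
  p ∈ switching ∧ Z.X p ≠ 0 ∧ Z.Y p ≠ 0 ∧ lie1 Z.X p * lie1 Z.Y p = 0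

def IsSigmaRegular (Z : NSField) (p : Plane) : Prop :=
  p ∈ sewing Z ∨ (p ∈ escaping Z ∪ sliding Z ∧ slidingField Z p ≠ 0)

/-- All singular points: real equilibria, and points of the line that are not regular. -/
def IsSingular (Z : NSField) (p : Plane) : Prop :=
  IsRealEquilibrium Z p ∨ (p ∈ switching ∧ ¬ IsSigmaRegular Z p)

/-- `p` attracts the one-dimensional sliding flow from both sides. -/
def SlidingAttractor (Z : NSField) (p : Plane) : Prop :=
  (∀ᶠ x in 𝓝[<] p.1, 0 < direction Z (x, 0)) ∧ (∀ᶠ x in 𝓝[>] p.1, direction Z (x, 0) < 0)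

/-- `p` repels the one-dimensional sliding flow to both sides. -/
def SlidingRepeller (Z : NSField) (p : Plane) : Prop :=
  (∀ᶠ x in 𝓝[<] p.1, direction Z (x, 0) < 0) ∧ (∀ᶠ x in 𝓝[>] p.1, 0 < direction Z (x, 0))

def IsSigmaSaddle (Z : NSField) (p : Plane) : Prop :=
  IsPseudoEquilibrium Z p ∧ ((p ∈ escaping Z ∧ SlidingAttractor Z p) ∨
    (p ∈ sliding Z ∧ SlidingRepeller Z p))

def IsSigmaRepeller (Z : NSField) (p : Plane) : Prop :=
  IsPseudoEquilibrium Z p ∧ p ∈ escaping Z ∧ SlidingRepeller Z p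

def IsSigmaAttractor (Z : NSField) (p : Plane) : Prop :=
  IsPseudoEquilibrium Z p ∧ p ∈ sliding Z ∧ SlidingAttractor Z p

/-- Visible folds of the upper field `X`. -/
def VisibleX (Z : NSField) (p : Plane) : Prop :=
  p ∈ switching ∧ lie1 Z.X p = 0 ∧ 0 < lie2 Z.X p

def InvisibleX (Z : NSField) (p : Plane) : Prop :=
  p ∈ switching ∧ lie1 Z.X p = 0 ∧ lie2 Z.X p < 0

/-- Visible folds of the lower field `Y`: the orbit of `Y` stays in `y ≤ 0` near `p`. -/
def VisibleY (Z : NSField) (p : Plane) : Prop :=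
  p ∈ switching ∧ lie1 Z.Y p = 0 ∧ lie2 Z.Y p < 0

def InvisibleY (Z : NSField) (p : Plane) : Prop :=
  p ∈ switching ∧ lie1 Z.Y p = 0 ∧ 0 < lie2 Z.Y p

/-! ### Topological behaviour: how many singular points of each type there are -/

inductive SingKind : Type
  | realSaddle
  | boundarySaddle
  | visibleFoldSaddle
  | invisibleFoldSaddle
  | visibleFold
  | invisibleFold
  | visibleVisible
  | visibleInvisible
  | invisibleInvisible
  | sigmaSaddle
  | sigmaAttractor
  | sigmaRepeller

/-- The type of a singular point; the two half planes play the same role. -/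
def HasKind (Z : NSField) (p : Plane) : SingKind → Prop
  | .realSaddle => (0 < p.2 ∧ IsSaddle Z.X p) ∨ (p.2 < 0 ∧ IsSaddle Z.Y p)
  | .boundarySaddle => p ∈ switching ∧
      ((IsSaddle Z.X p ∧ lie1 Z.Y p ≠ 0) ∨ (IsSaddle Z.Y p ∧ lie1 Z.X p ≠ 0))
  | .visibleFoldSaddle => (IsSaddle Z.X p ∧ VisibleY Z p) ∨ (IsSaddle Z.Y p ∧ VisibleX Z p)
  | .invisibleFoldSaddle =>
      (IsSaddle Z.X p ∧ InvisibleY Z p) ∨ (IsSaddle Z.Y p ∧ InvisibleX Z p)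
  | .visibleFold => (VisibleX Z p ∧ lie1 Z.Y p ≠ 0) ∨ (VisibleY Z p ∧ lie1 Z.X p ≠ 0)
  | .invisibleFold => (InvisibleX Z p ∧ lie1 Z.Y p ≠ 0) ∨ (InvisibleY Z p ∧ lie1 Z.X p ≠ 0)
  | .visibleVisible => VisibleX Z p ∧ VisibleY Z p
  | .visibleInvisible => (VisibleX Z p ∧ InvisibleY Z p) ∨ (InvisibleX Z p ∧ VisibleY Z p)
  | .invisibleInvisible => InvisibleX Z p ∧ InvisibleY Z p
  | .sigmaSaddle => IsSigmaSaddle Z p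
  | .sigmaAttractor => IsSigmaAttractor Z p
  | .sigmaRepeller => IsSigmaRepeller Z p

/-- The number of singular points of each type. -/
noncomputable def behaviour (Z : NSField) : SingKind → ℕ∞ :=
  fun k => {p | HasKind Z p k}.encard

/-! ### Configuration: what is seen along the discontinuity line -/

/-- `p` is the first point of the line reached by an unstable separatrix of a saddle of `F`
in the open half plane `U`. -/
def UnstableContact (F : Plane → Plane) (U : Set Plane) (p : Plane) : Prop :=
  p ∈ switching ∧ ∃ s ∈ U, IsSaddle F s ∧ ∃ γ : ℝ → Plane, γ 0 = p ∧
    ContinuousOn γ (Iic 0) ∧ (∀ t < 0, γ t ∈ U ∧ HasDerivAt γ (F (γ t)) t) ∧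
    Tendsto γ atBot (𝓝 s)

/-- `p` is the last point of the line on a stable separatrix of a saddle of `F` in `U`. -/
def StableContact (F : Plane → Plane) (U : Set Plane) (p : Plane) : Prop :=
  p ∈ switching ∧ ∃ s ∈ U, IsSaddle F s ∧ ∃ γ : ℝ → Plane, γ 0 = p ∧
    ContinuousOn γ (Ici 0) ∧ (∀ t > 0, γ t ∈ U ∧ HasDerivAt γ (F (γ t)) t) ∧
    Tendsto γ atTop (𝓝 s)

def upper : Set Plane := {p | 0 < p.2}

def lower : Set Plane := {p | p.2 < 0}

/-- The local data of `Z` at the point `(x, 0)` of the discontinuity line. -/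
structure Mark where
  signX : SignType
  signY : SignType
  foldX : SignType
  foldY : SignType
  zeroX : Prop
  zeroY : Prop
  slide : SignType
  unstableX : Prop
  stableX : Prop
  unstableY : Prop
  stableY : Prop

open Classical in
/-- The signs of `X.f` and `Y.f`, the signs of `X².f` and `Y².f` at contacts, the equilibria on the
line, the direction of the sliding flow, and the contacts of saddle separatrices. -/
noncomputable def mark (Z : NSField) (x : ℝ) : Mark where
  signX := SignType.sign (lie1 Z.X (x, 0))
  signY := SignType.sign (lie1 Z.Y (x, 0))
  foldX := if lie1 Z.X (x, 0) = 0 then SignType.sign (lie2 Z.X (x, 0)) else 0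
  foldY := if lie1 Z.Y (x, 0) = 0 then SignType.sign (lie2 Z.Y (x, 0)) else 0
  zeroX := Z.X (x, 0) = 0
  zeroY := Z.Y (x, 0) = 0
  slide := if ((x, 0) : Plane) ∈ escaping Z ∪ sliding Z then
    SignType.sign (direction Z (x, 0)) else 0
  unstableX := UnstableContact Z.X upper (x, 0)
  stableX := StableContact Z.X upper (x, 0)
  unstableY := UnstableContact Z.Y lower (x, 0)
  stableY := StableContact Z.Y lower (x, 0)

/-- Two systems have the same configuration if an increasing homeomorphism of the discontinuity
line carries all the data along it from one to the other, and if they have as many real saddles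
above and below the line. -/
def SameConfiguration (Z Z' : NSField) : Prop :=
  (∃ φ : ℝ ≃o ℝ, ∀ x, mark Z' (φ x) = mark Z x) ∧
  {p | p ∈ upper ∧ IsSaddle Z.X p}.encard = {p | p ∈ upper ∧ IsSaddle Z'.X p}.encard ∧
  {p | p ∈ lower ∧ IsSaddle Z.Y p}.encard = {p | p ∈ lower ∧ IsSaddle Z'.Y p}.encard

/-! ### Trajectories and graphs -/

/-- A trajectory on `I`: continuous, and outside finitely many switching times it follows `X` in
`y > 0`, `Y` in `y < 0`, or the sliding vector field. -/
def IsTrajectory (Z : NSField) (I : Set ℝ) (γ : ℝ → Plane) : Prop :=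
  ContinuousOn γ I ∧ ∃ T : Finset ℝ, ∀ t ∈ I, t ∉ T →
    (γ t ∈ upper ∧ HasDerivAt γ (Z.X (γ t)) t) ∨
    (γ t ∈ lower ∧ HasDerivAt γ (Z.Y (γ t)) t) ∨
    (γ t ∈ escaping Z ∪ sliding Z ∧ HasDerivAt γ (slidingField Z (γ t)) t)

/-- `A` is the image of an injective trajectory, defined on a bounded or unbounded open interval,
that goes from `p` to `q`; the end points are limits and do not belong to `A`. -/
def IsArc (Z : NSField) (p q : Plane) (A : Set Plane) : Prop :=
  ∃ (a b : EReal) (γ : ℝ → Plane), a < b ∧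
    IsTrajectory Z {t : ℝ | a < t ∧ t < b} γ ∧
    InjOn γ {t : ℝ | a < t ∧ t < b} ∧
    Tendsto γ (comap (fun t : ℝ => (t : EReal)) (𝓝[>] a)) (𝓝 p) ∧
    Tendsto γ (comap (fun t : ℝ => (t : EReal)) (𝓝[<] b)) (𝓝 q) ∧
    A = γ '' {t : ℝ | a < t ∧ t < b}

/-- A graph: a simple closed path that meets the discontinuity line and is made of equilibria,
pseudo equilibria, tangential singularities and arcs of trajectories that join them cyclically. -/
def IsSigmaGraph (Z : NSField) (D : Set Plane) : Prop :=
  ∃ (n : ℕ) (v : Fin (n + 1) → Plane) (A : Fin (n + 1) → Set Plane),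
    Function.Injective v ∧
    (∀ i, IsRealEquilibrium Z (v i) ∨ (v i ∈ switching ∧ (Z.X (v i) = 0 ∨ Z.Y (v i) = 0)) ∨
      IsPseudoEquilibrium Z (v i) ∨ IsTangential Z (v i)) ∧
    (∀ i, IsArc Z (v i) (v (i + 1)) (A i)) ∧
    (∀ i j, i ≠ j → Disjoint (A i) (A j)) ∧
    (∀ i j, v i ∉ A j) ∧
    D = range v ∪ ⋃ i, A i ∧
    (D ∩ switching).Nonempty

/-- Kind III: the graph is not contained in the line, and it meets the line in escaping or sliding
points and, besides these, in tangential singularities at most. -/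
def IsSigmaGraphIII (Z : NSField) (D : Set Plane) : Prop :=
  IsSigmaGraph Z D ∧ ¬ D ⊆ switching ∧ (D ∩ (escaping Z ∪ sliding Z)).Nonempty ∧
    ∀ p ∈ D ∩ switching, p ∈ escaping Z ∪ sliding Z ∨ IsTangential Z p

/-! ### The family -/

/-- The normal form with a visible fold of `X` at `(l, 0)`; `l`, `m`, `b` are the parameters
`λ`, `μ`, `β`. -/
noncomputable def family (l m b : ℝ) : NSField where
  X := fun p => (1, p.1 - l)
  Y := fun p => (m / 2 * p.1 + (m - 2) / 2 * (p.2 + b), (m - 2) / 2 * p.1 + m / 2 * (p.2 + b))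

/-- The abscissa of the contact of `Y` with the line. -/
noncomputable def contact (m b : ℝ) : ℝ := m * b / (2 - m)

/-- The numerator of the direction function at `(x, 0)` vanishes exactly when
`μ x² = ((μ-2)(1-β) + λμ) x + β (μ + λ(μ-2))`; this is the coefficient of `x`. -/
noncomputable def midTerm (l m b : ℝ) : ℝ := (m - 2) * (1 - b) + l * m

/-- The discriminant of that equation. -/
noncomputable def discr (l m b : ℝ) : ℝ :=
  midTerm l m b ^ 2 + 4 * m * b * (m + l * (m - 2))

/-- The abscissa of the pseudo equilibrium `Q`. -/
noncomputable def absQ (l m b : ℝ) : ℝ := (midTerm l m b - √(discr l m b)) / (2 * m)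

/-- The abscissa of the pseudo equilibrium `P`. -/
noncomputable def absP (l m b : ℝ) : ℝ := (midTerm l m b + √(discr l m b)) / (2 * m)

/-- The region of parameters `(λ, β)`. -/
def params : Set (ℝ × ℝ) := {p | |p.1| < 1 ∧ |p.2| < 1 ∧ |p.1| + p.2 < 1}

/-- The thirteen cases; a pair is `(λ, β)`. -/
def cell (m : ℝ) : ℕ → Set (ℝ × ℝ)
  | 1 => {p | p.2 < 0 ∧ p.1 < contact m p.2}
  | 2 => {p | p.2 < 0 ∧ p.1 = contact m p.2}
  | 3 => {p | p.2 < 0 ∧ contact m p.2 < p.1}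
  | 4 => {p | p.2 = 0 ∧ p.1 < 0}
  | 5 => {p | p.2 = 0 ∧ p.1 = 0}
  | 6 => {p | p.2 = 0 ∧ 0 < p.1}
  | 7 => {p | 0 < p.2 ∧ p.1 < -p.2}
  | 8 => {p | 0 < p.2 ∧ p.1 = -p.2}
  | 9 => {p | 0 < p.2 ∧ -p.2 < p.1 ∧ p.1 < contact m p.2}
  | 10 => {p | 0 < p.2 ∧ p.1 = contact m p.2}
  | 11 => {p | 0 < p.2 ∧ contact m p.2 < p.1 ∧ p.1 < p.2}
  | 12 => {p | 0 < p.2 ∧ p.1 = p.2}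
  | 13 => {p | 0 < p.2 ∧ p.2 < p.1}
  | _ => ∅

/-- The case that represents the topological behaviour of a case. -/
def representative : ℕ → ℕ
  | 3 => 1
  | 6 => 4
  | 8 => 7
  | 9 => 7
  | 12 => 11
  | 13 => 11
  | k => k

end FoldSaddle

namespace FoldSaddle

/-! ### The fields on the line -/

section Basics

/-! Everything seen along the line is governed by the order of a few of its points. `X` has its only
contact at `l`. `Y` is affine and decouples in the coordinates `x + (y + b)` and `x - (y + b)`, with
rates `m - 1` and `1`. So its contact `c = contact m b`, its saddle and the points `-b`, `b` where
the separatrices reach the line are explicit. On the escaping and sliding regions the denominator of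
the direction function has a fixed sign, so the sliding flow is read off from the numerator `numer`,
a quadratic in `x` with leading coefficient `-m > 0`.

The roots `absP < absQ` are located without estimating square roots. The values of `numer` at `l`,
`c`, `b` and `-b` factor, and the parameter region makes their signs known; a convex quadratic is
negative exactly between its roots. This puts `absQ` to the right of every other special point, and
`position_absP` records where `absP` lies. It falls weakly between the two contacts, hence is not a
pseudo equilibrium, unless `b > 0` and `l ≠ c`.

The mark at `x` depends only on the sign of `b` and on the signs of the differences of `x` with six
points (`mark_family`). Any increasing bijection matching these points therefore matches the marks,
and a piecewise linear one exists as soon as the orders agree. Conversely the marks single out `l`,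
`c`, the sign of `b` and, for `b > 0`, the points `-b` and `b`. So configurations correspond to the
relation `SameOrder`, whose classes are the thirteen cases. Behaviours are counted from the explicit
list `KindAt`; they do not see `l` against `-b` and `b`, which leaves seven.

For `m = 0` the numerator is linear. Its root satisfies the same `Position` relations as `absP`,
while `Q` has escaped to `+∞`: the sign of `x - q` becomes the constant `-1`, and the whole line
corresponds to the half line `x < q`.

If `l = c`, then `absP = l` as well and a common factor cancels, so the sliding velocity is affine
and sliding passes through the double contact in finite time. The graphs are made of these explicit
sliding motions and of orbits of `Y`; along the interior orbits the height `y` is convex, which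
gives the two crossings of the line. -/

theorem pos_mul_neg_iff {a x : ℝ} (ha : 0 < a) : a * x < 0 ↔ x < 0 :=
  ⟨fun h => by by_contra! h'; exact h.not_ge (mul_nonneg ha.le h'), mul_neg_of_pos_of_neg ha⟩

variable {l m b : ℝ}

theorem family_X (p : Plane) : (family l m b).X p = (1, p.1 - l) := rfl

theorem family_Y (p : Plane) : (family l m b).Y p =
    (m / 2 * p.1 + (m - 2) / 2 * (p.2 + b), (m - 2) / 2 * p.1 + m / 2 * (p.2 + b)) := rfl

theorem lie1_X (p : Plane) : lie1 (family l m b).X p = p.1 - l := lie1_eq _ _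

theorem lie1_Y (p : Plane) :
    lie1 (family l m b).Y p = (m - 2) / 2 * p.1 + m / 2 * (p.2 + b) := lie1_eq _ _

theorem mul_contact (hm : m ≤ 0) : (2 - m) * contact m b = m * b := by
  unfold contact
  field_simp [show 2 - m ≠ 0 by linarith]

theorem lie1_Y_line (hm : m ≤ 0) (x : ℝ) :
    lie1 (family l m b).Y (x, 0) = (2 - m) / 2 * (contact m b - x) := by
  rw [lie1_Y]
  linear_combination (-1 / 2) * mul_contact (b := b) hm

theorem lie1_Y_pos (hm : m ≤ 0) (x : ℝ) :
    0 < lie1 (family l m b).Y (x, 0) ↔ x < contact m b := by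
  rw [lie1_Y_line hm, mul_pos_iff_of_pos_left (by linarith), sub_pos]

theorem lie1_Y_neg (hm : m ≤ 0) (x : ℝ) :
    lie1 (family l m b).Y (x, 0) < 0 ↔ contact m b < x := by
  rw [lie1_Y_line hm, pos_mul_neg_iff (by linarith), sub_neg]

theorem lie1_Y_eq_zero (hm : m ≤ 0) (x : ℝ) :
    lie1 (family l m b).Y (x, 0) = 0 ↔ x = contact m b := by
  rw [lie1_Y_line hm, mul_eq_zero, or_iff_right (by linarith), sub_eq_zero, eq_comm]

theorem mem_switching_iff {w : Plane} : w ∈ switching ↔ w = (w.1, 0) := by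
  simp [switching, Prod.ext_iff]

theorem mk_mem_switching (x : ℝ) : ((x, 0) : Plane) ∈ switching := rfl

theorem mem_sliding_iff (hm : m ≤ 0) (x : ℝ) :
    (x, 0) ∈ sliding (family l m b) ↔ x < l ∧ x < contact m b := by
  change (_ ∧ _ ∧ _) ↔ _
  rw [lie1_Y_pos hm, lie1_X, sub_neg, and_iff_right (mk_mem_switching x)]

theorem mem_escaping_iff (hm : m ≤ 0) (x : ℝ) :
    (x, 0) ∈ escaping (family l m b) ↔ l < x ∧ contact m b < x := by
  change (_ ∧ _ ∧ _) ↔ _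
  rw [lie1_Y_neg hm, lie1_X, sub_pos, and_iff_right (mk_mem_switching x)]

theorem mem_sewing_iff (hm : m ≤ 0) (x : ℝ) :
    (x, 0) ∈ sewing (family l m b) ↔
      min l (contact m b) < x ∧ x < max l (contact m b) := by
  change (_ ∧ _) ↔ _
  rw [and_iff_right (mk_mem_switching x), mul_pos_iff, lie1_Y_pos hm, lie1_Y_neg hm, lie1_X,
    sub_pos, sub_neg, min_lt_iff, lt_max_iff]
  constructor
  · rintro (⟨h1, h2⟩ | ⟨h1, h2⟩)
    · exact ⟨.inl h1, .inr h2⟩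
    · exact ⟨.inr h2, .inl h1⟩
  · rintro ⟨h1 | h1, h2 | h2⟩
    · exact absurd h1 h2.not_gt
    · exact .inl ⟨h1, h2⟩
    · exact .inr ⟨h2, h1⟩
    · exact absurd h1 h2.not_gt

/-! ### Folds -/

theorem lie2_X (p : Plane) : lie2 (family l m b).X p = 1 := by
  have h : lie (family l m b).X Prod.snd = fun p => p.1 - l := funext lie1_X
  have h' : HasFDerivAt (fun p : Plane => p.1 - l) (ContinuousLinearMap.fst ℝ ℝ ℝ) p :=
    hasFDerivAt_fst.sub_const l
  rw [lie2, h, lie, h'.fderiv]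
  rfl

theorem lie2_Y (p : Plane) : lie2 (family l m b).Y p =
    (m - 2) / 2 * ((family l m b).Y p).1 + m / 2 * ((family l m b).Y p).2 := by
  have h : lie (family l m b).Y Prod.snd = fun p => (m - 2) / 2 * p.1 + m / 2 * (p.2 + b) :=
    funext lie1_Y
  have h' : HasFDerivAt (fun p : Plane => (m - 2) / 2 * p.1 + m / 2 * (p.2 + b))
      (((m - 2) / 2) • ContinuousLinearMap.fst ℝ ℝ ℝ +
        (m / 2) • ContinuousLinearMap.snd ℝ ℝ ℝ) p :=
    (hasFDerivAt_fst.const_mul _).add ((hasFDerivAt_snd.add_const b).const_mul _)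
  rw [lie2, h, lie, h'.fderiv]
  rfl

/-- At the contact the second component of `Y` vanishes and the first satisfies `(2 - m) Y₁ = -2 (1
- m) b`. As `1 - m > 0`, the sign of `b` alone decides visibility. -/
theorem lie2_Y_contact (hm : m ≤ 0) :
    lie2 (family l m b).Y (contact m b, 0) = (1 - m) * b := by
  rw [lie2_Y, family_Y]
  linear_combination (-m / 2) * mul_contact (b := b) hm

theorem visibleX_iff (w : Plane) : VisibleX (family l m b) w ↔ w = (l, 0) := by
  rw [VisibleX, lie1_X, lie2_X, sub_eq_zero]
  simp [switching, Prod.ext_iff, and_comm]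

theorem not_invisibleX (w : Plane) : ¬ InvisibleX (family l m b) w := by
  rw [InvisibleX, lie2_X]
  rintro ⟨-, -, h⟩
  linarith

theorem visibleY_iff (hm : m ≤ 0) (w : Plane) :
    VisibleY (family l m b) w ↔ b < 0 ∧ w = (contact m b, 0) := by
  constructor
  · rintro ⟨h, h1, h2⟩
    rw [mem_switching_iff] at h
    rw [h, lie1_Y_eq_zero hm] at h1
    rw [h1] at h
    rw [h, lie2_Y_contact hm, pos_mul_neg_iff (by linarith)] at h2
    exact ⟨h2, h⟩
  · rintro ⟨h, rfl⟩
    refine ⟨rfl, (lie1_Y_eq_zero hm _).2 rfl, ?_⟩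
    rwa [lie2_Y_contact hm, pos_mul_neg_iff (by linarith)]

theorem invisibleY_iff (hm : m ≤ 0) (w : Plane) :
    InvisibleY (family l m b) w ↔ 0 < b ∧ w = (contact m b, 0) := by
  constructor
  · rintro ⟨h, h1, h2⟩
    rw [mem_switching_iff] at h
    rw [h, lie1_Y_eq_zero hm] at h1
    rw [h1] at h
    rw [h, lie2_Y_contact hm, mul_pos_iff_of_pos_left (by linarith)] at h2
    exact ⟨h2, h⟩
  · rintro ⟨h, rfl⟩
    refine ⟨rfl, (lie1_Y_eq_zero hm _).2 rfl, ?_⟩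
    rwa [lie2_Y_contact hm, mul_pos_iff_of_pos_left (by linarith)]

/-! ### The saddle of the lower field -/

theorem family_X_ne_zero (w : Plane) : (family l m b).X w ≠ 0 := by
  simp [family_X, Prod.ext_iff]

theorem family_Y_eq_zero_iff (hm : m ≤ 0) (w : Plane) :
    (family l m b).Y w = 0 ↔ w = (0, -b) := by
  constructor
  · intro h
    have h1 : m / 2 * w.1 + (m - 2) / 2 * (w.2 + b) = 0 := congrArg Prod.fst h
    have h2 : (m - 2) / 2 * w.1 + m / 2 * (w.2 + b) = 0 := congrArg Prod.snd h
    have hv : w.1 - (w.2 + b) = 0 := by linear_combination h1 - h2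
    have hu : (m - 1) * (w.1 + (w.2 + b)) = 0 := by linear_combination h1 + h2
    rcases mul_eq_zero.1 hu with hu | hu
    · linarith
    · ext <;> simp <;> linarith
  · rintro rfl
    simp [family_Y]

/-- The linear part is symmetric with equal diagonal entries, so the two diagonal directions are
eigenvectors, with eigenvalues `m / 2 ± (m - 2) / 2`. -/
theorem isSaddle_family_Y (hm : m ≤ 0) : IsSaddle (family l m b).Y (0, -b) := by
  have h : HasFDerivAt (family l m b).Y
      (((m / 2) • ContinuousLinearMap.fst ℝ ℝ ℝ +
        ((m - 2) / 2) • ContinuousLinearMap.snd ℝ ℝ ℝ).prod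
        (((m - 2) / 2) • ContinuousLinearMap.fst ℝ ℝ ℝ +
        (m / 2) • ContinuousLinearMap.snd ℝ ℝ ℝ)) (0, -b) :=
    HasFDerivAt.prodMk
      ((hasFDerivAt_fst.const_mul _).add ((hasFDerivAt_snd.add_const b).const_mul _))
      ((hasFDerivAt_fst.const_mul _).add ((hasFDerivAt_snd.add_const b).const_mul _))
  refine ⟨h.differentiableAt, (family_Y_eq_zero_iff hm _).2 rfl, m - 1, 1, by linarith,
    one_pos, ?_, ?_⟩
  · rw [h.fderiv]
    refine Module.End.hasEigenvalue_of_hasEigenvector (x := ((1, 1) : Plane)) ⟨?_, by simp⟩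
    rw [Module.End.mem_eigenspace_iff]
    ext <;> simp <;> ring
  · rw [h.fderiv]
    refine Module.End.hasEigenvalue_of_hasEigenvector (x := ((1, -1) : Plane)) ⟨?_, by simp⟩
    rw [Module.End.mem_eigenspace_iff]
    ext <;> simp <;> ring

theorem isSaddle_X_false (w : Plane) : ¬ IsSaddle (family l m b).X w :=
  fun h => family_X_ne_zero w h.2.1

theorem isSaddle_Y_iff (hm : m ≤ 0) (w : Plane) :
    IsSaddle (family l m b).Y w ↔ w = (0, -b) :=
  ⟨fun h => (family_Y_eq_zero_iff hm w).1 h.2.1, fun h => h ▸ isSaddle_family_Y hm⟩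

theorem isRealEquilibrium_iff (hm : m ≤ 0) (w : Plane) :
    IsRealEquilibrium (family l m b) w ↔ 0 < b ∧ w = (0, -b) := by
  rw [IsRealEquilibrium, or_iff_right fun h => family_X_ne_zero w h.2, family_Y_eq_zero_iff hm]
  constructor
  · rintro ⟨h, rfl⟩
    exact ⟨neg_lt_zero.1 h, rfl⟩
  · rintro ⟨h, rfl⟩
    exact ⟨neg_lt_zero.2 h, rfl⟩

/-! ### The separatrices of the saddle of the lower field -/

/-- The product `u t * exp (-k t)` has zero derivative inside `D`. It is shown both monotone and
antitone, which needs only continuity at the boundary point; this is all a separatrix offers where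
it reaches the line. -/
theorem exp_solution_const {u : ℝ → ℝ} {k : ℝ} {D : Set ℝ} (hD : Convex ℝ D)
    (hc : ContinuousOn u D) (hu : ∀ t ∈ interior D, HasDerivAt u (k * u t) t)
    {s t : ℝ} (hs : s ∈ D) (ht : t ∈ D) :
    u s * Real.exp (-k * s) = u t * Real.exp (-k * t) := by
  have hg : ContinuousOn (fun t => u t * Real.exp (-k * t)) D :=
    hc.mul (by fun_prop)
  have hd : ∀ t ∈ interior D, HasDerivAt (fun t => u t * Real.exp (-k * t)) 0 t := by
    intro t ht
    have := (hu t ht).mul ((hasDerivAt_const_mul (x := t) (-k)).exp)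
    exact this.congr_deriv (by ring)
  have h1 := monotoneOn_of_deriv_nonneg hD hg
    (fun t ht => (hd t ht).differentiableAt.differentiableWithinAt)
    (fun t ht => (hd t ht).deriv.ge)
  have h2 := antitoneOn_of_deriv_nonpos hD hg
    (fun t ht => (hd t ht).differentiableAt.differentiableWithinAt)
    (fun t ht => (hd t ht).deriv.le)
  rcases le_total s t with h | h
  · exact le_antisymm (h1 hs ht h) (h2 hs ht h)
  · exact le_antisymm (h2 ht hs h) (h1 ht hs h)

theorem hasDerivAt_mk {f g : ℝ → ℝ} {f' g' t : ℝ} (hf : HasDerivAt f f' t)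
    (hg : HasDerivAt g g' t) : HasDerivAt (fun t => ((f t, g t) : Plane)) (f', g') t :=
  hf.prodMk hg

theorem hasDerivAt_fst {γ : ℝ → Plane} {v : Plane} {t : ℝ} (h : HasDerivAt γ v t) :
    HasDerivAt (fun t => (γ t).1) v.1 t :=
  (ContinuousLinearMap.fst ℝ ℝ ℝ).hasFDerivAt.comp_hasDerivAt t h

theorem hasDerivAt_snd {γ : ℝ → Plane} {v : Plane} {t : ℝ} (h : HasDerivAt γ v t) :
    HasDerivAt (fun t => (γ t).2) v.2 t :=
  (ContinuousLinearMap.snd ℝ ℝ ℝ).hasFDerivAt.comp_hasDerivAt t h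

/-- The orbits of the lower field in the coordinates `x + (y + b)`, `x - (y + b)`. -/
noncomputable def orbitY (m b u v t : ℝ) : Plane :=
  ((u * Real.exp ((m - 1) * t) + v * Real.exp t) / 2,
    (u * Real.exp ((m - 1) * t) - v * Real.exp t) / 2 - b)

theorem continuous_orbitY (m b u v : ℝ) : Continuous (orbitY m b u v) := by
  unfold orbitY
  fun_prop

theorem hasDerivAt_orbitY (l m b u v t : ℝ) :
    HasDerivAt (orbitY m b u v) ((family l m b).Y (orbitY m b u v t)) t := by
  have h1 : HasDerivAt (fun t => u * Real.exp ((m - 1) * t))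
      (u * (Real.exp ((m - 1) * t) * (m - 1))) t :=
    ((hasDerivAt_const_mul (x := t) (m - 1)).exp).const_mul u
  have h2 : HasDerivAt (fun t => v * Real.exp t) (v * Real.exp t) t :=
    (Real.hasDerivAt_exp t).const_mul v
  have h := hasDerivAt_mk ((h1.add h2).div_const 2) (((h1.sub h2).div_const 2).sub_const b)
  refine h.congr_deriv ?_
  rw [family_Y]
  ext <;> simp only [orbitY] <;> ring

theorem tendsto_exp_neg_atTop {k : ℝ} (hk : k < 0) :
    Tendsto (fun t => Real.exp (k * t)) atTop (𝓝 0) :=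
  Real.tendsto_exp_atBot.comp (tendsto_id.const_mul_atTop_of_neg hk)

theorem tendsto_exp_pos_atBot {k : ℝ} (hk : 0 < k) :
    Tendsto (fun t => Real.exp (k * t)) atBot (𝓝 0) :=
  Real.tendsto_exp_atBot.comp (tendsto_id.const_mul_atBot hk)

theorem tendsto_orbitY_atBot (m b v : ℝ) :
    Tendsto (orbitY m b 0 v) atBot (𝓝 (0, -b)) := by
  have h := Real.tendsto_exp_atBot.const_mul v
  have := (h.div_const 2).prodMk_nhds ((h.neg.div_const 2).sub_const b)
  simp only [mul_zero, zero_div, neg_zero, zero_sub] at this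
  refine this.congr fun t => ?_
  simp [orbitY]

theorem tendsto_orbitY_atTop (hm : m ≤ 0) (b u : ℝ) :
    Tendsto (orbitY m b u 0) atTop (𝓝 (0, -b)) := by
  have h := (tendsto_exp_neg_atTop (show m - 1 < 0 by linarith)).const_mul u
  have := (h.div_const 2).prodMk_nhds ((h.div_const 2).sub_const b)
  simp only [mul_zero, zero_div, zero_sub] at this
  refine this.congr fun t => ?_
  simp [orbitY]

/-- On a trajectory issuing from the saddle, `u = x + (y + b)` obeys `u' = (m - 1) u`, so `u t * exp
(-(m - 1) t)` is constant. As `t → -∞` both factors tend to `0`, hence `u = 0`, and this axis meets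
the line only at `-b`. -/
theorem unstableContact_iff (hm : m ≤ 0) (w : Plane) :
    UnstableContact (family l m b).Y lower w ↔ 0 < b ∧ w = (-b, 0) := by
  constructor
  · rintro ⟨hw, s, hs, hS, γ, h0, hc, hγ, hlim⟩
    obtain rfl := (isSaddle_Y_iff hm s).1 hS
    have hb : 0 < b := neg_lt_zero.1 hs
    refine ⟨hb, ?_⟩
    set u : ℝ → ℝ := fun t => (γ t).1 + ((γ t).2 + b) with hu_def
    have hu : ∀ t ∈ interior (Iic (0 : ℝ)), HasDerivAt u ((m - 1) * u t) t := by
      intro t ht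
      rw [interior_Iic] at ht
      have h := (hγ t ht).2
      refine ((hasDerivAt_fst h).add ((hasDerivAt_snd h).add_const b)).congr_deriv ?_
      simp only [hu_def, family_Y]
      ring
    have hcu : ContinuousOn u (Iic 0) :=
      (continuous_fst.comp_continuousOn hc).add
        ((continuous_snd.comp_continuousOn hc).add continuousOn_const)
    have hlu : Tendsto u atBot (𝓝 0) := by
      have h1 := (continuous_fst.tendsto _).comp hlim
      have h2 := (continuous_snd.tendsto _).comp hlim
      have := h1.add (h2.add_const b)
      simpa [hu_def] using this
    have hprod := hlu.mul (tendsto_exp_pos_atBot (show 0 < -(m - 1) by linarith))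
    have hev : (fun t => u t * Real.exp (-(m - 1) * t)) =ᶠ[atBot] fun _ => u 0 := by
      filter_upwards [eventually_le_atBot 0] with t ht
      rw [exp_solution_const (convex_Iic 0) hcu hu ht (mem_Iic.2 le_rfl)]
      simp
    have hu0 : u 0 = 0 := by
      have := tendsto_nhds_unique (tendsto_const_nhds.congr' hev.symm) hprod
      simpa using this
    have hw2 : w.2 = 0 := hw
    simp only [hu_def, h0] at hu0
    ext <;> simp only <;> linarith
  · rintro ⟨hb, rfl⟩
    -- At `(-b, 0)` the two decoupled coordinates are `0` and `-2 * b`.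
    refine ⟨rfl, (0, -b), neg_lt_zero.2 hb, isSaddle_family_Y hm, orbitY m b 0 (-2 * b), ?_,
      (continuous_orbitY _ _ _ _).continuousOn, fun t ht => ⟨?_, hasDerivAt_orbitY _ _ _ _ _ _⟩,
      tendsto_orbitY_atBot _ _ _⟩
    · ext <;> simp [orbitY]
      ring
    · have : Real.exp t < 1 := Real.exp_lt_one_iff.2 ht
      simp only [orbitY, lower, mem_ofPred_eq]
      nlinarith

/-- The mirror argument: `x - (y + b)` grows like `exp t` but must tend to `0` as `t → ∞`, so it
vanishes identically. -/
theorem stableContact_iff (hm : m ≤ 0) (w : Plane) :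
    StableContact (family l m b).Y lower w ↔ 0 < b ∧ w = (b, 0) := by
  constructor
  · rintro ⟨hw, s, hs, hS, γ, h0, hc, hγ, hlim⟩
    obtain rfl := (isSaddle_Y_iff hm s).1 hS
    have hb : 0 < b := neg_lt_zero.1 hs
    refine ⟨hb, ?_⟩
    set u : ℝ → ℝ := fun t => (γ t).1 - ((γ t).2 + b) with hu_def
    have hu : ∀ t ∈ interior (Ici (0 : ℝ)), HasDerivAt u (1 * u t) t := by
      intro t ht
      rw [interior_Ici] at ht
      have h := (hγ t ht).2
      refine ((hasDerivAt_fst h).sub ((hasDerivAt_snd h).add_const b)).congr_deriv ?_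
      simp only [hu_def, family_Y]
      ring
    have hcu : ContinuousOn u (Ici 0) :=
      (continuous_fst.comp_continuousOn hc).sub
        ((continuous_snd.comp_continuousOn hc).add continuousOn_const)
    have hlu : Tendsto u atTop (𝓝 0) := by
      have h1 := (continuous_fst.tendsto _).comp hlim
      have h2 := (continuous_snd.tendsto _).comp hlim
      have := h1.sub (h2.add_const b)
      simpa [hu_def] using this
    have hprod := hlu.mul (tendsto_exp_neg_atTop (show (-1 : ℝ) < 0 by norm_num))
    have hev : (fun t => u t * Real.exp (-1 * t)) =ᶠ[atTop] fun _ => u 0 := by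
      filter_upwards [eventually_ge_atTop 0] with t ht
      rw [exp_solution_const (convex_Ici 0) hcu hu ht (mem_Ici.2 le_rfl)]
      simp
    have hu0 : u 0 = 0 := by
      have := tendsto_nhds_unique (tendsto_const_nhds.congr' hev.symm) hprod
      simpa using this
    have hw2 : w.2 = 0 := hw
    simp only [hu_def, h0] at hu0
    ext <;> simp only <;> linarith
  · rintro ⟨hb, rfl⟩
    refine ⟨rfl, (0, -b), neg_lt_zero.2 hb, isSaddle_family_Y hm, orbitY m b (2 * b) 0, ?_,
      (continuous_orbitY _ _ _ _).continuousOn, fun t ht => ⟨?_, hasDerivAt_orbitY _ _ _ _ _ _⟩,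
      tendsto_orbitY_atTop hm _ _⟩
    · simp [orbitY]
    · have : Real.exp ((m - 1) * t) < 1 := Real.exp_lt_one_iff.2 (by nlinarith [ht.lt])
      simp only [orbitY, lower, mem_ofPred_eq]
      nlinarith

end Basics

/-! ### The direction function and its zeros -/

section Direction

variable {l m b : ℝ}

/-- Twice the numerator of the direction function at `(x, 0)`. -/
noncomputable def numer (l m b x : ℝ) : ℝ :=
  -m * x ^ 2 + midTerm l m b * x + b * (m + l * (m - 2))

theorem direction_eq (hm : m ≤ 0) (x : ℝ) : direction (family l m b) (x, 0) =
    numer l m b x / 2 / ((2 - m) / 2 * (contact m b - x) - (x - l)) := by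
  have h := lie1_Y_line (l := l) (b := b) hm x
  rw [lie1_eq] at h
  rw [direction, h]
  congr 1
  rw [← h]
  simp only [family_X, family_Y, numer, midTerm]
  ring

theorem denom_neg (hm : m ≤ 0) {x : ℝ} (h1 : l < x) (h2 : contact m b < x) :
    (2 - m) / 2 * (contact m b - x) - (x - l) < 0 := by
  have := mul_neg_of_pos_of_neg (show 0 < (2 - m) / 2 by linarith) (sub_neg.2 h2)
  linarith

theorem denom_pos (hm : m ≤ 0) {x : ℝ} (h1 : x < l) (h2 : x < contact m b) :
    0 < (2 - m) / 2 * (contact m b - x) - (x - l) := by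
  have := mul_pos (show 0 < (2 - m) / 2 by linarith) (sub_pos.2 h2)
  linarith

theorem sign_direction_escaping (hm : m ≤ 0) {x : ℝ} (h1 : l < x) (h2 : contact m b < x) :
    SignType.sign (direction (family l m b) (x, 0)) = -SignType.sign (numer l m b x) := by
  have hd := denom_neg (l := l) (b := b) hm h1 h2
  rw [direction_eq hm, div_eq_mul_inv, sign_mul, sign_neg (inv_neg''.2 hd), div_eq_mul_inv,
    sign_mul, sign_pos (by norm_num : (0 : ℝ) < 2⁻¹)]
  simp

theorem sign_direction_sliding (hm : m ≤ 0) {x : ℝ} (h1 : x < l) (h2 : x < contact m b) :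
    SignType.sign (direction (family l m b) (x, 0)) = SignType.sign (numer l m b x) := by
  have hd := denom_pos (l := l) (b := b) hm h1 h2
  rw [direction_eq hm, div_eq_mul_inv, sign_mul, sign_pos (inv_pos.2 hd), div_eq_mul_inv,
    sign_mul, sign_pos (by norm_num : (0 : ℝ) < 2⁻¹)]
  simp

/-- At the fold of `X` one has `X = (1, 0)`, so only twice the second component of `Y` survives. -/
theorem numer_at_fold (hm : m ≤ 0) : numer l m b l = (2 - m) * (contact m b - l) := by
  rw [numer, midTerm]
  linear_combination -mul_contact (b := b) hm

/-- At the contact of `Y` only the product of `X₂ = c - l` with `Y₁` survives. -/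
theorem numer_at_contact (hm : m ≤ 0) : (2 - m) * numer l m b (contact m b) =
    4 * (1 - m) * (b * (contact m b - l)) := by
  rw [numer, midTerm]
  linear_combination (-(2 - m) - (contact m b - l) * m) * mul_contact (b := b) hm

/-- The points `(b, 0)` and `(-b, 0)` lie on the eigenlines of the saddle, where `Y` is a multiple
of a diagonal vector. This is why the numerator factors there, and the remaining factors `1 - b + l`
and `1 - b - l` are positive by the condition `|l| + b < 1`. -/
theorem numer_at_b : numer l m b b = -(2 * (1 - m) * (1 - b + l) * b) := by
  rw [numer, midTerm]
  ring

theorem numer_at_neg_b : numer l m b (-b) = 2 * (1 - b - l) * b := by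
  rw [numer, midTerm]
  ring

/-! ### The parameter region and the two roots of the numerator -/

structure InParams (l b : ℝ) : Prop where
  left : 0 < 1 - b + l
  right : 0 < 1 - b - l
  l_gt : -1 < l
  l_lt : l < 1
  b_gt : -1 < b
  b_lt : b < 1

theorem inParams_of_mem (h : (l, b) ∈ params) : InParams l b := by
  obtain ⟨h1, h2, h3⟩ := h
  simp only at h1 h2 h3
  rw [abs_lt] at h1 h2
  have h4 := le_abs_self l
  have h5 := neg_abs_le l
  constructor <;> linarith

theorem contact_zero : contact m 0 = 0 := by simp [contact]

/-- The factor `m / (2 - m)` lies in `(-1, 0]`. -/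
theorem contact_nonpos (hm : m ≤ 0) (hb : 0 < b) : -b < contact m b ∧ contact m b ≤ 0 := by
  have h := mul_contact (b := b) hm
  constructor
  · by_contra! h'
    nlinarith
  · by_contra! h'
    nlinarith

theorem contact_nonneg (hm : m ≤ 0) (hb : b < 0) : 0 ≤ contact m b ∧ contact m b < -b := by
  have h := mul_contact (b := b) hm
  constructor
  · by_contra! h'
    nlinarith
  · by_contra! h'
    nlinarith

/-- The discriminant equals `numer' x ^ 2 + 4 m * numer x` for every `x`. As `m < 0`, a single point
where the numerator is negative suffices; such a point is `|b|` when `b ≠ 0`. -/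
theorem discr_pos (hm : m < 0) (h : InParams l b) : 0 < discr l m b := by
  have key : ∀ x, numer l m b x < 0 → 0 < discr l m b := by
    intro x hx
    have : discr l m b = (-2 * m * x + midTerm l m b) ^ 2 + 4 * m * numer l m b x := by
      rw [discr, numer]
      ring
    rw [this]
    nlinarith [sq_nonneg (-2 * m * x + midTerm l m b)]
  rcases lt_trichotomy b 0 with hb | rfl | hb
  · refine key (-b) ?_
    rw [numer_at_neg_b]
    nlinarith [h.right]
  -- For `b = 0` the numerator is `-m x ^ 2 + (m (1 + l) - 2) x`; at `x = 1 + l` the terms in `m`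
  -- cancel and `-2 (1 + l)` remains.
  · refine key (1 + l) ?_
    rw [numer, midTerm]
    nlinarith [h.l_gt]
  · refine key b ?_
    rw [numer_at_b]
    have := mul_pos (mul_pos (show 0 < 2 * (1 - m) by linarith) h.left) hb
    linarith

theorem numer_factor (hm : m < 0) (h : InParams l b) (x : ℝ) :
    numer l m b x = -m * ((x - absP l m b) * (x - absQ l m b)) := by
  have hs := Real.sq_sqrt (discr_pos hm h).le
  have hP : 2 * m * absP l m b = midTerm l m b + √(discr l m b) := by
    rw [absP, mul_div_cancel₀ _ (by linarith)]
  have hQ : 2 * m * absQ l m b = midTerm l m b - √(discr l m b) := by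
    rw [absQ, mul_div_cancel₀ _ (by linarith)]
  -- The factor `4 * m` clears the denominators `2 * m` of both roots.
  have h4 : 4 * m * numer l m b x =
      4 * m * (-m * ((x - absP l m b) * (x - absQ l m b))) := by
    have e : 4 * m * (-m * ((x - absP l m b) * (x - absQ l m b))) =
        -((2 * m * x - 2 * m * absP l m b) * (2 * m * x - 2 * m * absQ l m b)) := by ring
    rw [e, hP, hQ]
    have e2 : discr l m b = midTerm l m b ^ 2 + 4 * m * b * (m + l * (m - 2)) := rfl
    rw [numer]
    linear_combination -hs - e2
  exact mul_left_cancel₀ (by linarith) h4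

/-- The denominator `2 * m` is negative, so the root with `+√` is the smaller one. -/
theorem absP_lt_absQ (hm : m < 0) (h : InParams l b) : absP l m b < absQ l m b := by
  have hs := Real.sqrt_pos.2 (discr_pos hm h)
  rw [absP, absQ, div_lt_div_right_of_neg (by linarith)]
  linarith

theorem numer_neg_iff (hm : m < 0) (h : InParams l b) (x : ℝ) :
    numer l m b x < 0 ↔ absP l m b < x ∧ x < absQ l m b := by
  have hpq := absP_lt_absQ hm h
  rw [numer_factor hm h, pos_mul_neg_iff (by linarith), mul_neg_iff]
  constructor
  · rintro (⟨h1, h2⟩ | ⟨h1, h2⟩)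
    · exact ⟨sub_pos.1 h1, sub_neg.1 h2⟩
    · linarith
  · rintro ⟨h1, h2⟩
    exact .inl ⟨sub_pos.2 h1, sub_neg.2 h2⟩

theorem numer_pos_iff (hm : m < 0) (h : InParams l b) (x : ℝ) :
    0 < numer l m b x ↔ x < absP l m b ∨ absQ l m b < x := by
  have hpq := absP_lt_absQ hm h
  rw [numer_factor hm h, mul_pos_iff_of_pos_left (by linarith), mul_pos_iff]
  constructor
  · rintro (⟨h1, h2⟩ | ⟨h1, h2⟩)
    · exact .inr (sub_pos.1 h2)
    · exact .inl (sub_neg.1 h1)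
  · rintro (h1 | h1)
    · exact .inr ⟨sub_neg.2 h1, sub_neg.2 (h1.trans hpq)⟩
    · exact .inl ⟨sub_pos.2 (hpq.trans h1), sub_pos.2 h1⟩

theorem numer_eq_zero_iff (hm : m < 0) (h : InParams l b) (x : ℝ) :
    numer l m b x = 0 ↔ x = absP l m b ∨ x = absQ l m b := by
  rw [numer_factor hm h, mul_eq_zero, or_iff_right (by linarith), mul_eq_zero, sub_eq_zero,
    sub_eq_zero]

/-- For `b ≠ 0` the numerator is negative at `|b|`, which therefore lies between the roots. For `b =
0` the point `1 + l > 0` between the roots gives the second bound. -/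
theorem absP_lt_abs_lt_absQ (hm : m < 0) (h : InParams l b) :
    (b ≠ 0 → absP l m b < |b|) ∧ |b| < absQ l m b := by
  rcases lt_trichotomy b 0 with hb | rfl | hb
  · have h1 : numer l m b |b| < 0 := by
      rw [abs_of_neg hb, numer_at_neg_b]
      nlinarith [h.right]
    exact ⟨fun _ => ((numer_neg_iff hm h _).1 h1).1, ((numer_neg_iff hm h _).1 h1).2⟩
  · refine ⟨fun hb => absurd rfl hb, ?_⟩
    have h1 : numer l m 0 (1 + l) < 0 := by
      rw [numer, midTerm]
      nlinarith [h.l_gt]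
    have h2 : numer l m 0 0 = 0 := by simp [numer]
    obtain ⟨h3, h4⟩ := (numer_neg_iff hm h _).1 h1
    have hq : 0 < absQ l m 0 := by linarith [h.l_gt]
    simpa using hq
  · have h1 : numer l m b |b| < 0 := by
      rw [abs_of_pos hb, numer_at_b]
      have := mul_pos (mul_pos (show 0 < 2 * (1 - m) by linarith) h.left) hb
      linarith
    exact ⟨fun _ => ((numer_neg_iff hm h _).1 h1).1, ((numer_neg_iff hm h _).1 h1).2⟩

theorem contact_lt_absQ (hm : m < 0) (h : InParams l b) : contact m b < absQ l m b := by
  have hq := (absP_lt_abs_lt_absQ hm h).2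
  refine lt_of_le_of_lt ?_ hq
  rcases lt_trichotomy b 0 with hb | rfl | hb
  · rw [abs_of_neg hb]
    exact (contact_nonneg hm.le hb).2.le
  · simp [contact_zero]
  · exact (contact_nonpos hm.le hb).2.trans (abs_nonneg b)

/-- Either `l` is at most the contact, which is already to the left of `absQ`, or the numerator is
negative at `l`. -/
theorem fold_lt_absQ (hm : m < 0) (h : InParams l b) : l < absQ l m b := by
  rcases le_or_gt l (contact m b) with hl | hl
  · exact hl.trans_lt (contact_lt_absQ hm h)
  · have h1 : numer l m b l < 0 := by
      rw [numer_at_fold hm.le]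
      exact mul_neg_of_pos_of_neg (by linarith) (sub_neg.2 hl)
    exact ((numer_neg_iff hm h _).1 h1).2

/-- The position of the zero `p` of the direction function relative to the contacts `l` and `c`
and to the points `-b` and `b`. -/
structure Position (l c b p : ℝ) : Prop where
  contact_range : 0 < b → -b < c ∧ c < b
  contact_eq : b = 0 → c = 0
  zero_range : 0 < b → -b < p ∧ p < b
  of_eq : l = c → p = c
  neg_of_lt : b < 0 → l < c → l < p ∧ p < c
  neg_of_gt : b < 0 → c < l → c < p ∧ p < l
  of_zero : b = 0 → p = c
  pos_of_lt : 0 < b → l < c → c < p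
  pos_of_gt : 0 < b → c < l → p < c

/-- Since `l` and `c` are both less than `absQ`, the sign of the numerator at either of them tells
on which side of `absP` it lies; these signs are those of `c - l` and `b * (c - l)`. For `b > 0` the
value at `-b` is positive and that at `b` negative, which confines `absP` to `(-b, b)`. -/
theorem position_absP (hm : m < 0) (h : InParams l b) :
    Position l (contact m b) b (absP l m b) := by
  have hc := mul_contact (b := b) hm.le
  have hm2 : 0 < 2 - m := by linarith
  have hm1 : 0 < 4 * (1 - m) := by linarith
  have hl := numer_at_fold (l := l) (b := b) hm.le
  have hn := numer_at_contact (l := l) (b := b) hm.le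
  have hlq := fold_lt_absQ hm h
  have hcq := contact_lt_absQ hm h
  have hc_neg : b * (contact m b - l) < 0 → absP l m b < contact m b := fun h' => by
    have h1 := mul_neg_of_pos_of_neg hm1 h'
    rw [← hn, pos_mul_neg_iff hm2, numer_neg_iff hm h] at h1
    exact h1.1
  have hc_pos : 0 < b * (contact m b - l) → contact m b < absP l m b := fun h' => by
    have h1 := mul_pos hm1 h'
    rw [← hn, mul_pos_iff_of_pos_left hm2, numer_pos_iff hm h] at h1
    exact h1.resolve_right hcq.not_gt
  refine ⟨fun hb => ?_, fun hb => by simp [hb, contact_zero], fun hb => ?_, fun he => ?_,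
    fun hb hlc => ⟨?_, ?_⟩, fun hb hlc => ⟨?_, ?_⟩, fun hb => ?_, fun hb hlc => ?_,
    fun hb hlc => ?_⟩
  · obtain ⟨h1, h2⟩ := contact_nonpos hm.le hb
    exact ⟨h1, by linarith⟩
  · have h1 : 0 < numer l m b (-b) := by
      rw [numer_at_neg_b]
      have := h.right
      positivity
    have h2 := (absP_lt_abs_lt_absQ hm h)
    rw [abs_of_pos hb] at h2
    refine ⟨?_, h2.1 hb.ne'⟩
    exact ((numer_pos_iff hm h _).1 h1).resolve_right (by linarith)
  · have h1 : numer l m b l = 0 := by rw [hl, he]; ring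
    rw [← he]
    exact (((numer_eq_zero_iff hm h _).1 h1).resolve_right hlq.ne).symm
  · have h1 : 0 < numer l m b l := hl ▸ mul_pos hm2 (sub_pos.2 hlc)
    exact ((numer_pos_iff hm h _).1 h1).resolve_right hlq.not_gt
  · exact hc_neg (mul_neg_of_neg_of_pos hb (sub_pos.2 hlc))
  · exact hc_pos (mul_pos_of_neg_of_neg hb (sub_neg.2 hlc))
  · have h1 : numer l m b l < 0 := hl ▸ mul_neg_of_pos_of_neg hm2 (sub_neg.2 hlc)
    exact ((numer_neg_iff hm h _).1 h1).1
  · have h1 : numer l m b (contact m b) = 0 := by simp [hb, contact_zero, numer]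
    exact (((numer_eq_zero_iff hm h _).1 h1).resolve_right hcq.ne).symm
  · exact hc_pos (mul_pos hb (sub_pos.2 hlc))
  · exact hc_neg (mul_neg_of_pos_of_neg hb (sub_neg.2 hlc))

/-! ### The degenerate parameter `m = 0` -/

/-- The only zero of the direction function for `m = 0`. -/
noncomputable def absP₀ (l b : ℝ) : ℝ := -(b * l) / (1 - b)

theorem mul_absP₀ (h : InParams l b) : (1 - b) * absP₀ l b = -(b * l) := by
  rw [absP₀, mul_div_cancel₀ _ (by linarith [h.b_lt])]

theorem numer_zero (h : InParams l b) (x : ℝ) :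
    numer l 0 b x = -(2 * (1 - b) * (x - absP₀ l b)) := by
  rw [numer, midTerm]
  linear_combination -2 * mul_absP₀ h

/-- Here `c = 0`, and all relations follow from `(1 - b) p = -(b l)` with `1 - b > 0` and `1 - b ± l
> 0`. -/
theorem position_absP₀ (h : InParams l b) : Position l (contact 0 b) b (absP₀ l b) := by
  have hp := mul_absP₀ h
  have h1 : 0 < 1 - b := by linarith [h.b_lt]
  have hr := h.right
  have hl := h.left
  have hc : contact 0 b = 0 := by simp [contact]
  rw [hc]
  refine ⟨fun hb => ⟨by linarith, hb⟩, fun _ => rfl, fun hb => ⟨?_, ?_⟩, fun he => ?_,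
    fun hb hlc => ⟨?_, ?_⟩, fun hb hlc => ⟨?_, ?_⟩, fun hb => ?_, fun hb hlc => ?_,
    fun hb hlc => ?_⟩
  · by_contra! h'
    nlinarith
  · by_contra! h'
    nlinarith
  · simp [absP₀, he]
  · by_contra! h'
    nlinarith
  · by_contra! h'
    nlinarith
  · by_contra! h'
    nlinarith
  · by_contra! h'
    nlinarith
  · simp [absP₀, hb]
  · by_contra! h'
    nlinarith
  · by_contra! h'
    nlinarith

end Direction

/-! ### Pseudo equilibria -/

section Pseudo

variable {l m b : ℝ}

theorem direction_pos_escaping (hm : m ≤ 0) {x : ℝ} (h1 : l < x) (h2 : contact m b < x) :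
    0 < direction (family l m b) (x, 0) ↔ numer l m b x < 0 := by
  rw [← sign_eq_one_iff, sign_direction_escaping hm h1 h2, ← sign_eq_neg_one_iff, neg_eq_iff_eq_neg]

theorem direction_neg_escaping (hm : m ≤ 0) {x : ℝ} (h1 : l < x) (h2 : contact m b < x) :
    direction (family l m b) (x, 0) < 0 ↔ 0 < numer l m b x := by
  rw [← sign_eq_neg_one_iff, sign_direction_escaping hm h1 h2, ← sign_eq_one_iff, neg_inj]

theorem direction_pos_sliding (hm : m ≤ 0) {x : ℝ} (h1 : x < l) (h2 : x < contact m b) :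
    0 < direction (family l m b) (x, 0) ↔ 0 < numer l m b x := by
  rw [← sign_eq_one_iff, sign_direction_sliding hm h1 h2, sign_eq_one_iff]

theorem direction_neg_sliding (hm : m ≤ 0) {x : ℝ} (h1 : x < l) (h2 : x < contact m b) :
    direction (family l m b) (x, 0) < 0 ↔ numer l m b x < 0 := by
  rw [← sign_eq_neg_one_iff, sign_direction_sliding hm h1 h2, sign_eq_neg_one_iff]

theorem direction_eq_zero_iff (hm : m ≤ 0) {x : ℝ}
    (h : (l < x ∧ contact m b < x) ∨ (x < l ∧ x < contact m b)) :
    direction (family l m b) (x, 0) = 0 ↔ numer l m b x = 0 := by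
  rcases h with ⟨h1, h2⟩ | ⟨h1, h2⟩
  · have hs : ∀ s : SignType, -s = 0 ↔ s = 0 := by decide
    rw [← sign_eq_zero_iff, sign_direction_escaping hm h1 h2, hs, sign_eq_zero_iff]
  · rw [← sign_eq_zero_iff, sign_direction_sliding hm h1 h2, sign_eq_zero_iff]

theorem mem_escaping_or_sliding_iff (hm : m ≤ 0) (x : ℝ) :
    (x, 0) ∈ escaping (family l m b) ∪ sliding (family l m b) ↔
      (l < x ∧ contact m b < x) ∨ (x < l ∧ x < contact m b) := by
  rw [mem_union, mem_escaping_iff hm, mem_sliding_iff hm]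

theorem IsPseudoEquilibrium.eq_mk {Z : NSField} {w : Plane} (h : IsPseudoEquilibrium Z w) :
    w = (w.1, 0) := by
  rw [← mem_switching_iff]
  rcases h.1 with h | h <;> exact h.1

theorem isPseudoEquilibrium_mk_iff (hm : m ≤ 0) (x : ℝ) :
    IsPseudoEquilibrium (family l m b) (x, 0) ↔
      ((l < x ∧ contact m b < x) ∨ (x < l ∧ x < contact m b)) ∧ numer l m b x = 0 := by
  rw [IsPseudoEquilibrium, mem_escaping_or_sliding_iff hm]
  refine and_congr_right fun h => ?_
  rw [← direction_eq_zero_iff hm h]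
  simp [slidingField, Prod.ext_iff]

theorem slidingRepeller_of_escaping (hm : m ≤ 0) {r : ℝ} (h1 : l < r) (h2 : contact m b < r)
    (hl : ∀ᶠ x in 𝓝[<] r, 0 < numer l m b x) (hr : ∀ᶠ x in 𝓝[>] r, numer l m b x < 0) :
    SlidingRepeller (family l m b) (r, 0) := by
  have e1 := lt_mem_nhds h1
  have e2 := lt_mem_nhds h2
  constructor
  · filter_upwards [hl, nhdsWithin_le_nhds e1, nhdsWithin_le_nhds e2] with x hx h3 h4
    exact (direction_neg_escaping hm h3 h4).2 hx
  · filter_upwards [hr, nhdsWithin_le_nhds e1, nhdsWithin_le_nhds e2] with x hx h3 h4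
    exact (direction_pos_escaping hm h3 h4).2 hx

theorem slidingAttractor_of_escaping (hm : m ≤ 0) {r : ℝ} (h1 : l < r) (h2 : contact m b < r)
    (hl : ∀ᶠ x in 𝓝[<] r, numer l m b x < 0) (hr : ∀ᶠ x in 𝓝[>] r, 0 < numer l m b x) :
    SlidingAttractor (family l m b) (r, 0) := by
  have e1 := lt_mem_nhds h1
  have e2 := lt_mem_nhds h2
  constructor
  · filter_upwards [hl, nhdsWithin_le_nhds e1, nhdsWithin_le_nhds e2] with x hx h3 h4
    exact (direction_pos_escaping hm h3 h4).2 hx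
  · filter_upwards [hr, nhdsWithin_le_nhds e1, nhdsWithin_le_nhds e2] with x hx h3 h4
    exact (direction_neg_escaping hm h3 h4).2 hx

theorem slidingAttractor_of_sliding (hm : m ≤ 0) {r : ℝ} (h1 : r < l) (h2 : r < contact m b)
    (hl : ∀ᶠ x in 𝓝[<] r, 0 < numer l m b x) (hr : ∀ᶠ x in 𝓝[>] r, numer l m b x < 0) :
    SlidingAttractor (family l m b) (r, 0) := by
  have e1 := gt_mem_nhds h1
  have e2 := gt_mem_nhds h2
  constructor
  · filter_upwards [hl, nhdsWithin_le_nhds e1, nhdsWithin_le_nhds e2] with x hx h3 h4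
    exact (direction_pos_sliding hm h3 h4).2 hx
  · filter_upwards [hr, nhdsWithin_le_nhds e1, nhdsWithin_le_nhds e2] with x hx h3 h4
    exact (direction_neg_sliding hm h3 h4).2 hx

theorem SlidingAttractor.not_repeller {Z : NSField} {w : Plane} (h : SlidingAttractor Z w) :
    ¬ SlidingRepeller Z w := by
  intro h'
  obtain ⟨x, h1, h2⟩ := (h.2.and h'.2).exists
  exact lt_asymm h1 h2

theorem not_mem_sliding_of_escaping {Z : NSField} {w : Plane} (h : w ∈ escaping Z) :
    w ∉ sliding Z :=
  fun h' => lt_asymm h.2.1 h'.2.1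

/-- For `b ≤ 0` or `l = c` the zero lies weakly between `l` and `c`, outside both regions. For `b >
0` it lies beyond `c`, on the side away from `l`: escaping if `l < c`, sliding if `c < l`. -/
theorem Position.escaping_iff {c p : ℝ} (h : Position l c b p) :
    l < p ∧ c < p ↔ 0 < b ∧ l < c := by
  have h1 := h.neg_of_lt
  have h2 := h.neg_of_gt
  have h3 := h.of_zero
  have h4 := h.pos_of_lt
  have h5 := h.pos_of_gt
  have h6 := h.of_eq
  grind

theorem Position.sliding_iff {c p : ℝ} (h : Position l c b p) :
    p < l ∧ p < c ↔ 0 < b ∧ c < l := by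
  have h1 := h.neg_of_lt
  have h2 := h.neg_of_gt
  have h3 := h.of_zero
  have h4 := h.pos_of_lt
  have h5 := h.pos_of_gt
  have h6 := h.of_eq
  grind

/-! ### Sign changes at the two roots and the types of the pseudo equilibria -/

theorem eventually_numer_left_absP (hm : m < 0) (h : InParams l b) :
    ∀ᶠ x in 𝓝[<] absP l m b, 0 < numer l m b x := by
  filter_upwards [self_mem_nhdsWithin] with x hx
  exact (numer_pos_iff hm h x).2 (.inl hx)

theorem eventually_numer_right_absP (hm : m < 0) (h : InParams l b) :
    ∀ᶠ x in 𝓝[>] absP l m b, numer l m b x < 0 := by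
  filter_upwards [self_mem_nhdsWithin,
    nhdsWithin_le_nhds (gt_mem_nhds (absP_lt_absQ hm h))] with x hx hx'
  exact (numer_neg_iff hm h x).2 ⟨hx, hx'⟩

theorem eventually_numer_left_absQ (hm : m < 0) (h : InParams l b) :
    ∀ᶠ x in 𝓝[<] absQ l m b, numer l m b x < 0 := by
  filter_upwards [self_mem_nhdsWithin,
    nhdsWithin_le_nhds (lt_mem_nhds (absP_lt_absQ hm h))] with x hx hx'
  exact (numer_neg_iff hm h x).2 ⟨hx', hx⟩

theorem eventually_numer_right_absQ (hm : m < 0) (h : InParams l b) :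
    ∀ᶠ x in 𝓝[>] absQ l m b, 0 < numer l m b x := by
  filter_upwards [self_mem_nhdsWithin] with x hx
  exact (numer_pos_iff hm h x).2 (.inr hx)

theorem isPseudoEquilibrium_iff (hm : m < 0) (h : InParams l b) (w : Plane) :
    IsPseudoEquilibrium (family l m b) w ↔ w = (absQ l m b, 0) ∨
      (0 < b ∧ l ≠ contact m b ∧ w = (absP l m b, 0)) := by
  have hP := position_absP hm h
  constructor
  · intro hw
    have e := hw.eq_mk
    rw [e, isPseudoEquilibrium_mk_iff hm.le, numer_eq_zero_iff hm h] at hw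
    rcases hw with ⟨h1, h2 | h2⟩
    · right
      rw [h2] at h1 e
      rcases h1 with h1 | h1
      · rw [hP.escaping_iff] at h1
        exact ⟨h1.1, h1.2.ne, e⟩
      · rw [hP.sliding_iff] at h1
        exact ⟨h1.1, h1.2.ne', e⟩
    · left
      rwa [h2] at e
  · rintro (rfl | ⟨hb, hl, rfl⟩)
    · rw [isPseudoEquilibrium_mk_iff hm.le, numer_eq_zero_iff hm h]
      exact ⟨.inl ⟨fold_lt_absQ hm h, contact_lt_absQ hm h⟩, .inr rfl⟩
    · rw [isPseudoEquilibrium_mk_iff hm.le, numer_eq_zero_iff hm h, hP.escaping_iff,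
        hP.sliding_iff]
      rcases hl.lt_or_gt with hl | hl
      · exact ⟨.inl ⟨hb, hl⟩, .inl rfl⟩
      · exact ⟨.inr ⟨hb, hl⟩, .inl rfl⟩

theorem absQ_mem_escaping (hm : m < 0) (h : InParams l b) :
    (absQ l m b, 0) ∈ escaping (family l m b) :=
  (mem_escaping_iff hm.le _).2 ⟨fold_lt_absQ hm h, contact_lt_absQ hm h⟩

theorem slidingAttractor_absQ (hm : m < 0) (h : InParams l b) :
    SlidingAttractor (family l m b) (absQ l m b, 0) :=
  slidingAttractor_of_escaping hm.le (fold_lt_absQ hm h) (contact_lt_absQ hm h)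
    (eventually_numer_left_absQ hm h) (eventually_numer_right_absQ hm h)

theorem slidingRepeller_absP (hm : m < 0) (h : InParams l b) (hb : 0 < b)
    (hl : l < contact m b) : SlidingRepeller (family l m b) (absP l m b, 0) := by
  have h1 := (position_absP hm h).escaping_iff.2 ⟨hb, hl⟩
  exact slidingRepeller_of_escaping hm.le h1.1 h1.2
    (eventually_numer_left_absP hm h) (eventually_numer_right_absP hm h)

theorem slidingAttractor_absP (hm : m < 0) (h : InParams l b) (hb : 0 < b)
    (hl : contact m b < l) : SlidingAttractor (family l m b) (absP l m b, 0) := by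
  have h1 := (position_absP hm h).sliding_iff.2 ⟨hb, hl⟩
  exact slidingAttractor_of_sliding hm.le h1.1 h1.2
    (eventually_numer_left_absP hm h) (eventually_numer_right_absP hm h)

theorem absP_mem_escaping (hm : m < 0) (h : InParams l b) (hb : 0 < b)
    (hl : l < contact m b) : (absP l m b, 0) ∈ escaping (family l m b) :=
  (mem_escaping_iff hm.le _).2 ((position_absP hm h).escaping_iff.2 ⟨hb, hl⟩)

theorem absP_mem_sliding (hm : m < 0) (h : InParams l b) (hb : 0 < b)
    (hl : contact m b < l) : (absP l m b, 0) ∈ sliding (family l m b) :=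
  (mem_sliding_iff hm.le _).2 ((position_absP hm h).sliding_iff.2 ⟨hb, hl⟩)

theorem isSigmaSaddle_iff (hm : m < 0) (h : InParams l b) (w : Plane) :
    IsSigmaSaddle (family l m b) w ↔ w = (absQ l m b, 0) := by
  constructor
  · rintro ⟨hw, hw'⟩
    rcases (isPseudoEquilibrium_iff hm h w).1 hw with hw | ⟨hb, hl, rfl⟩
    · exact hw
    · exfalso
      rcases hl.lt_or_gt with hl | hl
      · rcases hw' with ⟨-, h2⟩ | ⟨h1, -⟩
        · exact h2.not_repeller (slidingRepeller_absP hm h hb hl)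
        · exact not_mem_sliding_of_escaping (absP_mem_escaping hm h hb hl) h1
      · rcases hw' with ⟨h1, -⟩ | ⟨-, h2⟩
        · exact not_mem_sliding_of_escaping h1 (absP_mem_sliding hm h hb hl)
        · exact (slidingAttractor_absP hm h hb hl).not_repeller h2
  · rintro rfl
    exact ⟨(isPseudoEquilibrium_iff hm h _).2 (.inl rfl),
      .inl ⟨absQ_mem_escaping hm h, slidingAttractor_absQ hm h⟩⟩

theorem isSigmaRepeller_iff (hm : m < 0) (h : InParams l b) (w : Plane) :
    IsSigmaRepeller (family l m b) w ↔ 0 < b ∧ l < contact m b ∧ w = (absP l m b, 0) := by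
  constructor
  · rintro ⟨hw, he, hr⟩
    rcases (isPseudoEquilibrium_iff hm h w).1 hw with rfl | ⟨hb, hl, rfl⟩
    · exact absurd hr (slidingAttractor_absQ hm h).not_repeller
    · refine ⟨hb, hl.lt_or_gt.resolve_right fun hl => ?_, rfl⟩
      exact not_mem_sliding_of_escaping he (absP_mem_sliding hm h hb hl)
  · rintro ⟨hb, hl, rfl⟩
    exact ⟨(isPseudoEquilibrium_iff hm h _).2 (.inr ⟨hb, hl.ne, rfl⟩),
      absP_mem_escaping hm h hb hl, slidingRepeller_absP hm h hb hl⟩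

theorem isSigmaAttractor_iff (hm : m < 0) (h : InParams l b) (w : Plane) :
    IsSigmaAttractor (family l m b) w ↔ 0 < b ∧ contact m b < l ∧ w = (absP l m b, 0) := by
  constructor
  · rintro ⟨hw, hs, ha⟩
    rcases (isPseudoEquilibrium_iff hm h w).1 hw with rfl | ⟨hb, hl, rfl⟩
    · exact absurd hs (not_mem_sliding_of_escaping (absQ_mem_escaping hm h))
    · refine ⟨hb, hl.lt_or_gt.resolve_left fun hl => ?_, rfl⟩
      exact not_mem_sliding_of_escaping (absP_mem_escaping hm h hb hl) hs
  · rintro ⟨hb, hl, rfl⟩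
    exact ⟨(isPseudoEquilibrium_iff hm h _).2 (.inr ⟨hb, hl.ne', rfl⟩),
      absP_mem_sliding hm h hb hl, slidingAttractor_absP hm h hb hl⟩

/-- The numerator is affine and decreasing, so its only zero repels when it is escaping and attracts
when it is sliding, the opposite of what a saddle requires. -/
theorem not_isSigmaSaddle_zero (h : InParams l b) (w : Plane) :
    ¬ IsSigmaSaddle (family l 0 b) w := by
  rintro ⟨hw, hw'⟩
  have e := hw.eq_mk
  have hb : 0 < 2 * (1 - b) := by linarith [h.b_lt]
  have hpos : ∀ x, x < absP₀ l b → 0 < numer l 0 b x := fun x hx => by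
    rw [numer_zero h, neg_pos]
    exact mul_neg_of_pos_of_neg hb (sub_neg.2 hx)
  have hneg : ∀ x, absP₀ l b < x → numer l 0 b x < 0 := fun x hx => by
    rw [numer_zero h, neg_lt_zero]
    exact mul_pos hb (sub_pos.2 hx)
  rw [e, isPseudoEquilibrium_mk_iff le_rfl] at hw
  have hz : w.1 = absP₀ l b := by
    rcases lt_trichotomy w.1 (absP₀ l b) with h' | h' | h'
    · exact absurd hw.2 (hpos _ h').ne'
    · exact h'
    · exact absurd hw.2 (hneg _ h').ne
  have el : ∀ᶠ x in 𝓝[<] (absP₀ l b), 0 < numer l 0 b x := by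
    filter_upwards [self_mem_nhdsWithin] with x hx using hpos x hx
  have er : ∀ᶠ x in 𝓝[>] (absP₀ l b), numer l 0 b x < 0 := by
    filter_upwards [self_mem_nhdsWithin] with x hx using hneg x hx
  rw [e, hz] at hw'
  rcases hw' with ⟨h1, h2⟩ | ⟨h1, h2⟩
  · have h3 := (mem_escaping_iff le_rfl _).1 h1
    exact h2.not_repeller (slidingRepeller_of_escaping le_rfl h3.1 h3.2 el er)
  · have h3 := (mem_sliding_iff le_rfl _).1 h1
    exact (slidingAttractor_of_sliding le_rfl h3.1 h3.2 el er).not_repeller h2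

end Pseudo

/-! ### Increasing homeomorphisms of the line with prescribed values -/

section OrderIso

/-- The piecewise linear homeomorphism that is the identity on the left of `s` and has slope `r`
on the right of `s`. -/
noncomputable def stretch (s r : ℝ) (hr : 0 < r) : ℝ ≃o ℝ :=
  StrictMono.orderIsoOfRightInverse (fun x => if x ≤ s then x else s + r * (x - s))
    (by
      intro x y hxy
      simp only
      split_ifs with h1 h2 h2
      · exact hxy
      · push Not at h2
        have := mul_pos hr (sub_pos.2 h2)
        linarith
      · linarith
      · have := mul_lt_mul_of_pos_left hxy hr
        linarith)
    (fun x => if x ≤ s then x else s + r⁻¹ * (x - s))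
    (by
      intro x
      simp only
      by_cases h : x ≤ s
      · simp [h]
      · have h' := h
        push Not at h'
        have := mul_pos (inv_pos.2 hr) (sub_pos.2 h')
        rw [if_neg h, if_neg (by linarith)]
        field_simp
        ring)

theorem stretch_of_le {s r : ℝ} (hr : 0 < r) {x : ℝ} (h : x ≤ s) : stretch s r hr x = x :=
  if_pos h

theorem stretch_of_gt {s r : ℝ} (hr : 0 < r) {x : ℝ} (h : s < x) :
    stretch s r hr x = s + r * (x - s) :=
  if_neg h.not_ge

/-- Induction on the largest point: an isomorphism right on the smaller points is corrected by a
stretch acting only to the right of their images. -/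
theorem exists_orderIso_of_strictMonoOn (f : ℝ → ℝ) (S : Finset ℝ) (hf : StrictMonoOn f S) :
    ∃ φ : ℝ ≃o ℝ, ∀ x ∈ S, φ x = f x := by
  induction S using Finset.induction_on_max with
  | empty => exact ⟨OrderIso.refl ℝ, by simp⟩
  | insert a S ha ih =>
    obtain ⟨φ, hφ⟩ := ih (hf.mono (by simp))
    rcases S.eq_empty_or_nonempty with rfl | hS
    · exact ⟨OrderIso.addRight (f a - a), by simp⟩
    · have hM := S.max'_mem hS
      set M := S.max' hS
      have h1 : f M < f a := hf (by simp [hM]) (by simp) (ha M hM)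
      have h2 : f M < φ a := hφ M hM ▸ φ.strictMono (ha M hM)
      have hr : 0 < (f a - f M) / (φ a - f M) := div_pos (sub_pos.2 h1) (sub_pos.2 h2)
      -- The slope is chosen so that `φ a` moves to `f a`, while all values up to `f M` stay fixed.
      refine ⟨φ.trans (stretch (f M) _ hr), fun x hx => ?_⟩
      rw [OrderIso.trans_apply]
      rcases Finset.mem_insert.1 hx with rfl | hx
      · rw [stretch_of_gt hr h2, div_mul_cancel₀ _ (sub_pos.2 h2).ne']
        ring
      · rw [hφ x hx, stretch_of_le]
        rcases (S.le_max' x hx).eq_or_lt with h | h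
        · rw [h]
        · exact (hf (by simp [hx]) (Finset.mem_coe.2 (Finset.mem_insert_of_mem hM)) h).le

/-- The tuples may have repetitions, since the special points collide in the boundary cases; the
order equivalence forces the same repetitions on both sides, so the assignment is well defined. -/
theorem exists_orderIso_of_tuple {n : ℕ} (v v' : Fin n → ℝ)
    (h : ∀ i j, v i < v j ↔ v' i < v' j) : ∃ φ : ℝ ≃o ℝ, ∀ i, φ (v i) = v' i := by
  classical
  have heq : ∀ i j, v i = v j → v' i = v' j := fun i j hij =>
    le_antisymm (not_lt.1 fun h' => hij.not_gt ((h _ _).2 h'))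
      (not_lt.1 fun h' => hij.not_lt ((h _ _).2 h'))
  let f : ℝ → ℝ := fun x => if hx : ∃ i, v i = x then v' hx.choose else 0
  have hf : ∀ i, f (v i) = v' i := fun i => by
    have hx : ∃ j, v j = v i := ⟨i, rfl⟩
    simp only [f, dif_pos hx]
    exact heq _ _ hx.choose_spec
  obtain ⟨φ, hφ⟩ := exists_orderIso_of_strictMonoOn f (Finset.univ.image v) (by
    intro x hx y hy hxy
    simp only [Finset.coe_image, Finset.coe_univ, image_univ, mem_range] at hx hy
    obtain ⟨i, rfl⟩ := hx
    obtain ⟨j, rfl⟩ := hy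
    rw [hf, hf]
    exact (h i j).1 hxy)
  exact ⟨φ, fun i => (hφ _ (by simp)).trans (hf i)⟩

theorem sign_orderIso_sub (φ : ℝ ≃o ℝ) (x y : ℝ) :
    SignType.sign (φ x - φ y) = SignType.sign (x - y) := by
  rcases lt_trichotomy x y with h | rfl | h
  · rw [sign_neg (sub_neg.2 h), sign_neg (sub_neg.2 (φ.strictMono h))]
  · simp
  · rw [sign_pos (sub_pos.2 h), sign_pos (sub_pos.2 (φ.strictMono h))]

/-- An increasing homeomorphism from the line onto a half line. -/
noncomputable def orderIsoIio (q : ℝ) : ℝ ≃o Iio q where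
  toFun x := ⟨q - Real.exp (-x), sub_lt_self q (Real.exp_pos _)⟩
  invFun y := -Real.log (q - y)
  left_inv x := by simp
  right_inv y := by
    ext
    simp [Real.exp_log (sub_pos.2 y.2)]
  map_rel_iff' {x y} := by
    rw [← Subtype.coe_le_coe]
    change q - Real.exp (-x) ≤ q - Real.exp (-y) ↔ x ≤ y
    rw [sub_le_sub_iff_left, Real.exp_le_exp, neg_le_neg_iff]

end OrderIso

/-! ### The data along the line -/

section Mark

variable {l m b : ℝ}

/-- The point `u` if `b` is positive, and the contact of `Y` otherwise. -/
noncomputable def ifPos (m b u : ℝ) : ℝ := if 0 < b then u else contact m b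

/-- The data at a point, in terms of its position relative to the contacts `l` and `c`, the zeros
`p` and `q` of the direction function and the contacts of the separatrices; `σ` is the sign of the
parameter `b`. -/
def lineMark (σ sl sc sp sq sh sj : SignType) : Mark where
  signX := sl
  signY := -sc
  foldX := if sl = 0 then 1 else 0
  foldY := if sc = 0 then σ else 0
  zeroX := False
  zeroY := σ = 0 ∧ sc = 0
  slide := if sl = 1 ∧ sc = 1 then -(sp * sq) else if sl = -1 ∧ sc = -1 then sp * sq else 0
  unstableX := False
  stableX := False
  unstableY := σ = 1 ∧ sh = 0
  stableY := σ = 1 ∧ sj = 0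

theorem sign_sub_eq_zero {x y : ℝ} : SignType.sign (x - y) = 0 ↔ x = y := by
  rw [sign_eq_zero_iff, sub_eq_zero]

theorem sign_sub_eq_one {x y : ℝ} : SignType.sign (x - y) = 1 ↔ y < x := by
  rw [sign_eq_one_iff, sub_pos]

theorem sign_sub_eq_neg_one {x y : ℝ} : SignType.sign (x - y) = -1 ↔ x < y := by
  rw [sign_eq_neg_one_iff, sub_neg]

/-- The sign `s` is what the numerator contributes beyond the root `p`: the sign of `x - absQ` when
`m < 0`, the constant `-1` when `m = 0`. This lets one computation serve both parameters. -/
theorem mark_eq_lineMark (hm : m ≤ 0) {p x : ℝ} {s : SignType}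
    (hs : SignType.sign (numer l m b x) = SignType.sign (x - p) * s) :
    mark (family l m b) x = lineMark (SignType.sign b) (SignType.sign (x - l))
      (SignType.sign (x - contact m b)) (SignType.sign (x - p)) s
      (SignType.sign (x - ifPos m b (-b))) (SignType.sign (x - ifPos m b b)) := by
  have hm2 : 0 < 2 - m := by linarith
  rw [mark, lineMark, Mark.mk.injEq]
  refine ⟨by rw [lie1_X], ?_, ?_, ?_, ?_, ?_, ?_, ?_, ?_, ?_, ?_⟩
  · rw [lie1_Y_line hm, sign_mul, sign_pos (by linarith), one_mul, ← Left.sign_neg, neg_sub]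
  · simp only [lie1_X, lie2_X, sub_eq_zero, sign_sub_eq_zero, sign_one]
  · simp only [lie1_Y_eq_zero hm, sign_sub_eq_zero]
    split_ifs with h
    · rw [h, lie2_Y_contact hm, sign_mul, sign_pos (by linarith), one_mul]
    · rfl
  · exact eq_false (family_X_ne_zero _)
  · rw [family_Y_eq_zero_iff hm, sign_eq_zero_iff, sign_sub_eq_zero, Prod.mk.injEq]
    refine propext ⟨fun ⟨h1, h2⟩ => ?_, fun ⟨h1, h2⟩ => ?_⟩
    · have hb : b = 0 := by linarith
      simp [hb, h1, contact_zero]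
    · simp [h2, h1, contact_zero]
  · simp only [mem_escaping_or_sliding_iff hm, sign_sub_eq_one, sign_sub_eq_neg_one]
    by_cases h1 : l < x ∧ contact m b < x
    · rw [if_pos (.inl h1), if_pos h1, sign_direction_escaping hm h1.1 h1.2, hs]
    · rw [if_neg h1]
      by_cases h2 : x < l ∧ x < contact m b
      · rw [if_pos (.inr h2), if_pos h2, sign_direction_sliding hm h2.1 h2.2, hs]
      · rw [if_neg h2, if_neg (by tauto)]
  · exact eq_false fun ⟨_, s, _, h, _⟩ => isSaddle_X_false s h
  · exact eq_false fun ⟨_, s, _, h, _⟩ => isSaddle_X_false s h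
  · rw [unstableContact_iff hm, sign_eq_one_iff, sign_sub_eq_zero]
    refine propext (and_congr_right fun hb => ?_)
    simp [ifPos, hb]
  · rw [stableContact_iff hm, sign_eq_one_iff, sign_sub_eq_zero]
    refine propext (and_congr_right fun hb => ?_)
    simp [ifPos, hb]

theorem mark_family (hm : m < 0) (h : InParams l b) (x : ℝ) :
    mark (family l m b) x = lineMark (SignType.sign b) (SignType.sign (x - l))
      (SignType.sign (x - contact m b)) (SignType.sign (x - absP l m b))
      (SignType.sign (x - absQ l m b))
      (SignType.sign (x - ifPos m b (-b))) (SignType.sign (x - ifPos m b b)) := by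
  refine mark_eq_lineMark hm.le ?_
  rw [numer_factor hm h, sign_mul, sign_pos (by linarith), one_mul, sign_mul]

theorem mark_family_zero (h : InParams l b) (x : ℝ) :
    mark (family l 0 b) x = lineMark (SignType.sign b) (SignType.sign (x - l))
      (SignType.sign (x - contact 0 b)) (SignType.sign (x - absP₀ l b)) (-1)
      (SignType.sign (x - ifPos 0 b (-b))) (SignType.sign (x - ifPos 0 b b)) := by
  refine mark_eq_lineMark le_rfl ?_
  rw [numer_zero h, Left.sign_neg, sign_mul, sign_pos (by linarith [h.b_lt]), one_mul]
  simp

/-! ### Comparison of two systems -/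

/-- The parameters are in the same position relative to each other. -/
structure SameOrder (l c b l' c' b' : ℝ) : Prop where
  neg : b < 0 ↔ b' < 0
  pos : 0 < b ↔ 0 < b'
  lt : l < c ↔ l' < c'
  gt : c < l ↔ c' < l'
  left_lt : 0 < b → (l < -b ↔ l' < -b')
  left_gt : 0 < b → (-b < l ↔ -b' < l')
  right_lt : 0 < b → (l < b ↔ l' < b')
  right_gt : 0 < b → (b < l ↔ b' < l')

theorem SameOrder.symm {l c b l' c' b' : ℝ} (h : SameOrder l c b l' c' b') :
    SameOrder l' c' b' l c b :=
  ⟨h.neg.symm, h.pos.symm, h.lt.symm, h.gt.symm, fun hb => (h.left_lt (h.pos.2 hb)).symm,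
    fun hb => (h.left_gt (h.pos.2 hb)).symm, fun hb => (h.right_lt (h.pos.2 hb)).symm,
    fun hb => (h.right_gt (h.pos.2 hb)).symm⟩

/-- The points of the line that determine the data along it on the left of `Q`. -/
noncomputable def marked (l m b p : ℝ) : Fin 5 → ℝ :=
  ![l, contact m b, p, ifPos m b (-b), ifPos m b b]

/-- For `b > 0` the relative position of `l` and `c` fixes the side of `c` on which `p` lies, both
`c` and `p` are in `(-b, b)`, and `SameOrder` places `l` against `-b` and `b`. So the order of all
five points is determined. -/
theorem SameOrder.marked_lt_of_pos {l c b p l' c' b' p' : ℝ} (h : SameOrder l c b l' c' b')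
    (hP : Position l c b p) (hP' : Position l' c' b' p') (hb : 0 < b) (i j : Fin 5)
    (hij : (![l, c, p, -b, b] : Fin 5 → ℝ) i < (![l, c, p, -b, b] : Fin 5 → ℝ) j) :
    (![l', c', p', -b', b'] : Fin 5 → ℝ) i < (![l', c', p', -b', b'] : Fin 5 → ℝ) j := by
  have hb' := h.pos.1 hb
  obtain ⟨c1, c2⟩ := hP.contact_range hb
  obtain ⟨c1', c2'⟩ := hP'.contact_range hb'
  obtain ⟨p1, p2⟩ := hP.zero_range hb
  obtain ⟨p1', p2'⟩ := hP'.zero_range hb'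
  have h1 := h.left_lt hb
  have h2 := h.left_gt hb
  have h3 := h.right_lt hb
  have h4 := h.right_gt hb
  rcases lt_trichotomy l c with hl | hl | hl
  · have hl' := h.lt.1 hl
    have e := hP.pos_of_lt hb hl
    have e' := hP'.pos_of_lt hb' hl'
    clear h hP hP'
    fin_cases i <;> fin_cases j <;> simp at hij ⊢ <;> first | linarith | grind
  · have hl' : l' = c' := le_antisymm (not_lt.1 fun h' => hl.not_gt (h.gt.2 h'))
      (not_lt.1 fun h' => hl.not_lt (h.lt.2 h'))
    have e := hP.of_eq hl
    have e' := hP'.of_eq hl'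
    clear h hP hP'
    fin_cases i <;> fin_cases j <;> simp at hij ⊢ <;> linarith
  · have hl' := h.gt.1 hl
    have e := hP.pos_of_gt hb hl
    have e' := hP'.pos_of_gt hb' hl'
    clear h hP hP'
    fin_cases i <;> fin_cases j <;> simp at hij ⊢ <;> first | linarith | grind

/-- For `b ≤ 0` there are no separatrix points, and `c` stands in for them so that they impose no
new constraint. The zero `p` is strictly between `l` and `c` if `b < 0` and `l ≠ c`, and equals `c`
otherwise. -/
theorem SameOrder.marked_lt_of_nonpos {l c b p l' c' b' p' : ℝ} (h : SameOrder l c b l' c' b')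
    (hP : Position l c b p) (hP' : Position l' c' b' p') (hb : b ≤ 0) (i j : Fin 5)
    (hij : (![l, c, p, c, c] : Fin 5 → ℝ) i < (![l, c, p, c, c] : Fin 5 → ℝ) j) :
    (![l', c', p', c', c'] : Fin 5 → ℝ) i < (![l', c', p', c', c'] : Fin 5 → ℝ) j := by
  have hlt := h.lt
  have hgt := h.gt
  have hpos : (l < c ∧ l < p ∧ p ≤ c) ∨ (l = c ∧ p = c) ∨ (c < l ∧ c ≤ p ∧ p < l) := by
    rcases lt_trichotomy l c with hl | hl | hl <;> rcases hb.lt_or_eq with hb | hb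
    · exact .inl ⟨hl, (hP.neg_of_lt hb hl).1, (hP.neg_of_lt hb hl).2.le⟩
    · exact .inl ⟨hl, by rwa [hP.of_zero hb], (hP.of_zero hb).le⟩
    · exact .inr (.inl ⟨hl, hP.of_eq hl⟩)
    · exact .inr (.inl ⟨hl, hP.of_eq hl⟩)
    · exact .inr (.inr ⟨hl, (hP.neg_of_gt hb hl).1.le, (hP.neg_of_gt hb hl).2⟩)
    · exact .inr (.inr ⟨hl, (hP.of_zero hb).ge, by rwa [hP.of_zero hb]⟩)
  rcases hb.lt_or_eq with hb | hb
  · have hb' := h.neg.1 hb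
    have e1 := hP.neg_of_lt hb
    have e2 := hP.neg_of_gt hb
    have e3 := hP.of_eq
    have e1' := hP'.neg_of_lt hb'
    have e2' := hP'.neg_of_gt hb'
    have e3' := hP'.of_eq
    clear h hP hP'
    fin_cases i <;> fin_cases j <;> simp at hij ⊢ <;> grind
  · have hb' : b' = 0 := le_antisymm (not_lt.1 fun h' => hb.not_gt (h.pos.2 h'))
      (not_lt.1 fun h' => hb.not_lt (h.neg.2 h'))
    have e := hP.of_zero hb
    have e' := hP'.of_zero hb'
    clear h hP hP'
    fin_cases i <;> fin_cases j <;> simp at hij ⊢ <;> grind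

theorem SameOrder.marked_lt {l m b p l' m' b' p' : ℝ}
    (h : SameOrder l (contact m b) b l' (contact m' b') b')
    (hP : Position l (contact m b) b p) (hP' : Position l' (contact m' b') b' p') (i j : Fin 5)
    (hij : marked l m b p i < marked l m b p j) :
    marked l' m' b' p' i < marked l' m' b' p' j := by
  by_cases hb : 0 < b
  · have hb' := h.pos.1 hb
    simp only [marked, ifPos, if_pos hb, if_pos hb'] at hij ⊢
    exact h.marked_lt_of_pos hP hP' hb i j hij
  · have hb' := fun hb' => hb (h.pos.2 hb')
    simp only [marked, ifPos, if_neg hb, if_neg hb'] at hij ⊢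
    exact h.marked_lt_of_nonpos hP hP' (not_lt.1 hb) i j hij

theorem SameOrder.sign_eq {l c b l' c' b' : ℝ} (h : SameOrder l c b l' c' b') :
    SignType.sign b' = SignType.sign b := by
  rcases lt_trichotomy b 0 with hb | hb | hb
  · rw [sign_neg hb, sign_neg (h.neg.1 hb)]
  · have hb' : b' = 0 := le_antisymm (not_lt.1 fun h' => hb.not_gt (h.pos.2 h'))
      (not_lt.1 fun h' => hb.not_lt (h.neg.2 h'))
    rw [hb, hb']
  · rw [sign_pos hb, sign_pos (h.pos.1 hb)]

theorem marked_lt_absQ (hm : m < 0) (h : InParams l b) (i : Fin 5) :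
    marked l m b (absP l m b) i < absQ l m b := by
  have h1 := fold_lt_absQ hm h
  have h2 := contact_lt_absQ hm h
  have h3 := absP_lt_absQ hm h
  have h4 := (absP_lt_abs_lt_absQ hm h).2
  have h5 := le_abs_self b
  have h6 := neg_le_abs b
  fin_cases i <;> simp only [marked, ifPos] <;> simp <;> try assumption
  · split_ifs <;> linarith
  · split_ifs <;> linarith

theorem encard_upper_saddle : {p | p ∈ upper ∧ IsSaddle (family l m b).X p}.encard = 0 := by
  rw [encard_eq_zero, eq_empty_iff_forall_notMem]
  exact fun p hp => isSaddle_X_false p hp.2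

theorem lower_saddle (hm : m ≤ 0) :
    {p | p ∈ lower ∧ IsSaddle (family l m b).Y p} = {p | 0 < b ∧ p = (0, -b)} := by
  ext p
  simp only [mem_ofPred_eq, isSaddle_Y_iff hm]
  constructor
  · rintro ⟨h, rfl⟩
    exact ⟨neg_lt_zero.1 h, rfl⟩
  · rintro ⟨h, rfl⟩
    exact ⟨neg_lt_zero.2 h, rfl⟩

theorem encard_if_singleton (P : Prop) [Decidable P] (a : Plane) :
    {p | P ∧ p = a}.encard = if P then 1 else 0 := by
  split_ifs with h
  · simp [h]
  · simp [h]

/-- The five points together with `absQ`, which is always last, have the same order in both systems.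
An isomorphism matching them preserves every sign on which the marks depend. -/
theorem sameConfiguration_of_sameOrder (hm : m < 0) {l' b' : ℝ} (h : InParams l b)
    (h' : InParams l' b') (ho : SameOrder l (contact m b) b l' (contact m b') b') :
    SameConfiguration (family l m b) (family l' m b') := by
  refine ⟨?_, ?_, ?_⟩
  · obtain ⟨φ, hφ⟩ := exists_orderIso_of_tuple
      (Fin.snoc (α := fun _ => ℝ) (marked l m b (absP l m b)) (absQ l m b))
      (Fin.snoc (α := fun _ => ℝ) (marked l' m b' (absP l' m b')) (absQ l' m b')) (by
        intro i j
        induction i using Fin.lastCases with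
        | last =>
          induction j using Fin.lastCases with
          | last => simp
          | cast j =>
            simp only [Fin.snoc_last, Fin.snoc_castSucc]
            exact iff_of_false (marked_lt_absQ hm h j).not_gt (marked_lt_absQ hm h' j).not_gt
        | cast i =>
          induction j using Fin.lastCases with
          | last =>
            simp only [Fin.snoc_last, Fin.snoc_castSucc]
            exact iff_of_true (marked_lt_absQ hm h i) (marked_lt_absQ hm h' i)
          | cast j =>
            simp only [Fin.snoc_castSucc]
            exact ⟨ho.marked_lt (position_absP hm h) (position_absP hm h') i j,
              ho.symm.marked_lt (position_absP hm h') (position_absP hm h) i j⟩)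
    refine ⟨φ, fun x => ?_⟩
    have e0 : φ l = l' := hφ 0
    have e1 : φ (contact m b) = contact m b' := hφ 1
    have e2 : φ (absP l m b) = absP l' m b' := hφ 2
    have e3 : φ (ifPos m b (-b)) = ifPos m b' (-b') := hφ 3
    have e4 : φ (ifPos m b b) = ifPos m b' b' := hφ 4
    have e5 : φ (absQ l m b) = absQ l' m b' := hφ 5
    rw [mark_family hm h, mark_family hm h', ← e2, ← e5, ← e3, ← e4, ← e1, ← e0, ho.sign_eq]
    simp only [sign_orderIso_sub]
  · rw [encard_upper_saddle, encard_upper_saddle]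
  · classical
    rw [lower_saddle hm.le, lower_saddle hm.le, encard_if_singleton, encard_if_singleton]
    simp only [ho.pos]

/-- The marks recognise the points: `l` as the zero of the sign of `X.f`, `c` as that of `Y.f`, and
for `b > 0` the points `-b` and `b` as separatrix contacts. The homeomorphism must carry each to its
counterpart, and being increasing it preserves their order. -/
theorem sameOrder_of_sameConfiguration (hm : m < 0) {l' b' : ℝ} (h : InParams l b)
    (h' : InParams l' b') (hc : SameConfiguration (family l m b) (family l' m b')) :
    SameOrder l (contact m b) b l' (contact m b') b' := by
  obtain ⟨⟨φ, hφ⟩, -, -⟩ := hc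
  simp only [mark_family hm h, mark_family hm h', lineMark, Mark.mk.injEq] at hφ
  have hl : φ l = l' := by
    have := (hφ l).1
    rwa [sub_self, sign_zero, sign_sub_eq_zero] at this
  have hcc : φ (contact m b) = contact m b' := by
    have := (hφ (contact m b)).2.1
    rwa [sub_self, sign_zero, neg_inj, sign_sub_eq_zero] at this
  -- The fold entry at the contact of `Y` is the sign of `b`.
  have hs : SignType.sign b' = SignType.sign b := by
    have := (hφ (contact m b)).2.2.2.1
    rwa [hcc, sub_self, sub_self, sign_zero, if_pos rfl, if_pos rfl] at this
  have hpos : 0 < b ↔ 0 < b' := by rw [← sign_eq_one_iff, ← sign_eq_one_iff, hs]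
  have hneg : b < 0 ↔ b' < 0 := by rw [← sign_eq_neg_one_iff, ← sign_eq_neg_one_iff, hs]
  have hleft : 0 < b → φ (-b) = -b' := fun hb => by
    have := (hφ (-b)).2.2.2.2.2.2.2.2.2.1
    simpa [ifPos, hb, hpos.1 hb, sign_sub_eq_zero, ← sub_eq_add_neg, sub_eq_zero,
      ← sub_eq_add_neg, eq_neg_iff_add_eq_zero] using this
  have hright : 0 < b → φ b = b' := fun hb => by
    have := (hφ b).2.2.2.2.2.2.2.2.2.2
    simpa [ifPos, hb, hpos.1 hb, sign_sub_eq_zero, sub_eq_zero] using this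
  refine ⟨hneg, hpos, ?_, ?_, fun hb => ?_, fun hb => ?_, fun hb => ?_, fun hb => ?_⟩
  · rw [← hl, ← hcc, φ.lt_iff_lt]
  · rw [← hl, ← hcc, φ.lt_iff_lt]
  · rw [← hl, ← hleft hb, φ.lt_iff_lt]
  · rw [← hl, ← hleft hb, φ.lt_iff_lt]
  · rw [← hl, ← hright hb, φ.lt_iff_lt]
  · rw [← hl, ← hright hb, φ.lt_iff_lt]

/-- All marked points other than `absQ` lie in the half line, which is itself order isomorphic to
`ℝ`. So the matching of five points is done in `ℝ` and transported, and on the half line the sign of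
`x - absQ` is the constant `-1` found for `m = 0`. -/
theorem exists_orderIso_Iio_of_sameOrder (hm : m < 0) {l' b' : ℝ} (h : InParams l b)
    (h' : InParams l' b') (ho : SameOrder l (contact m b) b l' (contact 0 b') b') :
    ∃ φ : ℝ ≃o Iio (absQ l m b), ∀ x, mark (family l m b) (φ x) = mark (family l' 0 b') x := by
  set q := absQ l m b with hq
  let θ := orderIsoIio q
  let v : Fin 5 → Iio q := fun i => ⟨marked l m b (absP l m b) i, marked_lt_absQ hm h i⟩
  obtain ⟨φ, hφ⟩ := exists_orderIso_of_tuple (marked l' 0 b' (absP₀ l' b'))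
    (fun i => θ.symm (v i)) (by
      intro i j
      rw [θ.symm.lt_iff_lt]
      exact ⟨ho.symm.marked_lt (position_absP₀ h') (position_absP hm h) i j,
        ho.marked_lt (position_absP hm h) (position_absP₀ h') i j⟩)
  have hv : ∀ i, (φ.trans θ) (marked l' 0 b' (absP₀ l' b') i) = v i := fun i => by
    rw [OrderIso.trans_apply, hφ]
    exact θ.apply_symm_apply _
  have hsign : ∀ x i, SignType.sign (((φ.trans θ) x : ℝ) - marked l m b (absP l m b) i) =
      SignType.sign (x - marked l' 0 b' (absP₀ l' b') i) := by
    intro x i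
    have e : marked l m b (absP l m b) i = ((φ.trans θ) (marked l' 0 b' (absP₀ l' b') i) : ℝ) :=
      (congrArg Subtype.val (hv i)).symm
    rw [e]
    rcases lt_trichotomy x (marked l' 0 b' (absP₀ l' b') i) with hx | hx | hx
    · rw [sign_neg (sub_neg.2 hx), sign_neg (sub_neg.2 (show ((φ.trans θ) _ : ℝ) < (φ.trans θ) _ from
        (φ.trans θ).strictMono hx))]
    · rw [hx, sub_self, sub_self]
    · rw [sign_pos (sub_pos.2 hx), sign_pos (sub_pos.2 (show ((φ.trans θ) _ : ℝ) < (φ.trans θ) _ from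
        (φ.trans θ).strictMono hx))]
  refine ⟨φ.trans θ, fun x => ?_⟩
  have e5 : SignType.sign (((φ.trans θ) x : ℝ) - absQ l m b) = -1 :=
    sign_sub_eq_neg_one.2 ((φ.trans θ) x).2
  have e0 := hsign x 0
  have e1 := hsign x 1
  have e2 := hsign x 2
  have e3 := hsign x 3
  have e4 := hsign x 4
  simp only [marked, Matrix.cons_val] at e0 e1 e2 e3 e4
  rw [mark_family hm h, mark_family_zero h', e0, e1, e2, e3, e4, e5, ho.sign_eq]

end Mark

/-! ### The thirteen cases -/

section Cells

variable {l m b : ℝ}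

/-- The number of the case of the parameters `(l, b)` if `c` is the contact of `Y`. -/
noncomputable def caseIndex (l c b : ℝ) : ℕ :=
  if b < 0 then (if l < c then 1 else if l = c then 2 else 3)
  else if b = 0 then (if l < 0 then 4 else if l = 0 then 5 else 6)
  else if l < -b then 7 else if l = -b then 8 else if l < c then 9 else if l = c then 10
  else if l < b then 11 else if l = b then 12 else 13

theorem caseIndex_mem (l c b : ℝ) : caseIndex l c b ∈ Finset.Icc 1 13 := by
  unfold caseIndex
  split_ifs <;> simp

theorem contact_range (hm : m ≤ 0) (hb : 0 < b) : -b < contact m b ∧ contact m b < b :=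
  ⟨(contact_nonpos hm hb).1, (contact_nonpos hm hb).2.trans_lt hb⟩

theorem mem_cell_caseIndex (l m b : ℝ) :
    (l, b) ∈ cell m (caseIndex l (contact m b) b) := by
  unfold caseIndex
  split_ifs <;> simp only [cell, mem_ofPred_eq] <;> grind

/-- For `b > 0` the successive tests are made against `-b < c < b`; this strict order is what makes
every earlier test fail and the cases exclusive. -/
theorem caseIndex_of_mem_cell (hm : m ≤ 0) {k : ℕ} (hk : k ∈ Finset.Icc 1 13)
    (h : (l, b) ∈ cell m k) : caseIndex l (contact m b) b = k := by
  have hc := contact_range (b := b) hm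
  rw [Finset.mem_Icc] at hk
  obtain ⟨hk1, hk2⟩ := hk
  unfold caseIndex
  interval_cases k <;> simp only [cell, mem_ofPred_eq] at h <;> grind

theorem sameOrder_of_caseIndex_eq {m' l' b' : ℝ} (hm : m ≤ 0) (hm' : m' ≤ 0)
    (h : caseIndex l (contact m b) b = caseIndex l' (contact m' b') b') :
    SameOrder l (contact m b) b l' (contact m' b') b' := by
  have h1 := mem_cell_caseIndex l m b
  have h2 := mem_cell_caseIndex l' m' b'
  rw [← h] at h2
  have hk := caseIndex_mem l (contact m b) b
  have hc := contact_range (b := b) hm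
  have hc' := contact_range (b := b') hm'
  have z : b = 0 → contact m b = 0 := fun hb => by simp [hb, contact_zero]
  have z' : b' = 0 → contact m' b' = 0 := fun hb => by simp [hb, contact_zero]
  generalize caseIndex l (contact m b) b = k at h1 h2 hk
  rw [Finset.mem_Icc] at hk
  obtain ⟨hk1, hk2⟩ := hk
  clear h
  interval_cases k <;> simp only [cell, mem_ofPred_eq] at h1 h2 <;>
    generalize contact m b = c at * <;> generalize contact m' b' = c' at * <;>
    constructor <;> grind

theorem SameOrder.caseIndex_eq {m' l' b' : ℝ} (hm' : m' ≤ 0)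
    (h : SameOrder l (contact m b) b l' (contact m' b') b') :
    caseIndex l (contact m b) b = caseIndex l' (contact m' b') b' := by
  have h0 := mem_cell_caseIndex l m b
  have hk := caseIndex_mem l (contact m b) b
  refine (caseIndex_of_mem_cell hm' hk ?_).symm
  have z : b = 0 → contact m b = 0 := fun hb => by simp [hb, contact_zero]
  have z' : b' = 0 → contact m' b' = 0 := fun hb => by simp [hb, contact_zero]
  generalize caseIndex l (contact m b) b = k at h0 hk ⊢
  obtain ⟨h1, h2, h3, h4, h5, h6, h7, h8⟩ := h
  rw [Finset.mem_Icc] at hk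
  obtain ⟨hk1, hk2⟩ := hk
  interval_cases k <;> simp only [cell, mem_ofPred_eq] at h0 ⊢ <;>
    generalize contact m b = c at * <;> generalize contact m' b' = c' at * <;> grind

theorem existsUnique_cell (hm : m ≤ 0) (p : ℝ × ℝ) :
    ∃! k : ℕ, k ∈ Finset.Icc 1 13 ∧ p ∈ cell m k :=
  ⟨caseIndex p.1 (contact m p.2) p.2, ⟨caseIndex_mem _ _ _, mem_cell_caseIndex _ _ _⟩,
    fun _ hk => (caseIndex_of_mem_cell hm hk.1 hk.2).symm⟩

theorem mem_cell_iff (hm : m ≤ 0) {k : ℕ} (hk : k ∈ Finset.Icc 1 13) (p : ℝ × ℝ) :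
    p ∈ cell m k ↔ caseIndex p.1 (contact m p.2) p.2 = k :=
  ⟨fun h => caseIndex_of_mem_cell hm hk h, fun h => h ▸ mem_cell_caseIndex _ _ _⟩

theorem exists_mem_cell (hm : m < 0) {k : ℕ} (hk : k ∈ Finset.Icc 1 13) {δ : ℝ} (hδ : 0 < δ) :
    ∃ p ∈ cell m k ∩ params, |p.1| < δ ∧ |p.2| < δ := by
  -- Heights `0` and `±e` suffice, with abscissas up to `2 * e` to get beyond `±b` in cases 7 and
  -- 13; then `|l| + b ≤ 3 * e < 1` and `2 * e < δ`.
  obtain ⟨e, he, he1, he2⟩ : ∃ e : ℝ, 0 < e ∧ 4 * e ≤ 1 ∧ 4 * e ≤ δ :=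
    ⟨min 1 δ / 4, by positivity, by linarith [min_le_left 1 δ], by linarith [min_le_right 1 δ]⟩
  have key : ∀ l b : ℝ, (l, b) ∈ cell m k → -(2 * e) ≤ l → l ≤ 2 * e → -e ≤ b → b ≤ e →
      ∃ p ∈ cell m k ∩ params, |p.1| < δ ∧ |p.2| < δ := by
    intro l b hc h1 h2 h3 h4
    have hl : |l| ≤ 2 * e := abs_le.2 ⟨h1, h2⟩
    have hb : |b| ≤ e := abs_le.2 ⟨h3, h4⟩
    refine ⟨(l, b), ⟨hc, ?_, ?_, ?_⟩, ?_, ?_⟩ <;> simp only <;> linarith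
  have c1 := contact_nonneg (m := m) (b := -e) hm.le (by linarith)
  have c2 := contact_nonpos (m := m) (b := e) hm.le he
  -- With `m < 0` strictly the contact is not `0`, so `l = 0` can serve as the sample for cases 1
  -- and 11.
  have c3 : contact m (-e) ≠ 0 := by
    have := mul_contact (m := m) (b := -e) hm.le
    intro h
    rw [h] at this
    nlinarith
  have c4 : contact m e ≠ 0 := by
    have := mul_contact (m := m) (b := e) hm.le
    intro h
    rw [h] at this
    nlinarith
  have c5 := c1.1.lt_of_ne c3.symm
  have c6 := c2.2.lt_of_ne c4
  rw [Finset.mem_Icc] at hk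
  obtain ⟨hk1, hk2⟩ := hk
  interval_cases k
  · exact key 0 (-e) ⟨by simpa, by simpa⟩ (by linarith) (by linarith) (by linarith) (by linarith)
  · exact key (contact m (-e)) (-e) ⟨by simpa, rfl⟩ (by linarith) (by linarith) (by linarith)
      (by linarith)
  · exact key e (-e) ⟨by simpa, by simpa using c1.2⟩ (by linarith) (by linarith) (by linarith)
      (by linarith)
  · exact key (-e) 0 ⟨rfl, by simpa⟩ (by linarith) (by linarith) (by linarith) (by linarith)
  · exact key 0 0 ⟨rfl, rfl⟩ (by linarith) (by linarith) (by linarith) (by linarith)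
  · exact key e 0 ⟨rfl, by simpa⟩ (by linarith) (by linarith) (by linarith) (by linarith)
  · exact key (-(2 * e)) e ⟨he, by simp only; linarith⟩ (by linarith) (by linarith) (by linarith)
      (by linarith)
  · exact key (-e) e ⟨he, rfl⟩ (by linarith) (by linarith) (by linarith) (by linarith)
  · exact key ((-e + contact m e) / 2) e ⟨he, by simp only; linarith, by simp only; linarith⟩
      (by linarith) (by linarith) (by linarith) (by linarith)
  · exact key (contact m e) e ⟨he, rfl⟩ (by linarith) (by linarith) (by linarith) (by linarith)
  · exact key 0 e ⟨he, c6, he⟩ (by linarith) (by linarith) (by linarith) (by linarith)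
  · exact key e e ⟨he, rfl⟩ (by linarith) (by linarith) (by linarith) (by linarith)
  · exact key (2 * e) e ⟨he, by simp only; linarith⟩ (by linarith) (by linarith) (by linarith)
      (by linarith)

theorem nonempty_cell (hm : m < 0) {k : ℕ} (hk : k ∈ Finset.Icc 1 13) :
    (cell m k ∩ params).Nonempty := by
  obtain ⟨p, hp, -⟩ := exists_mem_cell hm hk one_pos
  exact ⟨p, hp⟩

/-! ### The configuration classes of the parameters -/

theorem sameConfiguration_iff (hm : m < 0) {p p' : ℝ × ℝ} (hp : p ∈ params) (hp' : p' ∈ params) :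
    SameConfiguration (family p.1 m p.2) (family p'.1 m p'.2) ↔
      caseIndex p.1 (contact m p.2) p.2 = caseIndex p'.1 (contact m p'.2) p'.2 :=
  ⟨fun h => (sameOrder_of_sameConfiguration hm (inParams_of_mem hp) (inParams_of_mem hp')
      h).caseIndex_eq hm.le,
    fun h => sameConfiguration_of_sameOrder hm (inParams_of_mem hp) (inParams_of_mem hp')
      (sameOrder_of_caseIndex_eq hm.le hm.le h)⟩

theorem configurationClass_eq (hm : m < 0) {p : ℝ × ℝ} (hp : p ∈ params) :
    {p' ∈ params | SameConfiguration (family p.1 m p.2) (family p'.1 m p'.2)} =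
      cell m (caseIndex p.1 (contact m p.2) p.2) ∩ params := by
  ext p'
  rw [mem_inter_iff, mem_cell_iff hm.le (caseIndex_mem _ _ _)]
  constructor
  · rintro ⟨h1, h2⟩
    exact ⟨((sameConfiguration_iff hm hp h1).1 h2).symm, h1⟩
  · rintro ⟨h1, h2⟩
    exact ⟨h2, (sameConfiguration_iff hm hp h2).2 h1.symm⟩

theorem configurationClasses_eq (hm : m < 0) :
    {C : Set (ℝ × ℝ) | ∃ p ∈ params, C = {p' ∈ params |
        SameConfiguration (family p.1 m p.2) (family p'.1 m p'.2)}} =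
      {C | ∃ k ∈ Finset.Icc 1 13, C = cell m k ∩ params} := by
  ext C
  constructor
  · rintro ⟨p, hp, rfl⟩
    exact ⟨_, caseIndex_mem _ _ _, configurationClass_eq hm hp⟩
  · rintro ⟨k, hk, rfl⟩
    obtain ⟨p, hp, hp'⟩ := nonempty_cell hm hk
    refine ⟨p, hp', ?_⟩
    rw [configurationClass_eq hm hp', caseIndex_of_mem_cell hm.le hk hp]

theorem ncard_cells (hm : m < 0) :
    {C : Set (ℝ × ℝ) | ∃ k ∈ Finset.Icc 1 13, C = cell m k ∩ params}.ncard = 13 := by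
  have e : {C : Set (ℝ × ℝ) | ∃ k ∈ Finset.Icc 1 13, C = cell m k ∩ params} =
      (fun k => cell m k ∩ params) '' (Finset.Icc 1 13 : Finset ℕ) := by
    ext C
    simp only [mem_image, Finset.mem_coe, eq_comm (a := C), mem_ofPred_eq]
  rw [e, InjOn.ncard_image, ncard_coe_finset]
  · rfl
  · intro k hk k' hk' h
    obtain ⟨p, hp⟩ := nonempty_cell hm hk
    have hp' : p ∈ cell m k' ∩ params := by
      have h' : cell m k ∩ params = cell m k' ∩ params := h
      rwa [← h']
    rw [← caseIndex_of_mem_cell hm.le hk hp.1, ← caseIndex_of_mem_cell hm.le hk' hp'.1]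

end Cells

/-! ### The types of the singular points -/

section Kinds

variable {l m b : ℝ}

/-- The singular points of each type, explicitly. -/
def KindAt (l m b : ℝ) (w : Plane) : SingKind → Prop
  | .realSaddle => 0 < b ∧ w = (0, -b)
  | .boundarySaddle => (b = 0 ∧ l ≠ 0) ∧ w = (0, 0)
  | .visibleFoldSaddle => (b = 0 ∧ l = 0) ∧ w = (0, 0)
  | .invisibleFoldSaddle => False
  | .visibleFold => (l ≠ contact m b ∧ w = (l, 0)) ∨
      ((b < 0 ∧ l ≠ contact m b) ∧ w = (contact m b, 0))
  | .invisibleFold => (0 < b ∧ l ≠ contact m b) ∧ w = (contact m b, 0)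
  | .visibleVisible => (b < 0 ∧ l = contact m b) ∧ w = (l, 0)
  | .visibleInvisible => (0 < b ∧ l = contact m b) ∧ w = (l, 0)
  | .invisibleInvisible => False
  | .sigmaSaddle => w = (absQ l m b, 0)
  | .sigmaAttractor => (0 < b ∧ contact m b < l) ∧ w = (absP l m b, 0)
  | .sigmaRepeller => (0 < b ∧ l < contact m b) ∧ w = (absP l m b, 0)

theorem hasKind_iff (hm : m < 0) (h : InParams l b) (w : Plane) (κ : SingKind) :
    HasKind (family l m b) w κ ↔ KindAt l m b w κ := by
  cases κ with
  | realSaddle =>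
    simp only [HasKind, KindAt, isSaddle_X_false, and_false, false_or, isSaddle_Y_iff hm.le]
    constructor
    · rintro ⟨h1, rfl⟩
      exact ⟨neg_lt_zero.1 h1, rfl⟩
    · rintro ⟨h1, rfl⟩
      exact ⟨neg_lt_zero.2 h1, rfl⟩
  | boundarySaddle =>
    simp only [HasKind, KindAt, isSaddle_X_false, false_and, false_or, isSaddle_Y_iff hm.le,
      lie1_X]
    constructor
    · rintro ⟨h1, rfl, h2⟩
      have hb : b = 0 := neg_eq_zero.1 h1
      subst hb
      simp at h2
      exact ⟨⟨rfl, h2⟩, by simp⟩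
    · rintro ⟨⟨rfl, h1⟩, rfl⟩
      simp [h1, mk_mem_switching]
  | visibleFoldSaddle =>
    simp only [HasKind, KindAt, isSaddle_X_false, false_and, false_or, isSaddle_Y_iff hm.le,
      visibleX_iff]
    constructor
    · rintro ⟨h1, h2⟩
      rw [h1] at h2
      simp only [Prod.mk.injEq, neg_eq_zero] at h2
      obtain ⟨h3, rfl⟩ := h2
      exact ⟨⟨rfl, h3.symm⟩, by simpa using h1⟩
    · rintro ⟨⟨rfl, rfl⟩, rfl⟩
      simp
  | invisibleFoldSaddle =>
    simp [HasKind, KindAt, isSaddle_X_false, not_invisibleX]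
  | visibleFold =>
    simp only [HasKind, KindAt, visibleX_iff, visibleY_iff hm.le]
    refine or_congr ?_ ?_
    · rw [and_comm]
      refine and_congr_left ?_
      rintro rfl
      rw [ne_eq, lie1_Y_eq_zero hm.le]
    · rw [and_assoc, and_assoc]
      refine and_congr_right fun _ => ?_
      rw [and_comm]
      refine and_congr_left ?_
      rintro rfl
      rw [lie1_X, sub_ne_zero, ne_comm]
  | invisibleFold =>
    simp only [HasKind, KindAt, not_invisibleX, false_and, false_or, invisibleY_iff hm.le]
    rw [and_assoc, and_assoc]
    refine and_congr_right fun _ => ?_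
    rw [and_comm]
    refine and_congr_left ?_
    rintro rfl
    rw [lie1_X, sub_ne_zero, ne_comm]
  | visibleVisible =>
    simp only [HasKind, KindAt, visibleX_iff, visibleY_iff hm.le]
    constructor
    · rintro ⟨rfl, h1, h2⟩
      exact ⟨⟨h1, congrArg Prod.fst h2⟩, rfl⟩
    · rintro ⟨⟨h1, h2⟩, rfl⟩
      exact ⟨rfl, h1, by rw [h2]⟩
  | visibleInvisible =>
    simp only [HasKind, KindAt, visibleX_iff, invisibleY_iff hm.le, not_invisibleX, false_and,
      or_false]
    constructor
    · rintro ⟨rfl, h1, h2⟩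
      exact ⟨⟨h1, congrArg Prod.fst h2⟩, rfl⟩
    · rintro ⟨⟨h1, h2⟩, rfl⟩
      exact ⟨rfl, h1, by rw [h2]⟩
  | invisibleInvisible =>
    simp [HasKind, KindAt, not_invisibleX]
  | sigmaSaddle => exact isSigmaSaddle_iff hm h w
  | sigmaAttractor => exact (isSigmaAttractor_iff hm h w).trans and_assoc.symm
  | sigmaRepeller => exact (isSigmaRepeller_iff hm h w).trans and_assoc.symm

open Classical in
/-- The only possible type of a point. -/
noncomputable def kindOf (l m b : ℝ) (w : Plane) : SingKind :=
  if w.2 < 0 then .realSaddle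
  else if w.1 = absQ l m b then .sigmaSaddle
  else if w.1 = l then
    if l = contact m b then
      if b < 0 then .visibleVisible else if b = 0 then .visibleFoldSaddle else .visibleInvisible
    else .visibleFold
  else if w.1 = contact m b then
    if b < 0 then .visibleFold else if b = 0 then .boundarySaddle else .invisibleFold
  else if l < contact m b then .sigmaRepeller else .sigmaAttractor

/-- Recovering the type from the location of the point gives uniqueness with one check per type,
instead of a comparison of all pairs of types. -/
theorem KindAt.eq_kindOf (hm : m < 0) (h : InParams l b) {w : Plane} {κ : SingKind}
    (hκ : KindAt l m b w κ) : κ = kindOf l m b w := by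
  have hlq := (fold_lt_absQ hm h).ne
  have hcq := (contact_lt_absQ hm h).ne
  have hpq := (absP_lt_absQ hm h).ne
  have h0q := ((abs_nonneg b).trans_lt (absP_lt_abs_lt_absQ hm h).2).ne
  have hP := position_absP hm h
  cases κ with
  | realSaddle =>
    obtain ⟨hb, rfl⟩ := hκ
    simp [kindOf, hb]
  | boundarySaddle =>
    obtain ⟨⟨rfl, hl⟩, rfl⟩ := hκ
    simp [kindOf, h0q, hl.symm, contact_zero]
  | visibleFoldSaddle =>
    obtain ⟨⟨rfl, rfl⟩, rfl⟩ := hκ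
    simp [kindOf, h0q, contact_zero]
  | invisibleFoldSaddle => exact hκ.elim
  | visibleFold =>
    rcases hκ with ⟨hl, rfl⟩ | ⟨⟨hb, hl⟩, rfl⟩
    · simp [kindOf, hlq, hl]
    · simp [kindOf, hcq, hl.symm, hb]
  | invisibleFold =>
    obtain ⟨⟨hb, hl⟩, rfl⟩ := hκ
    simp [kindOf, hcq, hl.symm, hb.not_gt, hb.ne']
  | visibleVisible =>
    obtain ⟨⟨hb, hl⟩, rfl⟩ := hκ
    simp [kindOf, hlq, ← hl, hb]
  | visibleInvisible =>
    obtain ⟨⟨hb, hl⟩, rfl⟩ := hκ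
    simp [kindOf, hlq, ← hl, hb.not_gt, hb.ne']
  | invisibleInvisible => exact hκ.elim
  | sigmaSaddle =>
    obtain rfl := hκ
    simp [kindOf]
  | sigmaAttractor =>
    obtain ⟨⟨hb, hl⟩, rfl⟩ := hκ
    have hp := hP.pos_of_gt hb hl
    simp [kindOf, hpq, hp.ne, (hp.trans hl).ne, hl.not_gt]
  | sigmaRepeller =>
    obtain ⟨⟨hb, hl⟩, rfl⟩ := hκ
    have hp := hP.pos_of_lt hb hl
    simp [kindOf, hpq, hp.ne', (hl.trans hp).ne', hl]

/-- A point of the line other than the two contacts is sewing, escaping or sliding, so if it is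
singular it must be a pseudo equilibrium. At a contact the type depends on whether the contacts
coincide and on the sign of `b`. -/
theorem exists_kindAt_of_isSingular (hm : m < 0) (h : InParams l b) {w : Plane}
    (hw : IsSingular (family l m b) w) : ∃ κ, KindAt l m b w κ := by
  have hpseudo : IsPseudoEquilibrium (family l m b) w → ∃ κ, KindAt l m b w κ := by
    rw [isPseudoEquilibrium_iff hm h]
    rintro (h1 | ⟨hb, hl, h1⟩)
    · exact ⟨.sigmaSaddle, h1⟩
    · rcases hl.lt_or_gt with hl | hl
      · exact ⟨.sigmaRepeller, ⟨hb, hl⟩, h1⟩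
      · exact ⟨.sigmaAttractor, ⟨hb, hl⟩, h1⟩
  rcases hw with hw | ⟨hw, hr⟩
  · exact ⟨.realSaddle, (isRealEquilibrium_iff hm.le w).1 hw⟩
  · have hslide : w ∈ escaping (family l m b) ∪ sliding (family l m b) →
        ∃ κ, KindAt l m b w κ := fun h' => by
      refine hpseudo ⟨h', ?_⟩
      by_contra h0
      exact hr (.inr ⟨h', h0⟩)
    rw [mem_switching_iff] at hw
    by_cases hl : w.1 = l
    · rw [hl] at hw
      by_cases hlc : l = contact m b
      · rcases lt_trichotomy b 0 with hb | hb | hb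
        · exact ⟨.visibleVisible, ⟨hb, hlc⟩, hw⟩
        · have hl0 : l = 0 := by rw [hlc, hb, contact_zero]
          exact ⟨.visibleFoldSaddle, ⟨hb, hl0⟩, by rw [hw, hl0]⟩
        · exact ⟨.visibleInvisible, ⟨hb, hlc⟩, hw⟩
      · exact ⟨.visibleFold, .inl ⟨hlc, hw⟩⟩
    by_cases hc : w.1 = contact m b
    · rw [hc] at hw hl
      rcases lt_trichotomy b 0 with hb | hb | hb
      · exact ⟨.visibleFold, .inr ⟨⟨hb, fun e => hl e.symm⟩, hw⟩⟩
      · rw [hb, contact_zero] at hw hl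
        exact ⟨.boundarySaddle, ⟨hb, fun e => hl e.symm⟩, hw⟩
      · exact ⟨.invisibleFold, ⟨hb, fun e => hl e.symm⟩, hw⟩
    refine hslide ?_
    rw [hw, mem_escaping_or_sliding_iff hm.le]
    by_contra hn
    refine hr (.inl ?_)
    rw [hw, mem_sewing_iff hm.le, min_lt_iff, lt_max_iff]
    grind

theorem existsUnique_kind (hm : m < 0) (h : InParams l b) {w : Plane}
    (hw : IsSingular (family l m b) w) : ∃! κ : SingKind, HasKind (family l m b) w κ := by
  obtain ⟨κ, hκ⟩ := exists_kindAt_of_isSingular hm h hw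
  refine ⟨κ, (hasKind_iff hm h w κ).2 hκ, fun κ' hκ' => ?_⟩
  rw [KindAt.eq_kindOf hm h hκ, KindAt.eq_kindOf hm h ((hasKind_iff hm h w κ').1 hκ')]

/-! ### The topological behaviours -/

/-- The number of singular points of each type in the representative cases. -/
def behaviourTable : ℕ → SingKind → ℕ
  | _, .sigmaSaddle => 1
  | 1, .visibleFold => 2
  | 2, .visibleVisible => 1
  | 4, .visibleFold => 1
  | 4, .boundarySaddle => 1
  | 5, .visibleFoldSaddle => 1
  | 7, .realSaddle => 1
  | 7, .visibleFold => 1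
  | 7, .invisibleFold => 1
  | 7, .sigmaRepeller => 1
  | 10, .realSaddle => 1
  | 10, .visibleInvisible => 1
  | 11, .realSaddle => 1
  | 11, .visibleFold => 1
  | 11, .invisibleFold => 1
  | 11, .sigmaAttractor => 1
  | _, _ => 0

theorem behaviour_apply (hm : m < 0) (h : InParams l b) (κ : SingKind) :
    behaviour (family l m b) κ = {w | KindAt l m b w κ}.encard := by
  simp only [behaviour, hasKind_iff hm h]

theorem behaviour_eq_table (hm : m < 0) (h : InParams l b) {k : ℕ} (hk : k ∈ Finset.Icc 1 13)
    (hc : (l, b) ∈ cell m k) :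
    behaviour (family l m b) = fun κ => (behaviourTable (representative k) κ : ℕ∞) := by
  have hr := contact_range (b := b) hm.le
  have z : b = 0 → contact m b = 0 := fun hb => by simp [hb, contact_zero]
  have two : l ≠ contact m b → ((l, 0) : Plane) ≠ (contact m b, 0) :=
    fun h h' => h (congrArg Prod.fst h')
  funext κ
  rw [behaviour_apply hm h]
  -- The counts see only the sign of `b` and the comparison of `l` with `c`; for `b ≤ 0` not even
  -- the side matters, while for `b > 0` it separates a repeller from an attractor.
  have key : (b < 0 ∧ l ≠ contact m b ∧ representative k = 1) ∨
      (b < 0 ∧ l = contact m b ∧ representative k = 2) ∨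
      (b = 0 ∧ l ≠ contact m b ∧ representative k = 4) ∨
      (b = 0 ∧ l = contact m b ∧ representative k = 5) ∨
      (0 < b ∧ l < contact m b ∧ representative k = 7) ∨
      (0 < b ∧ l = contact m b ∧ representative k = 10) ∨
      (0 < b ∧ contact m b < l ∧ representative k = 11) := by
    rw [Finset.mem_Icc] at hk
    obtain ⟨hk1, hk2⟩ := hk
    interval_cases k <;> simp only [cell, mem_ofPred_eq] at hc <;>
      simp only [representative] <;> grind
  rcases key with ⟨hb, hl, e⟩ | ⟨hb, hl, e⟩ | ⟨hb, hl, e⟩ | ⟨hb, hl, e⟩ | ⟨hb, hl, e⟩ |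
    ⟨hb, hl, e⟩ | ⟨hb, hl, e⟩ <;> rw [e]
  · cases κ <;> simp [KindAt, behaviourTable, hb, hb.ne, hb.not_gt, hl]
    exact encard_pair (two hl)
  · cases κ <;> simp [KindAt, behaviourTable, hb, hb.ne, hb.not_gt, hl]
  · rw [z hb] at hl
    subst hb
    cases κ <;> simp [KindAt, behaviourTable, hl, contact_zero]
  · rw [z hb] at hl
    subst hb
    cases κ <;> simp [KindAt, behaviourTable, hl, contact_zero]
  · cases κ <;> simp [KindAt, behaviourTable, hb, hb.ne', hb.not_gt, hl, hl.ne, hl.not_gt]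
  · cases κ <;> simp [KindAt, behaviourTable, hb, hb.ne', hb.not_gt, hl]
  · cases κ <;> simp [KindAt, behaviourTable, hb, hb.ne', hb.not_gt, hl, hl.ne', hl.not_gt]

/-- Six of the twelve counts already separate the seven rows. -/
theorem behaviourTable_inj {r r' : ℕ} (hr : r ∈ ({1, 2, 4, 5, 7, 10, 11} : Finset ℕ))
    (hr' : r' ∈ ({1, 2, 4, 5, 7, 10, 11} : Finset ℕ))
    (h : (fun κ => (behaviourTable r κ : ℕ∞)) = fun κ => (behaviourTable r' κ : ℕ∞)) :
    r = r' := by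
  have h' : ∀ κ, behaviourTable r κ = behaviourTable r' κ := fun κ => by
    have := congrFun h κ
    exact_mod_cast this
  have h1 := h' .visibleFold
  have h2 := h' .visibleVisible
  have h3 := h' .visibleFoldSaddle
  have h4 := h' .sigmaRepeller
  have h5 := h' .sigmaAttractor
  have h6 := h' .realSaddle
  clear h h'
  simp only [Finset.mem_insert, Finset.mem_singleton] at hr hr'
  rcases hr with rfl | rfl | rfl | rfl | rfl | rfl | rfl <;>
    rcases hr' with rfl | rfl | rfl | rfl | rfl | rfl | rfl <;>
    simp [behaviourTable] at h1 h2 h3 h4 h5 h6 ⊢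

theorem representative_mem {k : ℕ} (hk : k ∈ Finset.Icc 1 13) :
    representative k ∈ ({1, 2, 4, 5, 7, 10, 11} : Finset ℕ) := by
  revert k
  decide

theorem behaviour_eq_iff (hm : m < 0) {k k' : ℕ} (hk : k ∈ Finset.Icc 1 13)
    (hk' : k' ∈ Finset.Icc 1 13) {p p' : ℝ × ℝ} (hp : p ∈ cell m k ∩ params)
    (hp' : p' ∈ cell m k' ∩ params) :
    behaviour (family p.1 m p.2) = behaviour (family p'.1 m p'.2) ↔
      representative k = representative k' := by
  rw [behaviour_eq_table hm (inParams_of_mem hp.2) hk hp.1,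
    behaviour_eq_table hm (inParams_of_mem hp'.2) hk' hp'.1]
  exact ⟨behaviourTable_inj (representative_mem hk) (representative_mem hk'), fun h => by rw [h]⟩

theorem ncard_behaviours (hm : m < 0) :
    ((fun p : ℝ × ℝ => behaviour (family p.1 m p.2)) '' params).ncard = 7 := by
  have e : (fun p : ℝ × ℝ => behaviour (family p.1 m p.2)) '' params =
      (fun r κ => (behaviourTable r κ : ℕ∞)) '' ({1, 2, 4, 5, 7, 10, 11} : Finset ℕ) := by
    ext f
    constructor
    · rintro ⟨p, hp, rfl⟩
      exact ⟨_, representative_mem (caseIndex_mem p.1 (contact m p.2) p.2),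
        (behaviour_eq_table hm (inParams_of_mem hp) (caseIndex_mem _ _ _)
          (mem_cell_caseIndex _ _ _)).symm⟩
    · rintro ⟨r, hr, rfl⟩
      have hr' : r ∈ Finset.Icc 1 13 ∧ representative r = r := by
        revert r
        decide
      obtain ⟨p, hp, hp'⟩ := nonempty_cell hm hr'.1
      refine ⟨p, hp', ?_⟩
      have := behaviour_eq_table hm (inParams_of_mem hp') hr'.1 hp
      rw [hr'.2] at this
      exact this
  rw [e, InjOn.ncard_image, ncard_coe_finset]
  · rfl
  · intro r hr r' hr' h
    exact behaviourTable_inj hr hr' h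

end Kinds

/-! ### Trajectories and arcs made of pieces -/

section Arcs

/-- The curve `γ` follows one of the three vector fields at time `t`. -/
def Follows (Z : NSField) (γ : ℝ → Plane) (t : ℝ) : Prop :=
  (γ t ∈ upper ∧ HasDerivAt γ (Z.X (γ t)) t) ∨
    (γ t ∈ lower ∧ HasDerivAt γ (Z.Y (γ t)) t) ∨
    (γ t ∈ escaping Z ∪ sliding Z ∧ HasDerivAt γ (slidingField Z (γ t)) t)

theorem Follows.congr {Z : NSField} {γ γ' : ℝ → Plane} {t : ℝ} (h : Follows Z γ t)
    (he : γ' =ᶠ[𝓝 t] γ) : Follows Z γ' t := by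
  rw [Follows, he.eq_of_nhds]
  exact h.imp (fun h => ⟨h.1, h.2.congr_of_eventuallyEq he⟩)
    (Or.imp (fun h => ⟨h.1, h.2.congr_of_eventuallyEq he⟩)
      (fun h => ⟨h.1, h.2.congr_of_eventuallyEq he⟩))

/-- The curve `γ` until time `s`, then the curve `γ'`. -/
noncomputable def glue (s : ℝ) (γ γ' : ℝ → Plane) (t : ℝ) : Plane := if t ≤ s then γ t else γ' t

variable {s t : ℝ} {γ γ' : ℝ → Plane} {Z : NSField}

theorem glue_of_le (h : t ≤ s) : glue s γ γ' t = γ t := if_pos h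

theorem glue_of_gt (h : s < t) : glue s γ γ' t = γ' t := if_neg h.not_ge

theorem continuous_glue (h : Continuous γ) (h' : Continuous γ') (hs : γ s = γ' s) :
    Continuous (glue s γ γ') :=
  h.if_le h' continuous_id continuous_const fun t ht => by
    have : t = s := ht
    rw [this, hs]

theorem follows_glue_of_lt (h : Follows Z γ t) (ht : t < s) : Follows Z (glue s γ γ') t := by
  refine h.congr ?_
  filter_upwards [gt_mem_nhds ht] with r hr using glue_of_le hr.le

theorem follows_glue_of_gt (h : Follows Z γ' t) (ht : s < t) : Follows Z (glue s γ γ') t := by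
  refine h.congr ?_
  filter_upwards [lt_mem_nhds ht] with r hr using glue_of_gt hr

theorem injOn_glue {I : Set ℝ} (h : InjOn γ (I ∩ Iic s)) (h' : InjOn γ' (I ∩ Ioi s))
    (hd : ∀ t ∈ I, t ≤ s → ∀ t' ∈ I, s < t' → γ t ≠ γ' t') : InjOn (glue s γ γ') I := by
  intro t ht t' ht' e
  rcases le_or_gt t s with h1 | h1 <;> rcases le_or_gt t' s with h2 | h2
  · rw [glue_of_le h1, glue_of_le h2] at e
    exact h ⟨ht, h1⟩ ⟨ht', h2⟩ e
  · rw [glue_of_le h1, glue_of_gt h2] at e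
    exact absurd e (hd t ht h1 t' ht' h2)
  · rw [glue_of_gt h1, glue_of_le h2] at e
    exact absurd e.symm (hd t' ht' h2 t ht h1)
  · rw [glue_of_gt h1, glue_of_gt h2] at e
    exact h' ⟨ht, h1⟩ ⟨ht', h2⟩ e

/-- Arcs are defined with extended real end points. This and the next two lemmas reduce their limit
conditions to ordinary limits at a real number, at `-∞` and at `+∞`. -/
theorem comap_coe_nhdsWithin_le (a : ℝ) (S : Set EReal) :
    comap (fun t : ℝ => (t : EReal)) (𝓝[S] (a : EReal)) ≤ 𝓝 a := by
  rw [EReal.isEmbedding_coe.isInducing.nhds_eq_comap]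
  exact comap_mono nhdsWithin_le_nhds

theorem comap_coe_bot_le : comap (fun t : ℝ => (t : EReal)) (𝓝[>] ⊥) ≤ atBot := by
  intro S hS
  obtain ⟨a, ha⟩ := mem_atBot_sets.1 hS
  refine ⟨Iio (a : EReal), nhdsWithin_le_nhds (Iio_mem_nhds (EReal.bot_lt_coe a)), ?_⟩
  intro t ht
  exact ha t (EReal.coe_lt_coe_iff.1 ht).le

theorem comap_coe_top_le : comap (fun t : ℝ => (t : EReal)) (𝓝[<] ⊤) ≤ atTop := by
  intro S hS
  obtain ⟨a, ha⟩ := mem_atTop_sets.1 hS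
  refine ⟨Ioi (a : EReal), nhdsWithin_le_nhds (Ioi_mem_nhds (EReal.coe_lt_top a)), ?_⟩
  intro t ht
  exact ha t (EReal.coe_lt_coe_iff.1 ht).le

/-- The curves used are continuous on all of `ℝ`, so the limits at finite ends are simply values. -/
theorem isArc_Ioo {a b : ℝ} (hab : a < b) (hc : Continuous γ)
    (hT : ∃ T : Finset ℝ, ∀ t ∈ Ioo a b, t ∉ T → Follows Z γ t) (hi : InjOn γ (Ioo a b)) :
    IsArc Z (γ a) (γ b) (γ '' Ioo a b) := by
  have e : {t : ℝ | (a : EReal) < t ∧ (t : EReal) < b} = Ioo a b := by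
    ext t
    simp [EReal.coe_lt_coe_iff]
  refine ⟨a, b, γ, EReal.coe_lt_coe_iff.2 hab, ?_, ?_, ?_, ?_, ?_⟩ <;> try rw [e]
  · exact ⟨hc.continuousOn, hT⟩
  · exact hi
  · exact (hc.tendsto a).mono_left (comap_coe_nhdsWithin_le a _)
  · exact (hc.tendsto b).mono_left (comap_coe_nhdsWithin_le b _)

theorem isArc_Iio {b : ℝ} {p : Plane} (hc : Continuous γ) (hp : Tendsto γ atBot (𝓝 p))
    (hT : ∃ T : Finset ℝ, ∀ t ∈ Iio b, t ∉ T → Follows Z γ t) (hi : InjOn γ (Iio b)) :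
    IsArc Z p (γ b) (γ '' Iio b) := by
  have e : {t : ℝ | (⊥ : EReal) < t ∧ (t : EReal) < b} = Iio b := by
    ext t
    simp [EReal.coe_lt_coe_iff]
  refine ⟨⊥, b, γ, EReal.bot_lt_coe b, ?_, ?_, ?_, ?_, ?_⟩ <;> try rw [e]
  · exact ⟨hc.continuousOn, hT⟩
  · exact hi
  · exact hp.mono_left comap_coe_bot_le
  · exact (hc.tendsto b).mono_left (comap_coe_nhdsWithin_le b _)

theorem isArc_Ioi {a : ℝ} {p : Plane} (hc : Continuous γ) (hp : Tendsto γ atTop (𝓝 p))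
    (hT : ∃ T : Finset ℝ, ∀ t ∈ Ioi a, t ∉ T → Follows Z γ t) (hi : InjOn γ (Ioi a)) :
    IsArc Z (γ a) p (γ '' Ioi a) := by
  have e : {t : ℝ | (a : EReal) < t ∧ (t : EReal) < ⊤} = Ioi a := by
    ext t
    simp [EReal.coe_lt_coe_iff]
  refine ⟨a, ⊤, γ, EReal.coe_lt_top a, ?_, ?_, ?_, ?_, ?_⟩ <;> try rw [e]
  · exact ⟨hc.continuousOn, hT⟩
  · exact hi
  · exact (hc.tendsto a).mono_left (comap_coe_nhdsWithin_le a _)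
  · exact hp.mono_left comap_coe_top_le

end Arcs

/-! ### The sliding flow when the contacts coincide -/

section Slide

/-- The solution of `x' = k (q - x)` with `x 0 = c`. -/
noncomputable def slideX (k q c t : ℝ) : ℝ := q - (q - c) * Real.exp (-k * t)

variable {k q c : ℝ}

theorem slideX_zero : slideX k q c 0 = c := by simp [slideX]

theorem strictMono_slideX (hk : 0 < k) (hc : c < q) : StrictMono (slideX k q c) := by
  intro s t hst
  have h1 : Real.exp (-k * t) < Real.exp (-k * s) :=
    Real.exp_lt_exp.2 (by nlinarith)
  have := mul_lt_mul_of_pos_left h1 (sub_pos.2 hc)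
  simp only [slideX]
  linarith

theorem exists_slideX_eq (hk : 0 < k) (hc : c < q) {x : ℝ} (hx : x < q) :
    ∃ t, slideX k q c t = x := by
  have h1 : 0 < q - c := sub_pos.2 hc
  have h2 : 0 < (q - x) / (q - c) := div_pos (sub_pos.2 hx) h1
  refine ⟨-(Real.log ((q - x) / (q - c)) / k), ?_⟩
  rw [slideX, show -k * -(Real.log ((q - x) / (q - c)) / k) = Real.log ((q - x) / (q - c)) by
    field_simp, Real.exp_log h2, mul_div_cancel₀ _ h1.ne']
  ring

theorem hasDerivAt_slideX (k q c t : ℝ) :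
    HasDerivAt (slideX k q c) (k * (q - slideX k q c t)) t := by
  have h := (((hasDerivAt_const_mul (x := t) (-k)).exp).const_mul (q - c)).const_sub q
  refine h.congr_deriv ?_
  rw [slideX]
  ring

/-- The sliding motion as a curve in the plane. -/
noncomputable def slide (k q c a t : ℝ) : Plane := (slideX k q c (t + a), 0)

theorem continuous_slide (k q c a : ℝ) : Continuous (slide k q c a) := by
  unfold slide slideX
  fun_prop

theorem hasDerivAt_slide (k q c a t : ℝ) :
    HasDerivAt (slide k q c a) (k * (q - slideX k q c (t + a)), 0) t :=
  hasDerivAt_mk ((hasDerivAt_slideX k q c (t + a)).comp_add_const t a) (hasDerivAt_const t 0)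

theorem injective_slide (hk : 0 < k) (hc : c < q) (a : ℝ) : Function.Injective (slide k q c a) := by
  intro s t h
  have := (strictMono_slideX hk hc).injective (congrArg Prod.fst h)
  linarith

end Slide

/-! ### The graphs through the common contact -/

section Graphs

variable {l m b : ℝ}

/-- If the contacts coincide, `absP` coincides with them, and the factor `x - l` cancels between the
numerator and the denominator `-((4 - m) / 2 * (x - l))`. The sliding velocity thus extends across
the contact as an affine function that is positive there. -/
theorem direction_of_eq_contact (hm : m < 0) (h : InParams l b) (hl : l = contact m b) {x : ℝ}
    (hx : x ≠ l) : direction (family l m b) (x, 0) = -m / (4 - m) * (absQ l m b - x) := by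
  have hp := (position_absP hm h).of_eq hl
  rw [direction_eq hm.le, numer_factor hm h, hp, ← hl]
  have h1 : x - l ≠ 0 := sub_ne_zero.2 hx
  have h2 : (4 - m) ≠ 0 := by linarith
  have h3 : (2 - m) / 2 * (l - x) - (x - l) = -((4 - m) / 2 * (x - l)) := by ring
  rw [h3]
  field_simp
  ring

theorem sliding_rate_pos (hm : m < 0) : 0 < -m / (4 - m) :=
  div_pos (by linarith) (by linarith)

/-- The motion is at the double contact only when `t + a = 0`; at every other time it is strictly in
the sliding or the escaping region. -/
theorem follows_slide (hm : m < 0) (h : InParams l b) (hl : l = contact m b) {a t : ℝ}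
    (ht : t + a ≠ 0) :
    Follows (family l m b) (slide (-m / (4 - m)) (absQ l m b) l a) t := by
  have hq := fold_lt_absQ hm h
  have hmono := strictMono_slideX (sliding_rate_pos hm) hq
  have hne : slideX (-m / (4 - m)) (absQ l m b) l (t + a) ≠ l := by
    intro h'
    refine ht (hmono.injective ?_)
    rw [h', slideX_zero]
  refine .inr (.inr ⟨?_, ?_⟩)
  · rw [slide, mem_escaping_or_sliding_iff hm.le, ← hl]
    rcases hne.lt_or_gt with h' | h'
    · exact .inr ⟨h', h'⟩
    · exact .inl ⟨h', h'⟩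
  · rw [slidingField, slide, direction_of_eq_contact hm h hl hne]
    exact hasDerivAt_slide _ _ _ _ _

theorem follows_orbitY {u v a t : ℝ} (h : (orbitY m b u v (t + a)).2 < 0) :
    Follows (family l m b) (fun t => orbitY m b u v (t + a)) t :=
  .inr (.inl ⟨h, (hasDerivAt_orbitY l m b u v (t + a)).comp_add_const t a⟩)

theorem isTangential_fold (hm : m ≤ 0) (hb : b ≠ 0) (l : ℝ) :
    IsTangential (family l m b) (l, 0) := by
  refine ⟨rfl, family_X_ne_zero _, ?_, ?_⟩
  · rw [ne_eq, family_Y_eq_zero_iff hm, Prod.mk.injEq]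
    rintro ⟨-, h⟩
    exact hb (neg_eq_zero.1 h.symm)
  · rw [lie1_X, sub_self, zero_mul]

/-- The part of the boundary of the triangle on the left of the contact. -/
def leftSide (l b : ℝ) : Set Plane :=
  {w | (w.1 = -(w.2 + b) ∧ -b < w.2 ∧ w.2 ≤ 0) ∨ (w.2 = 0 ∧ -b < w.1 ∧ w.1 < l)}

/-- The part of the boundary of the triangle on the right of the contact. -/
def rightSide (l b : ℝ) : Set Plane :=
  {w | (w.2 = 0 ∧ l < w.1 ∧ w.1 ≤ b) ∨ (w.1 = w.2 + b ∧ -b < w.2 ∧ w.2 < 0)}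

theorem orbitY_unstable (m b t : ℝ) :
    orbitY m b 0 (-2 * b) t = (-(b * Real.exp t), b * Real.exp t - b) := by
  rw [orbitY]
  ext <;> simp only <;> ring

theorem orbitY_stable (m b t : ℝ) :
    orbitY m b (2 * b) 0 t = (b * Real.exp ((m - 1) * t), b * Real.exp ((m - 1) * t) - b) := by
  rw [orbitY]
  ext <;> simp only <;> ring

/-- The arc leaves the saddle along its unstable separatrix, reaches the line at `-b`, which is a
sliding point, and slides right until it arrives at the contact in finite time. -/
theorem isArc_leftSide (hm : m < 0) (h : InParams l b) (hb : 0 < b) (hl : l = contact m b) :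
    IsArc (family l m b) (0, -b) (l, 0) (leftSide l b) := by
  have hq := fold_lt_absQ hm h
  have hk := sliding_rate_pos hm
  have hr := contact_range hm.le hb
  rw [← hl] at hr
  set k := -m / (4 - m)
  set q := absQ l m b
  have hmono := strictMono_slideX hk hq
  -- The sliding clock is `0` at the contact, so `-b` is passed at a negative time `τ`, and sliding
  -- from `-b` to the contact takes time `-τ`.
  obtain ⟨τ, hτ⟩ := exists_slideX_eq hk hq (show -b < q by linarith)
  have hτ0 : τ < 0 := by
    rw [← hmono.lt_iff_lt, hτ, slideX_zero]
    exact hr.1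
  set γ := glue 0 (fun t => orbitY m b 0 (-2 * b) (t + 0)) (slide k q l τ) with hγ
  have hγ1 : ∀ t ≤ 0, γ t = (-(b * Real.exp t), b * Real.exp t - b) := fun t ht => by
    rw [hγ, glue_of_le ht, add_zero, orbitY_unstable]
  have hγ2 : ∀ t > 0, γ t = (slideX k q l (t + τ), 0) := fun t ht => by
    rw [hγ, glue_of_gt ht, slide]
  have hc : Continuous γ := by
    refine continuous_glue ((continuous_orbitY _ _ _ _).comp (continuous_add_const 0))
      (continuous_slide _ _ _ _) ?_
    simp only [add_zero]
    rw [orbitY_unstable, slide, zero_add, hτ]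
    simp
  have himage : γ '' Iio (-τ) = leftSide l b := by
    ext w
    constructor
    · rintro ⟨t, ht, rfl⟩
      rcases le_or_gt t 0 with h0 | h0
      · rw [hγ1 t h0]
        have h1 := Real.exp_pos t
        have h2 := Real.exp_le_one_iff.2 h0
        refine .inl ⟨by ring, ?_, ?_⟩ <;> simp only <;> nlinarith
      · rw [hγ2 t h0]
        have ht' : t + τ < 0 := by linarith [mem_Iio.1 ht]
        refine .inr ⟨rfl, ?_, ?_⟩
        · simp only
          rw [← hτ]
          exact hmono (by linarith)
        · exact (hmono ht').trans_eq slideX_zero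
    · rintro (⟨h1, h2, h3⟩ | ⟨h1, h2, h3⟩)
      · have hpos : 0 < (w.2 + b) / b := div_pos (by linarith) hb
        have hle : (w.2 + b) / b ≤ 1 := (div_le_one hb).2 (by linarith)
        have h0 := Real.log_nonpos hpos.le hle
        refine ⟨Real.log ((w.2 + b) / b), mem_Iio.2 (by linarith), ?_⟩
        rw [hγ1 _ h0, Real.exp_log hpos, mul_div_cancel₀ _ hb.ne']
        ext <;> simp [h1]
      · obtain ⟨t, ht⟩ := exists_slideX_eq hk hq (show w.1 < q by linarith)
        have h4 : τ < t := by rwa [← hmono.lt_iff_lt, hτ, ht]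
        have h5 : t < 0 := by rwa [← hmono.lt_iff_lt, slideX_zero, ht]
        refine ⟨t - τ, mem_Iio.2 (by linarith), ?_⟩
        rw [hγ2 _ (by linarith), sub_add_cancel, ht, ← h1]
  have hend : γ (-τ) = (l, 0) := by
    rw [hγ2 _ (by linarith), neg_add_cancel, slideX_zero]
  rw [← himage, ← hend]
  refine isArc_Iio hc ?_ ⟨{0}, fun t ht h0 => ?_⟩ ?_
  · refine (tendsto_orbitY_atBot m b (-2 * b)).congr' ?_
    filter_upwards [eventually_le_atBot 0] with t ht
    rw [hγ1 t ht, orbitY_unstable]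
  · rw [Finset.mem_singleton] at h0
    rcases Ne.lt_or_gt h0 with h0 | h0
    · refine follows_glue_of_lt (follows_orbitY ?_) h0
      rw [add_zero, orbitY_unstable]
      have := Real.exp_lt_one_iff.2 h0
      simp only
      nlinarith
    · refine follows_glue_of_gt (follows_slide hm h hl ?_) h0
      have := mem_Iio.1 ht
      linarith
  · refine injOn_glue ?_ (injective_slide hk hq τ).injOn ?_
    · intro s _ t _ e
      simp only [add_zero, orbitY_unstable, Prod.mk.injEq] at e
      exact Real.exp_injective (mul_left_cancel₀ hb.ne' (neg_inj.1 e.1))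
    · intro t _ ht t' _ ht' e
      simp only [add_zero, orbitY_unstable, slide, Prod.mk.injEq] at e
      have h1 : slideX k q l τ < slideX k q l (t' + τ) := hmono (by linarith)
      rw [hτ, ← e.1] at h1
      linarith [e.2]

/-- From the contact the motion slides right through the escaping region up to `b`, which comes
before `absQ`, and leaves the line there along the stable separatrix of the saddle. -/
theorem isArc_rightSide (hm : m < 0) (h : InParams l b) (hb : 0 < b) (hl : l = contact m b) :
    IsArc (family l m b) (l, 0) (0, -b) (rightSide l b) := by
  have hq := fold_lt_absQ hm h
  have hk := sliding_rate_pos hm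
  have hr := contact_range hm.le hb
  rw [← hl] at hr
  have hbq := (absP_lt_abs_lt_absQ hm h).2
  rw [abs_of_pos hb] at hbq
  set k := -m / (4 - m)
  set q := absQ l m b
  have hmono := strictMono_slideX hk hq
  obtain ⟨τ, hτ⟩ := exists_slideX_eq hk hq hbq
  have hτ0 : 0 < τ := by
    rw [← hmono.lt_iff_lt, hτ, slideX_zero]
    exact hr.2
  set γ := glue τ (slide k q l 0) (fun t => orbitY m b (2 * b) 0 (t + -τ)) with hγ
  have hγ1 : ∀ t ≤ τ, γ t = (slideX k q l t, 0) := fun t ht => by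
    rw [hγ, glue_of_le ht, slide, add_zero]
  have hγ2 : ∀ t > τ, γ t = (b * Real.exp ((m - 1) * (t + -τ)),
      b * Real.exp ((m - 1) * (t + -τ)) - b) := fun t ht => by
    rw [hγ, glue_of_gt ht, orbitY_stable]
  have hlt : ∀ t > τ, Real.exp ((m - 1) * (t + -τ)) < 1 := fun t ht =>
    Real.exp_lt_one_iff.2 (mul_neg_of_neg_of_pos (by linarith) (by linarith [ht.lt]))
  have hc : Continuous γ := by
    refine continuous_glue (continuous_slide _ _ _ _)
      ((continuous_orbitY _ _ _ _).comp (continuous_add_const _)) ?_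
    simp only [add_neg_cancel]
    rw [orbitY_stable, slide, add_zero, hτ]
    simp
  have himage : γ '' Ioi 0 = rightSide l b := by
    ext w
    constructor
    · rintro ⟨t, ht, rfl⟩
      rcases le_or_gt t τ with h0 | h0
      · rw [hγ1 t h0]
        refine .inl ⟨rfl, ?_, ?_⟩
        · exact slideX_zero.symm.trans_lt (hmono ht)
        · exact (hmono.monotone h0).trans_eq hτ
      · rw [hγ2 t h0]
        have h1 := Real.exp_pos ((m - 1) * (t + -τ))
        have h2 := hlt t h0
        refine .inr ⟨by ring, ?_, ?_⟩ <;> simp only <;> nlinarith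
    · rintro (⟨h1, h2, h3⟩ | ⟨h1, h2, h3⟩)
      · obtain ⟨t, ht⟩ := exists_slideX_eq hk hq (show w.1 < q by linarith)
        have h4 : t ≤ τ := by rwa [← hmono.le_iff_le, hτ, ht]
        have h5 : 0 < t := by rwa [← hmono.lt_iff_lt, slideX_zero, ht]
        refine ⟨t, h5, ?_⟩
        rw [hγ1 _ h4, ht, ← h1]
      · have hpos : 0 < (w.2 + b) / b := div_pos (by linarith) hb
        have hle : (w.2 + b) / b < 1 := (div_lt_one hb).2 (by linarith)
        have h0 := Real.log_neg hpos hle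
        have h4 : 0 < Real.log ((w.2 + b) / b) / (m - 1) :=
          div_pos_of_neg_of_neg h0 (by linarith)
        refine ⟨Real.log ((w.2 + b) / b) / (m - 1) + τ, mem_Ioi.2 (by linarith), ?_⟩
        rw [hγ2 _ (by linarith), add_neg_cancel_right, mul_div_cancel₀ _ (by linarith),
          Real.exp_log hpos, mul_div_cancel₀ _ hb.ne']
        ext <;> simp [h1]
  have hstart : γ 0 = (l, 0) := by
    rw [hγ1 _ hτ0.le, slideX_zero]
  rw [← himage, ← hstart]
  refine isArc_Ioi hc ?_ ⟨{τ}, fun t ht h0 => ?_⟩ ?_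
  · refine ((tendsto_orbitY_atTop hm.le b (2 * b)).comp
      (tendsto_atTop_add_const_right atTop (-τ) tendsto_id)).congr' ?_
    filter_upwards [eventually_gt_atTop τ] with t ht
    rw [hγ2 t ht, Function.comp_apply, orbitY_stable, id]
  · rw [Finset.mem_singleton] at h0
    rcases Ne.lt_or_gt h0 with h0 | h0
    · refine follows_glue_of_lt (follows_slide hm h hl ?_) h0
      have := mem_Ioi.1 ht
      linarith
    · refine follows_glue_of_gt (follows_orbitY ?_) h0
      rw [orbitY_stable]
      have := hlt t h0
      simp only
      nlinarith
  · refine injOn_glue (injective_slide hk hq 0).injOn ?_ ?_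
    · intro s _ t _ e
      simp only [orbitY_stable, Prod.mk.injEq] at e
      have e1 := Real.exp_injective (mul_left_cancel₀ hb.ne' e.1)
      have e2 := mul_left_cancel₀ (show m - 1 ≠ 0 by linarith) e1
      linarith
    · intro t _ ht t' _ ht' e
      simp only [orbitY_stable, slide, Prod.mk.injEq] at e
      have := hlt t' ht'
      have h2 := e.2
      nlinarith

theorem mem_segment_line {w : Plane} (hb : 0 < b) :
    w ∈ segment ℝ ((-b, 0) : Plane) (b, 0) ↔ w.2 = 0 ∧ -b ≤ w.1 ∧ w.1 ≤ b := by
  constructor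
  · rintro ⟨x, y, hx, hy, hxy, rfl⟩
    simp only [Prod.smul_mk, Prod.mk_add_mk, smul_eq_mul]
    refine ⟨by ring, ?_, ?_⟩ <;> nlinarith
  · rintro ⟨h1, h2, h3⟩
    refine ⟨(b - w.1) / (2 * b), (b + w.1) / (2 * b), div_nonneg (by linarith) (by linarith),
      div_nonneg (by linarith) (by linarith), by field_simp; ring, ?_⟩
    ext
    · simp only [Prod.smul_mk, Prod.mk_add_mk, smul_eq_mul]
      field_simp
      ring
    · simp [h1]

theorem mem_segment_right {w : Plane} (hb : 0 < b) :
    w ∈ segment ℝ ((b, 0) : Plane) (0, -b) ↔ w.1 = w.2 + b ∧ -b ≤ w.2 ∧ w.2 ≤ 0 := by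
  constructor
  · rintro ⟨x, y, hx, hy, hxy, rfl⟩
    simp only [Prod.smul_mk, Prod.mk_add_mk, smul_eq_mul]
    refine ⟨?_, ?_, ?_⟩
    · linear_combination b * hxy
    · nlinarith
    · nlinarith
  · rintro ⟨h1, h2, h3⟩
    refine ⟨(w.2 + b) / b, -w.2 / b, div_nonneg (by linarith) hb.le,
      div_nonneg (by linarith) hb.le, by field_simp; ring, ?_⟩
    ext
    · simp only [Prod.smul_mk, Prod.mk_add_mk, smul_eq_mul]
      rw [h1]
      field_simp
      ring
    · simp only [Prod.smul_mk, Prod.mk_add_mk, smul_eq_mul]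
      field_simp
      ring

theorem mem_segment_left {w : Plane} (hb : 0 < b) :
    w ∈ segment ℝ ((0, -b) : Plane) (-b, 0) ↔ w.1 = -(w.2 + b) ∧ -b ≤ w.2 ∧ w.2 ≤ 0 := by
  constructor
  · rintro ⟨x, y, hx, hy, hxy, rfl⟩
    simp only [Prod.smul_mk, Prod.mk_add_mk, smul_eq_mul]
    refine ⟨?_, ?_, ?_⟩
    · linear_combination -b * hxy
    · nlinarith
    · nlinarith
  · rintro ⟨h1, h2, h3⟩
    refine ⟨-w.2 / b, (w.2 + b) / b, div_nonneg (by linarith) hb.le,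
      div_nonneg (by linarith) hb.le, by field_simp; ring, ?_⟩
    ext
    · simp only [Prod.smul_mk, Prod.mk_add_mk, smul_eq_mul]
      rw [h1]
      field_simp
      ring
    · simp only [Prod.smul_mk, Prod.mk_add_mk, smul_eq_mul]
      field_simp
      ring

theorem triangle_eq (hl : -b < l) (hl' : l < b) :
    (segment ℝ ((-b, 0) : Plane) (b, 0) ∪ segment ℝ ((b, 0) : Plane) (0, -b) ∪
      segment ℝ ((0, -b) : Plane) (-b, 0)) =
    {((0, -b) : Plane), (l, 0)} ∪ (leftSide l b ∪ rightSide l b) := by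
  have hb : 0 < b := by linarith
  ext ⟨x, y⟩
  simp only [mem_union, mem_segment_line hb, mem_segment_right hb, mem_segment_left hb,
    mem_insert_iff, mem_singleton_iff, leftSide, rightSide, mem_ofPred_eq, Prod.mk.injEq]
  grind

theorem mem_region_of_mem_line (hm : m ≤ 0) (hl : l = contact m b) {x : ℝ} (hx : x ≠ l) :
    (x, 0) ∈ escaping (family l m b) ∪ sliding (family l m b) := by
  rw [mem_escaping_or_sliding_iff hm, ← hl]
  rcases hx.lt_or_gt with h | h
  · exact .inr ⟨h, h⟩
  · exact .inl ⟨h, h⟩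

/-- A graph through the common contact that is not contained in the line is of kind III. -/
theorem isSigmaGraphIII_of_isSigmaGraph (hm : m ≤ 0) (hb : b ≠ 0) (hl : l = contact m b)
    {D : Set Plane} (hD : IsSigmaGraph (family l m b) D) (h1 : ¬ D ⊆ switching) {x : ℝ}
    (hx : x ≠ l) (hxD : ((x, 0) : Plane) ∈ D) : IsSigmaGraphIII (family l m b) D := by
  refine ⟨hD, h1, ⟨(x, 0), hxD, mem_region_of_mem_line hm hl hx⟩, ?_⟩
  rintro w ⟨-, hw⟩
  rw [mem_switching_iff] at hw
  by_cases h : w.1 = l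
  · rw [hw, h]
    exact .inr (isTangential_fold hm hb l)
  · rw [hw]
    exact .inl (mem_region_of_mem_line hm hl h)

theorem isSigmaGraphIII_triangle (hm : m < 0) (h : InParams l b) (hb : 0 < b)
    (hl : l = contact m b) :
    IsSigmaGraphIII (family l m b)
      (segment ℝ ((-b, 0) : Plane) (b, 0) ∪ segment ℝ ((b, 0) : Plane) (0, -b) ∪
        segment ℝ ((0, -b) : Plane) (-b, 0)) := by
  have hr := contact_range hm.le hb
  rw [← hl] at hr
  obtain ⟨hr1, hr2⟩ := hr
  rw [triangle_eq hr1 hr2]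
  have hS : ((0, -b) : Plane) ∉ leftSide l b ∪ rightSide l b := by
    simp [leftSide, rightSide, hb.ne']
  have hd : ((l, 0) : Plane) ∉ leftSide l b ∪ rightSide l b := by
    simp only [leftSide, rightSide, mem_union, mem_ofPred_eq]
    grind
  have hD : {((0, -b) : Plane), (l, 0)} ∪ (leftSide l b ∪ rightSide l b) =
      range (![(0, -b), (l, 0)] : Fin 2 → Plane) ∪
        ⋃ i, (![leftSide l b, rightSide l b] : Fin 2 → Set Plane) i := by
    ext w
    simp only [mem_union, mem_insert_iff, mem_singleton_iff, mem_range, mem_iUnion,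
      Fin.exists_fin_two, Matrix.cons_val_zero, Matrix.cons_val_one, eq_comm (a := w)]
  refine isSigmaGraphIII_of_isSigmaGraph hm.le hb.ne' hl (x := -b) ?_ ?_ hr1.ne ?_
  -- The vertices are the saddle and the contact; the corners `(-b, 0)` and `(b, 0)` are switching
  -- points inside the arcs.
  · refine ⟨1, ![(0, -b), (l, 0)], ![leftSide l b, rightSide l b], ?_, ?_, ?_, ?_, ?_, ?_, ?_⟩
    · intro i j hij
      fin_cases i <;> fin_cases j <;> simp [hb.ne'] at hij ⊢
    · rw [Fin.forall_fin_two]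
      exact ⟨.inl ((isRealEquilibrium_iff hm.le _).2 ⟨hb, rfl⟩),
        .inr (.inr (.inr (isTangential_fold hm.le hb.ne' l)))⟩
    · rw [Fin.forall_fin_two]
      exact ⟨isArc_leftSide hm h hb hl, isArc_rightSide hm h hb hl⟩
    · have hdis : Disjoint (leftSide l b) (rightSide l b) := by
        rw [disjoint_left]
        rintro ⟨x, y⟩
        simp only [leftSide, rightSide, mem_ofPred_eq]
        grind
      intro i j hij
      fin_cases i <;> fin_cases j
      · exact absurd rfl hij
      · exact hdis
      · exact hdis.symm
      · exact absurd rfl hij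
    · rw [mem_union, not_or] at hS hd
      intro i j
      fin_cases i <;> fin_cases j
      exacts [hS.1, hS.2, hd.1, hd.2]
    · exact hD
    · exact ⟨(l, 0), by simp, rfl⟩
  · intro h'
    have : ((0, -b) : Plane) ∈ switching := h' (by simp)
    exact hb.ne' (neg_eq_zero.1 this)
  · refine .inr (.inl (.inl ⟨by simp, by simpa using hb, le_rfl⟩))

/-! ### The graphs in the interior of the triangle -/

/-- For `u > 0 > v` the height is, up to a constant, a sum of exponentials with positive
coefficients, hence convex, and lies above its tangents. The inequality reduces to `1 + z ≤ exp z`.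
-/
theorem orbitY_snd_tangent {u v : ℝ} (hu : 0 < u) (hv : v < 0) (s t : ℝ) :
    (orbitY m b u v t).2 + ((family l m b).Y (orbitY m b u v t)).2 * (s - t) ≤
      (orbitY m b u v s).2 := by
  have h1 := Real.add_one_le_exp ((m - 1) * (s - t))
  have h2 := Real.add_one_le_exp (s - t)
  have e1 : Real.exp ((m - 1) * s) = Real.exp ((m - 1) * t) * Real.exp ((m - 1) * (s - t)) := by
    rw [← Real.exp_add]
    ring_nf
  have e2 : Real.exp s = Real.exp t * Real.exp (s - t) := by
    rw [← Real.exp_add]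
    ring_nf
  have h3 := mul_le_mul_of_nonneg_left h1 (mul_pos hu (Real.exp_pos ((m - 1) * t))).le
  have h4 := mul_le_mul_of_nonneg_left h2 (mul_pos (neg_pos.2 hv) (Real.exp_pos t)).le
  simp only [orbitY, family_Y, e1, e2]
  linarith

/-- A convex height that is negative at time `0` and becomes nonnegative in both time directions
vanishes once on each side, is negative in between, and crosses zero transversally. -/
theorem exists_orbitY_crossings {u v : ℝ} (hm : m ≤ 0) (hu : 0 < u) (hv : v < 0)
    (h0 : (orbitY m b u v 0).2 < 0) : ∃ t₁ t₂, t₁ < 0 ∧ 0 < t₂ ∧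
      (orbitY m b u v t₁).2 = 0 ∧ (orbitY m b u v t₂).2 = 0 ∧
      (∀ t ∈ Ioo t₁ t₂, (orbitY m b u v t).2 < 0) ∧
      ((family l m b).Y (orbitY m b u v t₁)).2 < 0 ∧
      0 < ((family l m b).Y (orbitY m b u v t₂)).2 := by
  have hc : Continuous fun t => (orbitY m b u v t).2 :=
    continuous_snd.comp (continuous_orbitY _ _ _ _)
  have h0' : (u - v) / 2 < b := by
    simpa [orbitY] using h0
  have hb : 0 < b := by linarith
  have key := orbitY_snd_tangent (l := l) (m := m) (b := b) hu hv
  obtain ⟨t₂, ht₂, e₂⟩ : ∃ t, 0 < t ∧ (orbitY m b u v t).2 = 0 := by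
    -- At this time the growing exponential alone compensates `-b`, and the other term is positive;
    -- for negative times `u` plays the role of `-v`.
    have hT : 0 < Real.log (2 * b / -v) := by
      refine Real.log_pos ?_
      rw [lt_div_iff₀ (by linarith)]
      linarith
    have hval : 0 ≤ (orbitY m b u v (Real.log (2 * b / -v))).2 := by
      simp only [orbitY]
      rw [Real.exp_log (div_pos (by linarith) (by linarith))]
      have := mul_pos hu (Real.exp_pos ((m - 1) * Real.log (2 * b / -v)))
      have e : v * (2 * b / -v) = -(2 * b) := by
        field_simp [hv.ne]
      rw [e]
      linarith
    obtain ⟨t, ht, e⟩ := intermediate_value_Icc hT.le hc.continuousOn ⟨h0.le, hval⟩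
    refine ⟨t, lt_of_le_of_ne ht.1 fun h => ?_, e⟩
    rw [← h] at e
    exact h0.ne e
  obtain ⟨t₁, ht₁, e₁⟩ : ∃ t, t < 0 ∧ (orbitY m b u v t).2 = 0 := by
    have hlog : 0 < Real.log (2 * b / u) := by
      refine Real.log_pos ?_
      rw [lt_div_iff₀ hu]
      linarith
    have hT : Real.log (2 * b / u) / (m - 1) < 0 := div_neg_of_pos_of_neg hlog (by linarith)
    have hval : 0 ≤ (orbitY m b u v (Real.log (2 * b / u) / (m - 1))).2 := by
      simp only [orbitY]
      rw [mul_div_cancel₀ _ (by linarith), Real.exp_log (div_pos (by linarith) hu)]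
      have := mul_pos (neg_pos.2 hv) (Real.exp_pos (Real.log (2 * b / u) / (m - 1)))
      have e : u * (2 * b / u) = 2 * b := by
        field_simp
      rw [e]
      linarith
    obtain ⟨t, ht, e⟩ := intermediate_value_Icc' hT.le hc.continuousOn ⟨h0.le, hval⟩
    refine ⟨t, lt_of_le_of_ne ht.2 fun h => ?_, e⟩
    rw [h] at e
    exact h0.ne e
  refine ⟨t₁, t₂, ht₁, ht₂, e₁, e₂, fun t ht => ?_, ?_, ?_⟩
  -- If the height were nonnegative at an intermediate time, the tangent there could not exceed `0`
  -- at either crossing, so it would be horizontal, against the negative height at time `0`.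
  · by_contra! hneg
    have k1 := key t₁ t
    have k2 := key t₂ t
    have k0 := key 0 t
    rw [e₁] at k1
    rw [e₂] at k2
    generalize ((family l m b).Y (orbitY m b u v t)).2 = d at k1 k2 k0
    have hd1 : 0 ≤ d := by
      by_contra! hd
      nlinarith [ht.1]
    have hd2 : d ≤ 0 := by
      by_contra! hd
      nlinarith [ht.2]
    have hd : d = 0 := le_antisymm hd2 hd1
    rw [hd] at k0
    linarith
  · have k0 := key 0 t₁
    rw [e₁] at k0
    by_contra! hd
    nlinarith
  · have k0 := key 0 t₂
    rw [e₂] at k0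
    by_contra! hd
    nlinarith

/-- On the line, `x + b` is the first decoupled coordinate and `x - b` the second, and these keep
the signs of `u` and `v`. -/
theorem orbitY_fst_range {u v t : ℝ} (hu : 0 < u) (hv : v < 0) (h : (orbitY m b u v t).2 = 0) :
    -b < (orbitY m b u v t).1 ∧ (orbitY m b u v t).1 < b := by
  have h1 := mul_pos hu (Real.exp_pos ((m - 1) * t))
  have h2 := mul_pos (neg_pos.2 hv) (Real.exp_pos t)
  simp only [orbitY] at h ⊢
  constructor <;> linarith

theorem injective_orbitY {u v : ℝ} (hm : m ≤ 0) (hu : u ≠ 0) :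
    Function.Injective (orbitY m b u v) := by
  intro s t e
  simp only [orbitY, Prod.mk.injEq] at e
  have e1 : u * Real.exp ((m - 1) * s) = u * Real.exp ((m - 1) * t) := by
    linarith [e.1, e.2]
  exact mul_left_cancel₀ (show m - 1 ≠ 0 by linarith)
    (Real.exp_injective (mul_left_cancel₀ hu e1))

/-- The interior of the triangle is the part of the lower half plane where the decoupled coordinates
satisfy `u > 0 > v`. The orbit of `Y` through `w` comes down from an escaping point and goes up to a
sliding point. Sliding from the contact to the former and from the latter back to the contact closes
the loop. -/
theorem exists_isSigmaGraphIII (hm : m < 0) (h : InParams l b) (hl : l = contact m b)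
    {w : Plane} (hw : w.2 < 0) (hw' : |w.1| < w.2 + b) :
    ∃ D, IsSigmaGraphIII (family l m b) D ∧ w ∈ D ∧ (l, 0) ∈ D := by
  obtain ⟨hw1, hw2⟩ := abs_lt.1 hw'
  have hb : 0 < b := by linarith
  have hq := fold_lt_absQ hm h
  have hk := sliding_rate_pos hm
  have hr := contact_range hm.le hb
  rw [← hl] at hr
  have hbq := (absP_lt_abs_lt_absQ hm h).2
  rw [abs_of_pos hb] at hbq
  set k := -m / (4 - m)
  set q := absQ l m b
  have hmono := strictMono_slideX hk hq
  obtain ⟨u, hu_def⟩ : ∃ u, u = w.1 + (w.2 + b) := ⟨_, rfl⟩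
  obtain ⟨v, hv_def⟩ : ∃ v, v = w.1 - (w.2 + b) := ⟨_, rfl⟩
  have hu : 0 < u := by linarith
  have hv : v < 0 := by linarith
  have hη0 : orbitY m b u v 0 = w := by
    simp only [orbitY, mul_zero, Real.exp_zero, mul_one]
    ext <;> simp only <;> linarith
  obtain ⟨t₁, t₂, ht₁, ht₂, e₁, e₂, hneg, hd₁, hd₂⟩ :=
    exists_orbitY_crossings (l := l) (b := b) hm.le hu hv (by rw [hη0]; exact hw)
  have hx₁ := orbitY_fst_range hu hv e₁
  have hx₂ := orbitY_fst_range hu hv e₂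
  have hη₁ : orbitY m b u v t₁ = ((orbitY m b u v t₁).1, 0) := Prod.ext rfl e₁
  have hη₂ : orbitY m b u v t₂ = ((orbitY m b u v t₂).1, 0) := Prod.ext rfl e₂
  -- The direction of crossing fixes the side: downward crossings of `Y` are to the right of the
  -- contact, upward ones to the left.
  rw [← lie1_eq, hη₁, lie1_Y_neg hm.le, ← hl] at hd₁
  rw [← lie1_eq, hη₂, lie1_Y_pos hm.le, ← hl] at hd₂
  obtain ⟨τ₁, hτ₁⟩ := exists_slideX_eq hk hq (hx₁.2.trans hbq)
  obtain ⟨τ₂, hτ₂⟩ := exists_slideX_eq hk hq (hx₂.2.trans hbq)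
  have hτ₁0 : 0 < τ₁ := by rwa [← hmono.lt_iff_lt, hτ₁, slideX_zero]
  have hτ₂0 : τ₂ < 0 := by rwa [← hmono.lt_iff_lt, hτ₂, slideX_zero]
  -- One clock for the loop: sliding until `τ₁`, the orbit of `Y` until `T`, then sliding again
  -- until `T - τ₂`, where `τ₂ < 0`. The shifts make consecutive pieces agree at `τ₁` and `T`.
  set η : ℝ → Plane := fun t => orbitY m b u v (t + (t₁ - τ₁)) with hη
  set T := τ₁ + (t₂ - t₁) with hT
  set γ := glue τ₁ (slide k q l 0) (glue T η (slide k q l (τ₂ - T))) with hγ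
  have hητ : η τ₁ = orbitY m b u v t₁ := by simp [hη]
  have hηT : η T = orbitY m b u v t₂ := by
    simp only [hη, hT]
    congr 1
    ring
  have hηneg : ∀ t, τ₁ < t → t < T → (η t).2 < 0 := fun t h1 h2 =>
    hneg _ ⟨by linarith, by linarith⟩
  have hτT : τ₁ < T := by linarith
  have hc : Continuous γ := by
    have hcη : Continuous η := (continuous_orbitY _ _ _ _).comp (continuous_add_const _)
    refine continuous_glue (continuous_slide _ _ _ _)
      (continuous_glue hcη (continuous_slide _ _ _ _) ?_) ?_
    · rw [hηT, hη₂, slide, add_sub_cancel, hτ₂]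
    · rw [glue_of_le hτT.le, hητ, hη₁, slide, add_zero, hτ₁]
  have hγ0 : γ 0 = (l, 0) := by
    rw [hγ, glue_of_le hτ₁0.le, slide, add_zero, slideX_zero]
  have hγend : γ (T - τ₂) = (l, 0) := by
    rw [hγ, glue_of_gt (by linarith), glue_of_gt (by linarith), slide,
      show T - τ₂ + (τ₂ - T) = 0 by ring, slideX_zero]
  -- After `τ₁` the curve is below the line or to the left of the contact, so it meets neither the
  -- first sliding piece nor the contact.
  have hlate : ∀ t, τ₁ < t → t < T - τ₂ → (glue T η (slide k q l (τ₂ - T)) t).2 < 0 ∨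
      (glue T η (slide k q l (τ₂ - T)) t).1 < l := by
    intro t h1 h2
    rcases lt_trichotomy t T with h3 | h3 | h3
    · rw [glue_of_le h3.le]
      exact .inl (hηneg t h1 h3)
    · rw [glue_of_le h3.le, h3, hηT]
      exact .inr hd₂
    · rw [glue_of_gt h3]
      exact .inr ((hmono (by linarith)).trans_eq slideX_zero)
  have harc : IsArc (family l m b) (l, 0) (l, 0) (γ '' Ioo 0 (T - τ₂)) := by
    have := isArc_Ioo (Z := family l m b) (show 0 < T - τ₂ by linarith) hc
      ⟨{τ₁, T}, fun t ht h0 => ?_⟩ ?_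
    · rwa [hγ0, hγend] at this
    · simp only [Finset.mem_insert, Finset.mem_singleton, not_or] at h0
      rcases Ne.lt_or_gt h0.1 with h1 | h1
      · refine follows_glue_of_lt (follows_slide hm h hl ?_) h1
        linarith [ht.1]
      · refine follows_glue_of_gt ?_ h1
        rcases Ne.lt_or_gt h0.2 with h2 | h2
        · exact follows_glue_of_lt (follows_orbitY (hηneg t h1 h2)) h2
        · refine follows_glue_of_gt (follows_slide hm h hl ?_) h2
          linarith [ht.2]
    · refine injOn_glue (injective_slide hk hq 0).injOn
        (injOn_glue ?_ (injective_slide hk hq _).injOn ?_) ?_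
      · intro s _ t _ e
        have := injective_orbitY hm.le hu.ne' e
        linarith
      · rintro t ⟨_, ht1⟩ ht t' _ ht' e
        rcases ht.lt_or_eq with h3 | h3
        · have := hηneg t ht1 h3
          rw [e] at this
          exact lt_irrefl _ this
        · rw [h3, hηT] at e
          have e3 := congrArg Prod.fst e
          simp only [slide] at e3
          rw [← hτ₂] at e3
          have := hmono.injective e3
          linarith
      · rintro t ht1 ht t' ht1' ht' e
        have hlt : l < (slide k q l 0 t).1 := by
          rw [slide, add_zero]
          exact slideX_zero.symm.trans_lt (hmono ht1.1)
        rcases hlate t' ht' ht1'.2 with h3 | h3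
        · rw [← e] at h3
          exact lt_irrefl _ h3
        · rw [← e] at h3
          exact lt_asymm hlt h3
  have hd : ((l, 0) : Plane) ∉ γ '' Ioo 0 (T - τ₂) := by
    rintro ⟨t, ht, e⟩
    rcases le_or_gt t τ₁ with h1 | h1
    · rw [hγ, glue_of_le h1, slide, add_zero] at e
      exact (hmono ht.1).ne (slideX_zero.trans (congrArg Prod.fst e).symm)
    · rw [hγ, glue_of_gt h1] at e
      have := hlate t h1 ht.2
      rw [e] at this
      simp at this
  have hwD : w ∈ γ '' Ioo 0 (T - τ₂) := by
    refine ⟨τ₁ - t₁, ⟨by linarith, by linarith⟩, ?_⟩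
    rw [hγ, glue_of_gt (by linarith), glue_of_le (by linarith)]
    simp only [hη]
    rw [show τ₁ - t₁ + (t₁ - τ₁) = 0 by ring, hη0]
  refine ⟨{(l, 0)} ∪ γ '' Ioo 0 (T - τ₂), ?_, .inr hwD, .inl rfl⟩
  refine isSigmaGraphIII_of_isSigmaGraph hm.le hb.ne' hl ?_ ?_ hd₁.ne' (.inr ?_)
  -- There is a single vertex, indexed by `Fin 1`, so `i + 1 = i` and the one arc runs from the
  -- contact to itself.
  · refine ⟨0, fun _ => (l, 0), fun _ => γ '' Ioo 0 (T - τ₂), fun i j _ => Subsingleton.elim (α := Fin 1) i j,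
      fun _ => .inr (.inr (.inr (isTangential_fold hm.le hb.ne' l))), fun _ => harc,
      fun i j hij => absurd (Subsingleton.elim (α := Fin 1) i j) hij, fun _ _ => hd, ?_,
      ⟨(l, 0), .inl rfl, rfl⟩⟩
    rw [range_const, iUnion_const]
  · intro h'
    have : w ∈ switching := h' (.inr hwD)
    exact hw.ne this
  · refine ⟨τ₁, ⟨hτ₁0, by linarith⟩, ?_⟩
    rw [hγ, glue_of_le le_rfl, slide, add_zero, hτ₁]

end Graphs

end FoldSaddle

/-! ### Assembly of the theorem -/

open FoldSaddle in
theorem theorem6 (μ : ℝ) (hμ : μ < 0) :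
    -- the thirteen cases partition the parameter region, and all of them occur near the origin
    (∀ p ∈ params, ∃! k : ℕ, k ∈ Finset.Icc 1 13 ∧ p ∈ cell μ k) ∧
    (∀ k ∈ Finset.Icc 1 13, ∀ δ > 0, ∃ p ∈ cell μ k ∩ params, |p.1| < δ ∧ |p.2| < δ) ∧
    -- there are exactly 13 configurations, one for each case
    {C : Set (ℝ × ℝ) | ∃ p ∈ params, C = {p' ∈ params |
        SameConfiguration (family p.1 μ p.2) (family p'.1 μ p'.2)}} =
      {C | ∃ k ∈ Finset.Icc 1 13, C = cell μ k ∩ params} ∧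
    {C : Set (ℝ × ℝ) | ∃ p ∈ params, C = {p' ∈ params |
        SameConfiguration (family p.1 μ p.2) (family p'.1 μ p'.2)}}.ncard = 13 ∧
    -- there are exactly 7 behaviours, represented by the cases 1, 2, 4, 5, 7, 10, 11
    ((fun p : ℝ × ℝ => behaviour (family p.1 μ p.2)) '' params).ncard = 7 ∧
    (∀ k ∈ Finset.Icc 1 13, ∀ k' ∈ Finset.Icc 1 13,
      ∀ p ∈ cell μ k ∩ params, ∀ p' ∈ cell μ k' ∩ params,
        (behaviour (family p.1 μ p.2) = behaviour (family p'.1 μ p'.2) ↔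
          representative k = representative k')) ∧
    -- the type of a singular point is well defined
    (∀ p ∈ params, ∀ w, IsSingular (family p.1 μ p.2) w →
      ∃! κ : SingKind, HasKind (family p.1 μ p.2) w κ) ∧
    -- description of the phase portraits
    (∀ l b : ℝ, (l, b) ∈ params →
      -- the regions of the line: sliding to the left of both contacts, escaping to the right
      (∀ x : ℝ, (x, 0) ∈ sliding (family l μ b) ↔ x < min l (contact μ b)) ∧
      (∀ x : ℝ, (x, 0) ∈ escaping (family l μ b) ↔ max l (contact μ b) < x) ∧
      (∀ x : ℝ, (x, 0) ∈ sewing (family l μ b) ↔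
        min l (contact μ b) < x ∧ x < max l (contact μ b)) ∧
      -- the fold `d` of `X`
      (∀ w, VisibleX (family l μ b) w ↔ w = (l, 0)) ∧
      (∀ w, ¬ InvisibleX (family l μ b) w) ∧
      -- the fold `e` or `i` of `Y`
      (∀ w, VisibleY (family l μ b) w ↔ b < 0 ∧ w = (contact μ b, 0)) ∧
      (∀ w, InvisibleY (family l μ b) w ↔ 0 < b ∧ w = (contact μ b, 0)) ∧
      -- the saddle `S` of `Y`
      (∀ w, (family l μ b).Y w = 0 ↔ w = (0, -b)) ∧
      IsSaddle (family l μ b).Y (0, -b) ∧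
      (∀ w, IsRealEquilibrium (family l μ b) w ↔ 0 < b ∧ w = (0, -b)) ∧
      -- the separatrices of `S` meet the line at `h` and `j`
      (∀ w, UnstableContact (family l μ b).Y lower w ↔ 0 < b ∧ w = (-b, 0)) ∧
      (∀ w, StableContact (family l μ b).Y lower w ↔ 0 < b ∧ w = (b, 0)) ∧
      -- the additional pseudo equilibrium `Q` is on the right of `d`, `e`, `S`, `i`, `h` and `j`
      IsSigmaSaddle (family l μ b) (absQ l μ b, 0) ∧
      l < absQ l μ b ∧ contact μ b < absQ l μ b ∧ 0 < absQ l μ b ∧ |b| < absQ l μ b ∧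
      -- cases 1 to 6 and 10
      ((b ≤ 0 ∨ l = contact μ b) →
        (∀ w, IsPseudoEquilibrium (family l μ b) w ↔ w = (absQ l μ b, 0)) ∧
        (∀ x : ℝ, (x, 0) ∈ escaping (family l μ b) ∪ sliding (family l μ b) →
          (0 < direction (family l μ b) (x, 0) ↔ x < absQ l μ b))) ∧
      -- cases 7, 8, 9
      ((0 < b ∧ l < contact μ b) →
        (∀ w, IsPseudoEquilibrium (family l μ b) w ↔
          w = (absP l μ b, 0) ∨ w = (absQ l μ b, 0)) ∧
        IsSigmaRepeller (family l μ b) (absP l μ b, 0) ∧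
        contact μ b < absP l μ b ∧ absP l μ b < b ∧
        (∀ x : ℝ, (x, 0) ∈ sliding (family l μ b) → 0 < direction (family l μ b) (x, 0)) ∧
        (∀ x : ℝ, (x, 0) ∈ escaping (family l μ b) →
          (0 < direction (family l μ b) (x, 0) ↔ absP l μ b < x ∧ x < absQ l μ b))) ∧
      -- cases 11, 12, 13
      ((0 < b ∧ contact μ b < l) →
        (∀ w, IsPseudoEquilibrium (family l μ b) w ↔
          w = (absP l μ b, 0) ∨ w = (absQ l μ b, 0)) ∧
        IsSigmaAttractor (family l μ b) (absP l μ b, 0) ∧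
        -b < absP l μ b ∧ absP l μ b < contact μ b ∧
        (∀ x : ℝ, (x, 0) ∈ sliding (family l μ b) →
          (0 < direction (family l μ b) (x, 0) ↔ x < absP l μ b)) ∧
        (∀ x : ℝ, (x, 0) ∈ escaping (family l μ b) →
          (0 < direction (family l μ b) (x, 0) ↔ x < absQ l μ b))) ∧
      -- case 10: the graph through `d = i`, `j`, `S`, `h`, and the graphs that fill its interior
      ((0 < b ∧ l = contact μ b) →
        IsSigmaGraphIII (family l μ b)
          (segment ℝ (-b, 0) (b, 0) ∪ segment ℝ (b, 0) (0, -b) ∪ segment ℝ (0, -b) (-b, 0)) ∧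
        ∀ w : ℝ × ℝ, w.2 < 0 → |w.1| < w.2 + b →
          ∃ D, IsSigmaGraphIII (family l μ b) D ∧ w ∈ D ∧ (l, 0) ∈ D)) ∧
    -- to the left of `Q` one sees the configuration of the same case for `μ = 0`, which has no
    -- pseudo equilibrium of saddle type
    (∀ k ∈ Finset.Icc 1 13, ∀ p ∈ cell μ k ∩ params, ∀ p' ∈ cell 0 k ∩ params,
      (∃ φ : ℝ ≃o Set.Iio (absQ p.1 μ p.2),
        ∀ x, mark (family p.1 μ p.2) (φ x) = mark (family p'.1 0 p'.2) x) ∧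
      (∀ w, ¬ IsSigmaSaddle (family p'.1 0 p'.2) w) ∧
      (∀ x : ℝ, absQ p.1 μ p.2 < x → (x, 0) ∈ escaping (family p.1 μ p.2) ∧
        direction (family p.1 μ p.2) (x, 0) < 0)) := by
  refine ⟨fun p _ => existsUnique_cell hμ.le p, fun k hk δ hδ => exists_mem_cell hμ hk hδ,
    configurationClasses_eq hμ, ?_, ncard_behaviours hμ, fun k hk k' hk' p hp p' hp' =>
      behaviour_eq_iff hμ hk hk' hp hp',
    fun p hp w hw => existsUnique_kind hμ (inParams_of_mem hp) hw, fun l b hp => ?_,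
    fun k hk p hp p' hp' => ⟨?_, not_isSigmaSaddle_zero (inParams_of_mem hp'.2),
      fun x hx => ?_⟩⟩
  · rw [configurationClasses_eq hμ]
    exact ncard_cells hμ
  · have h := inParams_of_mem hp
    have hm := hμ.le
    have hlq := fold_lt_absQ hμ h
    have hcq := contact_lt_absQ hμ h
    have hbq := (absP_lt_abs_lt_absQ hμ h).2
    have hP := position_absP hμ h
    have hpe := isPseudoEquilibrium_iff hμ h
    have hne := numer_neg_iff hμ h
    have hpo := numer_pos_iff hμ h
    refine ⟨fun x => (mem_sliding_iff hm x).trans lt_min_iff.symm,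
      fun x => (mem_escaping_iff hm x).trans max_lt_iff.symm, mem_sewing_iff hm, visibleX_iff,
      not_invisibleX, visibleY_iff hm, invisibleY_iff hm, family_Y_eq_zero_iff hm,
      isSaddle_family_Y hm, isRealEquilibrium_iff hm, unstableContact_iff hm,
      stableContact_iff hm, (isSigmaSaddle_iff hμ h _).2 rfl, hlq, hcq,
      (abs_nonneg b).trans_lt hbq, hbq, fun hc => ⟨fun w => ?_, fun x hx => ?_⟩,
      fun ⟨hb, hl⟩ => ⟨fun w => ?_, (isSigmaRepeller_iff hμ h _).2 ⟨hb, hl, rfl⟩,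
        hP.pos_of_lt hb hl, (hP.zero_range hb).2, fun x hx => ?_, fun x hx => ?_⟩,
      fun ⟨hb, hl⟩ => ⟨fun w => ?_, (isSigmaAttractor_iff hμ h _).2 ⟨hb, hl, rfl⟩,
        (hP.zero_range hb).1, hP.pos_of_gt hb hl, fun x hx => ?_, fun x hx => ?_⟩,
      fun ⟨hb, hl⟩ => ⟨isSigmaGraphIII_triangle hμ h hb hl,
        fun w hw hw' => exists_isSigmaGraphIII hμ h hl hw hw'⟩⟩
    · rw [hpe, or_iff_left]
      rintro ⟨hb, hl, -⟩
      exact hc.elim hb.not_ge hl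
    · rw [mem_escaping_or_sliding_iff hm] at hx
      -- Here `absP` lies weakly between the contacts, so it is to the left of every escaping point
      -- and to the right of every sliding point; only the position relative to `absQ` matters.
      have he := hP.escaping_iff
      have hs := hP.sliding_iff
      have hz := hP.of_zero
      have hn := hP.neg_of_lt
      have hn' := hP.neg_of_gt
      have heq := hP.of_eq
      rcases hx with ⟨h1, h2⟩ | ⟨h1, h2⟩
      · rw [direction_pos_escaping hm h1 h2, hne]
        grind
      · rw [direction_pos_sliding hm h1 h2, hpo]
        grind
    · rw [hpe, or_comm]
      simp only [hb, hl.ne, true_and, ne_eq, not_false_eq_true]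
    · rw [mem_sliding_iff hm] at hx
      rw [direction_pos_sliding hm hx.1 hx.2, hpo]
      exact .inl (hx.2.trans (hP.pos_of_lt hb hl))
    · rw [mem_escaping_iff hm] at hx
      rw [direction_pos_escaping hm hx.1 hx.2, hne]
    · rw [hpe, or_comm]
      simp only [hb, hl.ne', true_and, ne_eq, not_false_eq_true]
    · rw [mem_sliding_iff hm] at hx
      rw [direction_pos_sliding hm hx.1 hx.2, hpo, or_iff_left (hx.1.trans hlq).not_gt]
    · rw [mem_escaping_iff hm] at hx
      rw [direction_pos_escaping hm hx.1 hx.2, hne,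
        and_iff_right ((hP.pos_of_gt hb hl).trans hx.2)]
  · refine exists_orderIso_Iio_of_sameOrder hμ (inParams_of_mem hp.2) (inParams_of_mem hp'.2)
      (sameOrder_of_caseIndex_eq hμ.le le_rfl ?_)
    rw [caseIndex_of_mem_cell hμ.le hk hp.1, caseIndex_of_mem_cell le_rfl hk hp'.1]
  · have h := inParams_of_mem hp.2
    have h1 := (fold_lt_absQ hμ h).trans hx
    have h2 := (contact_lt_absQ hμ h).trans hx
    refine ⟨(mem_escaping_iff hμ.le x).2 ⟨h1, h2⟩, ?_⟩
    rw [direction_neg_escaping hμ.le h1 h2, numer_pos_iff hμ h]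
    exact .inr hx
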